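/- All graphs are finite, simple, connected and non-empty. A strong rainbow $k$-colouring of $G$ ($k\ge 0$) is a map $c:E(G)\to\{1,\dots,k\}$ (not necessarily proper) such that every two vertices are joined by a shortest path no two of whose edges have the same colour; $src(G)$ is the least $k$ for which one exists. A cactus is a graph in which every edge lies in at most one cycle; it is odd if it has no cycle of even length. For an edge $e=ab$ of an odd cycle $C$ in $G$, a vertex $v$ of $C$ is antipodal to $e$ if $d(v,a)=d(v,b)$. For an odd cactus $G$ put: $n=|V(G)|$; $m=|E(G)|$; $E_{\mathrm{cut}}$ is the set of cut edges; $E_{\mathrm{ant}}$ is the set of edges $e$ lying on a cycle whose antipodal vertex on that cycle is a cut vertex of $G$. A cycle segment of $G$ is a non-empty contiguous part $x_j x_{j+1}\dots x_{j+k}$ of the alternating sequence of vertices and edges $x_1x_2\dots x_{2\ell+1}$ of a cycle of length $\ell$ in $G$, traversed once from a cut vertex $x_1=x_{2\ell+1}$ of $G$, such that none of $x_j,\dots,x_{j+k}$ is a cut vertex or an edge of $E_{\mathrm{ant}}$, while each of the two boundary elements $x_{j-1}$ and $x_{j+k+1}$ is a cut vertex or an edge of $E_{\mathrm{ant}}$.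 $\mathcal S_1$ is the set of cycle segments both of whose boundary elements are cut vertices; segments that differ only in the direction of traversal are identified. Then for every odd cactus $G$ $$src(G)=\begin{cases}\tfrac12\big(m+|E_{\mathrm{cut}}|+|\mathcal S_1|-|E_{\mathrm{ant}}|\big), & G\text{ is not an odd cycle},\\ (n+1)/2, & G=C_n,\ n\ge 5,\\ 1, & G=C_3.\end{cases}$$ Moreover, the right-hand side can be evaluated in linear time: there are a program for a random access machine (with unit-cost steps: copying, successor and predecessor, indirect loads and stores, and comparison tests) and a constant $C$ such that, for every odd cactus $G$ on $n$ vertices given by adjacency lists, the program halts after at most $Cn$ steps with the value of the formula as its output. -/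

import Mathlib

namespace OddCactus

section Graphs

variable {V : Type*}

/-- An edge colouring `c : E(G) → {1, …, k}` is a strong rainbow colouring if any two vertices are
joined by a shortest path no two edges of which have the same colour. -/
def IsStrongRainbow (G : SimpleGraph V) {k : ℕ} (c : G.edgeSet → Fin k) : Prop :=
  ∀ u v : V, ∃ p : G.Walk u v, p.IsPath ∧ p.length = G.dist u v ∧
    ∀ e f : G.edgeSet, (e : Sym2 V) ∈ p.edges → (f : Sym2 V) ∈ p.edges → c e = c f → e = f

/-- The strong rainbow connection number: the least `k` admitting a strong rainbow `k`-colouring.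
For a finite connected graph the set below is nonempty (colour all edges differently). -/
noncomputable def src (G : SimpleGraph V) : ℕ :=
  sInf {k : ℕ | ∃ c : G.edgeSet → Fin k, IsStrongRainbow G c}

/-- A (connected) graph is a cactus if each edge lies in at most one cycle. Two closed walks that
are cycles describe the same cycle if they have the same set of edges. -/
def IsCactus (G : SimpleGraph V) : Prop :=
  G.Connected ∧
    ∀ (u v : V) (c : G.Walk u u) (d : G.Walk v v), c.IsCycle → d.IsCycle →
      (∃ e, e ∈ c.edges ∧ e ∈ d.edges) → ∀ f, f ∈ c.edges ↔ f ∈ d.edges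

/-- An odd cactus: a cactus without cycles of even length. -/
def IsOddCactus (G : SimpleGraph V) : Prop :=
  IsCactus G ∧ ∀ (u : V) (c : G.Walk u u), c.IsCycle → Odd c.length

/-- `v` is a cut vertex if `G - v` has strictly more components than `G` (for finite `G`). -/
def IsCutVertex (G : SimpleGraph V) (v : V) : Prop :=
  Nat.card G.ConnectedComponent < Nat.card (G.induce ({v}ᶜ : Set V)).ConnectedComponent

/-- The set `E_cut` of cut edges. -/
def cutEdges (G : SimpleGraph V) : Set (Sym2 V) :=
  {e | e ∈ G.edgeSet ∧ G.IsBridge e}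

/-- The vertex `v` is antipodal to the edge `e`: both lie on a common odd cycle, and `v` is at the
same distance from the two ends of `e`. -/
def IsAntipodal (G : SimpleGraph V) (v : V) (e : Sym2 V) : Prop :=
  ∃ (w : V) (c : G.Walk w w), c.IsCycle ∧ Odd c.length ∧ v ∈ c.support ∧ e ∈ c.edges ∧
    ∀ a ∈ e, ∀ b ∈ e, G.dist v a = G.dist v b

/-- The set `E_ant` of edges whose antipodal vertex is a cut vertex. -/
def antEdges (G : SimpleGraph V) : Set (Sym2 V) :=
  {e | e ∈ G.edgeSet ∧ ∃ v, IsAntipodal G v e ∧ IsCutVertex G v}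

/-- The alternating sequence `vertex, edge, vertex, …, edge, vertex` of a walk. -/
def trace {G : SimpleGraph V} : {u v : V} → G.Walk u v → List (V ⊕ Sym2 V)
  | u, _, .nil => [Sum.inl u]
  | u, _, .cons (v := x) _ p => Sum.inl u :: Sum.inr s(u, x) :: trace p

/-- Membership of a vertex or an edge in (cut vertices) `∪ E_ant`. -/
def IsMarked (G : SimpleGraph V) : V ⊕ Sym2 V → Prop
  | Sum.inl v => IsCutVertex G v
  | Sum.inr e => e ∈ antEdges G

/-- `l` is a cycle segment of the closed walk `c`, with boundary elements `x` and `y`: it is a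
nonempty contiguous subsequence of the alternating sequence of `c` without marked elements,
and the elements `x`, `y` just before and just after it are marked. -/
def IsCycleSegment (G : SimpleGraph V) {w : V} (c : G.Walk w w)
    (x : V ⊕ Sym2 V) (l : List (V ⊕ Sym2 V)) (y : V ⊕ Sym2 V) : Prop :=
  l ≠ [] ∧ (x :: l ++ [y]) <:+: trace c ∧ IsMarked G x ∧ IsMarked G y ∧ ∀ z ∈ l, ¬ IsMarked G z

/-- The set `𝒮₁` of those cycle segments of `G` (in any cycle, traversed from a cut vertex on it)
whose two boundary elements are cut vertices. A segment is identified with the set of its vertices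
and edges, so that the direction in which the cycle is traversed does not matter. -/
def segments₁ (G : SimpleGraph V) : Set (Set (V ⊕ Sym2 V)) :=
  {S | ∃ (w : V) (c : G.Walk w w) (u v : V) (l : List (V ⊕ Sym2 V)),
    c.IsCycle ∧ IsCutVertex G w ∧ IsCycleSegment G c (Sum.inl u) l (Sum.inl v) ∧ S = {z | z ∈ l}}

/-- `G` is (isomorphic to) the cycle on `n` vertices. -/
def IsCycleOfLength (G : SimpleGraph V) (n : ℕ) : Prop :=
  3 ≤ n ∧ Nonempty (G ≃g SimpleGraph.cycleGraph n)

open Classical in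
/-- The value of the formula: `(m + |E_cut| + |𝒮₁| - |E_ant|) / 2` if `G` is not an odd cycle, and
`1` for the triangle, `(n + 1) / 2` for longer odd cycles. -/
noncomputable def formula (G : SimpleGraph V) : ℚ :=
  if Odd (Nat.card V) ∧ IsCycleOfLength G (Nat.card V) then
    if Nat.card V = 3 then 1 else ((Nat.card V : ℚ) + 1) / 2
  else
    ((G.edgeSet.ncard : ℚ) + ((cutEdges G).ncard : ℚ) + ((segments₁ G).ncard : ℚ)
      - ((antEdges G).ncard : ℚ)) / 2

end Graphs

section Machine

/-- A memory state of a random access machine: registers, and arrays of cells (a program can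
refer only to finitely many registers and arrays by name; cells are addressed indirectly). -/
structure State where
  reg : ℕ → ℕ
  arr : ℕ → ℕ → ℕ

/-- Tests: comparisons of two registers. -/
inductive Test
  | eq (r s : ℕ)
  | ne (r s : ℕ)
  | lt (r s : ℕ)

def Test.holds (σ : State) : Test → Prop
  | .eq r s => σ.reg r = σ.reg s
  | .ne r s => σ.reg r ≠ σ.reg s
  | .lt r s => σ.reg r < σ.reg s

/-- Basic instructions. The only arithmetic is successor and predecessor, so that a run of `t`
steps produces no number exceeding the constants in the program and the numbers in the input by
more than `t`. -/
inductive Instr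
  | const (r k : ℕ)
  | move (r s : ℕ)
  | inc (r : ℕ)
  | dec (r : ℕ)
  /-- register `r` gets the content of cell number (register `i`) of array `a` -/
  | load (r a i : ℕ)
  /-- cell number (register `i`) of array `a` gets the content of register `r` -/
  | store (a i r : ℕ)

def State.setReg (σ : State) (r x : ℕ) : State :=
  { σ with reg := Function.update σ.reg r x }

def State.setCell (σ : State) (a i x : ℕ) : State :=
  { σ with arr := Function.update σ.arr a (Function.update (σ.arr a) i x) }

def Instr.run (σ : State) : Instr → State
  | .const r k => σ.setReg r k
  | .move r s => σ.setReg r (σ.reg s)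
  | .inc r => σ.setReg r (σ.reg r + 1)
  | .dec r => σ.setReg r (σ.reg r - 1)
  | .load r a i => σ.setReg r (σ.arr a (σ.reg i))
  | .store a i r => σ.setCell a (σ.reg i) (σ.reg r)

/-- Programs. -/
inductive Prog
  | instr (i : Instr)
  | seq (p q : Prog)
  | ite (b : Test) (p q : Prog)
  | loop (b : Test) (p : Prog)

/-- `Exec p σ t τ`: started in state `σ`, the program `p` halts in state `τ` after exactly `t` steps;
each basic instruction and each evaluation of a test is one step. -/
inductive Exec : Prog → State → ℕ → State → Prop
  | instr (i : Instr) (σ : State) : Exec (.instr i) σ 1 (i.run σ)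
  | seq {p q : Prog} {σ τ ρ : State} {s t : ℕ} :
      Exec p σ s τ → Exec q τ t ρ → Exec (.seq p q) σ (s + t) ρ
  | iteTrue {b : Test} {p q : Prog} {σ τ : State} {t : ℕ} :
      b.holds σ → Exec p σ t τ → Exec (.ite b p q) σ (t + 1) τ
  | iteFalse {b : Test} {p q : Prog} {σ τ : State} {t : ℕ} :
      ¬ b.holds σ → Exec q σ t τ → Exec (.ite b p q) σ (t + 1) τ
  | loopStop {b : Test} {p : Prog} {σ : State} :
      ¬ b.holds σ → Exec (.loop b p) σ 1 σ
  | loopStep {b : Test} {p : Prog} {σ τ ρ : State} {s t : ℕ} :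
      b.holds σ → Exec p σ s τ → Exec (.loop b p) τ t ρ → Exec (.loop b p) σ (s + t + 1) ρ

/-- `adj` is an adjacency-list representation of `G`: `adj v` lists the neighbours of `v`, each
once, in any order. -/
def IsAdjList {n : ℕ} (G : SimpleGraph (Fin n)) (adj : Fin n → List (Fin n)) : Prop :=
  ∀ v, (adj v).Nodup ∧ ∀ w, w ∈ adj v ↔ G.Adj v w

/-- The input state for a graph on `{0, …, n - 1}`: register `0` holds `n`; array `1` holds the
concatenation of the lists `adj 0, …, adj (n - 1)`; cell `i ≤ n` of array `0` holds the position
in array `1` at which the list of vertex `i` starts (for `i = n`: the total length).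
Everything else is `0`. -/
def inputState {n : ℕ} (adj : Fin n → List (Fin n)) : State where
  reg r := if r = 0 then n else 0
  arr a i :=
    if a = 0 then
      if i ≤ n then (((List.ofFn adj).take i).flatten).length else 0
    else if a = 1 then
      (((List.ofFn adj).flatten.map Fin.val)[i]?).getD 0
    else 0

end Machine

end OddCactus

/-! Call a vertex equidistant from an edge if it has the same distance to both ends (`Eqd`).
Everything rests on one dichotomy for two distinct edges `e`, `f`. If no end of either is
equidistant from the other, both edges lie on every geodesic between suitable ends, because
geodesics are unique without even cycles (`exists_forall_geodesic_mem`), so they need different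
colours. Otherwise no geodesic contains both (`not_eqd_of_geodesic`), and they may share a colour.

An odd cycle is parametrised by ℤ/(2k+1) with neighbouring vertices differing by `2`. Then `E p = {v
(p - 1), v (p + 1)}` is the edge opposite to `v p`, a step in the alternating sequence of vertices
and edges advances the parameter by one, and a vertex is equidistant from `E p` exactly when it
projects to `v p`. A position `p` is marked if `v p` is a cut vertex, equivalently if `E p` is in
`E_ant`.

If `G` is not a cycle, each cycle has a marked position. In every run of unmarked positions, select
every other one, beginning with the first. The cut edges and the edges at selected positions form
the set `key`. Any two of them need different colours. Conversely every other edge can take a colour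
from `key`: at an unmarked position that of its predecessor, at a marked one that of a key edge
hanging behind the cut vertex. Hence `src G` is the size of `key` (`src_eq`). The unmarked runs of
odd length are the segments in `𝒮₁`, and counting positions gives the formula (`formula_count`). On
a cycle, colour classes consist of edges at pairwise consecutive positions.

For the algorithm, fix a root of degree other than two. Breadth-first search finds the horizontal
edges, whose ends are equally far from the root; each cycle has exactly one. Then `key` has `n - 1`
elements minus the number of unselected positions other than the bases of the cycles, the base being
the projection of the root. Climbing the two sides of each cycle alternately produces the positions
in the order of the greedy choice. -/

namespace OddCactus

/-! ### Retractions through which all walks must pass -/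

section Gates

variable {V : Type*} {G : SimpleGraph V}

/-- A retraction of `G` onto a family `v` of vertices such that an edge that is not contracted has
both ends in the family. -/
structure Gate (G : SimpleGraph V) (I : Type*) where
  v : I → V
  π : V → I
  π_v : ∀ i, π (v i) = i
  adj : ∀ {x y}, G.Adj x y → π x = π y ∨ (x = v (π x) ∧ y = v (π y))

namespace Gate

variable {I : Type*} (C : Gate G I)

/-- The projection changes only along an edge with both ends in the family, so a walk leaves the
fibre of `x` from `C.v (C.π x)`. -/
theorem mem_support {x y : V} (p : G.Walk x y) (h : C.π x ≠ C.π y ∨ y = C.v (C.π x)) :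
    C.v (C.π x) ∈ p.support := by
  induction p with
  | nil => 
    rcases h with h | h
    · exact absurd rfl h
    · simp [← h]
  | @cons x z y hxz p ih =>
    rcases C.adj hxz with e | ⟨e, -⟩
    · rw [e] at h ⊢
      exact List.mem_cons_of_mem _ (ih h)
    · rw [← e]; simp

theorem dist_add_of_mem_geodesic {x y m : V} (hG : G.Connected)
    (h : ∀ p : G.Walk x y, m ∈ p.support) : G.dist x y = G.dist x m + G.dist m y := by
  classical
  refine le_antisymm (hG.dist_triangle) ?_
  obtain ⟨p, hp⟩ := hG.exists_walk_length_eq_dist x y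
  have h1 := SimpleGraph.dist_le (p.takeUntil m (h p))
  have h2 := SimpleGraph.dist_le (p.dropUntil m (h p))
  have h3 := congrArg SimpleGraph.Walk.length (p.take_spec (h p))
  rw [SimpleGraph.Walk.length_append] at h3
  omega

theorem dist_v (hG : G.Connected) (x : V) (i : I) :
    G.dist x (C.v i) = G.dist x (C.v (C.π x)) + G.dist (C.v (C.π x)) (C.v i) :=
  dist_add_of_mem_geodesic hG fun p => C.mem_support p (by
    rw [C.π_v]
    by_cases h : C.π x = i
    · right; rw [h]
    · left; exact h)

theorem dist_ne (hG : G.Connected) {x y : V} (h : C.π x ≠ C.π y) :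
    G.dist x y = G.dist x (C.v (C.π x)) + G.dist (C.v (C.π x)) (C.v (C.π y))
      + G.dist (C.v (C.π y)) y := by
  rw [dist_add_of_mem_geodesic hG fun p => C.mem_support p (.inl h),
    G.dist_comm (u := C.v (C.π x)) (v := y), C.dist_v hG y, G.dist_comm (u := y),
    G.dist_comm (u := C.v (C.π y)) (v := C.v (C.π x))]
  omega

theorem eq_of_adj_of_ne {x y : V} (h : G.Adj x y) (hx : x ≠ C.v (C.π x)) : C.π y = C.π x := by
  rcases C.adj h with e | ⟨e, -⟩
  · exact e.symm
  · exact absurd e hx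

end Gate

open Classical in
/-- The retraction onto the two ends of a bridge. -/
noncomputable def bridgeGate {a b : V} (h : G.IsBridge s(a, b)) : Gate G Bool where
  v i := if i then a else b
  π x := decide ((G.deleteEdges {s(a, b)}).Reachable x a)
  π_v i := by
    rw [SimpleGraph.isBridge_iff] at h
    cases i
    · simpa using fun h' : (G.deleteEdges _).Reachable _ _ => h h'.symm
    · simp
  adj {x y} hxy := by
    rw [SimpleGraph.isBridge_iff] at h
    by_cases e : s(x, y) = s(a, b)
    · right
      rcases Sym2.eq_iff.1 e with ⟨rfl, rfl⟩ | ⟨rfl, rfl⟩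
      · simpa using fun h' : (G.deleteEdges {s(x, y)}).Reachable y x => (absurd h'.symm h : y = x)
      · simpa using fun h' : (G.deleteEdges {s(y, x)}).Reachable x y => (absurd h'.symm h : x = y)
    · left
      have : (G.deleteEdges {s(a, b)}).Adj x y := by
        rw [SimpleGraph.deleteEdges_adj]
        exact ⟨hxy, e⟩
      rw [decide_eq_decide]
      exact ⟨fun h => this.symm.reachable.trans h, fun h => this.reachable.trans h⟩

end Gates

/-! ### Halving modulo an odd number -/

section ZModLemmas

variable {k : ℕ}

/-- The inverse of `2`: multiplying a parameter by `k + 1` converts steps of `2` into the order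
along the cycle. -/
theorem half_mul_two (k : ℕ) : ((k : ZMod (2 * k + 1)) + 1) * 2 = 1 := by
  have := ZMod.natCast_self (2 * k + 1)
  push_cast at this
  linear_combination this

theorem two_mul_cancel {x y : ZMod (2 * k + 1)} (h : 2 * x = 2 * y) : x = y := by
  linear_combination ((k : ZMod (2 * k + 1)) + 1) * h - (x - y) * half_mul_two k

theorem cast_inj_of_lt {i j : ℕ} (hi : i < 2 * k + 1) (hj : j < 2 * k + 1)
    (h : (i : ZMod (2 * k + 1)) = j) : i = j := by
  rw [ZMod.natCast_eq_natCast_iff'] at h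
  rwa [Nat.mod_eq_of_lt hi, Nat.mod_eq_of_lt hj] at h

theorem one_ne_zero_zmod (hk : 1 ≤ k) : (1 : ZMod (2 * k + 1)) ≠ 0 := by
  intro h
  have := cast_inj_of_lt (k := k) (i := 1) (j := 0) (by omega) (by omega) (by simpa using h)
  omega

theorem exists_eq_two_mul (x : ZMod (2 * k + 1)) : ∃ j < 2 * k + 1, x = 2 * (j : ℕ) := by
  refine ⟨(x * (k + 1)).val, ZMod.val_lt _, ?_⟩
  rw [ZMod.natCast_zmod_val]
  linear_combination -x * half_mul_two k

end ZModLemmas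

/-! ### Odd cycles parametrised with step two -/

section Charts

variable {V : Type*} {G : SimpleGraph V}

/-- A parametrization of an odd cycle in which consecutive vertices of the cycle have parameters
that differ by `2`. -/
structure CycleParam (G : SimpleGraph V) where
  k : ℕ
  hk : 1 ≤ k
  v : ZMod (2 * k + 1) → V
  inj : Function.Injective v
  step : ∀ p, G.Adj (v p) (v (p + 2))

namespace CycleParam

variable (C : CycleParam G)

/-- The edge opposite to the vertex `v p`. -/
def E (p : ZMod (2 * C.k + 1)) : Sym2 V := s(C.v (p - 1), C.v (p + 1))

theorem E_mem (p) : C.E p ∈ G.edgeSet := by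
  have := C.step (p - 1)
  rw [show p - 1 + 2 = p + 1 by ring] at this
  exact this

theorem E_add_one (p) : C.E (p + 1) = s(C.v p, C.v (p + 2)) := by
  rw [E, show p + 1 - 1 = p by ring, show p + 1 + 1 = p + 2 by ring]

theorem E_injective : Function.Injective C.E := by
  intro p q h
  rcases Sym2.eq_iff.1 h with ⟨h1, -⟩ | ⟨h1, h2⟩
  · have := C.inj h1
    linear_combination this
  · have h1 := C.inj h1
    have h2 := C.inj h2
    have : (2 : ZMod (2 * C.k + 1)) * (2 * 1) = 2 * (2 * 0) := by linear_combination h2 - h1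
    exact absurd (two_mul_cancel (two_mul_cancel this)) (one_ne_zero_zmod C.hk)

theorem exists_walk (p : ZMod (2 * C.k + 1)) (n : ℕ) : ∀ q, q = p + 2 * n →
    ∃ W : G.Walk (C.v p) (C.v q), W.length = n ∧ ∀ i ≤ n, W.getVert i = C.v (p + 2 * i) := by
  induction n generalizing p with
  | zero =>
    rintro q rfl
    exact ⟨SimpleGraph.Walk.nil.copy rfl (by simp), by simp, fun i hi => by
      obtain rfl : i = 0 := by omega
      simp⟩
  | succ n ih =>
    rintro q rfl
    obtain ⟨W, h1, h2⟩ := ih (p + 2) (p + 2 * (n + 1 : ℕ)) (by push_cast; ring)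
    refine ⟨.cons (C.step p) W, by simp [h1], fun i hi => ?_⟩
    cases i with
    | zero => simp
    | succ i =>
      rw [SimpleGraph.Walk.getVert_cons_succ, h2 i (by omega)]
      congr 1; push_cast; ring

theorem exists_cycle (p : ZMod (2 * C.k + 1)) :
    ∃ W : G.Walk (C.v p) (C.v p), W.IsCycle ∧ W.length = 2 * C.k + 1 ∧
      ∀ i ≤ 2 * C.k + 1, W.getVert i = C.v (p + 2 * i) := by
  have hz := ZMod.natCast_self (2 * C.k + 1)
  push_cast at hz
  -- After the first edge, `2k` further steps of `2` complete `2 (2k + 1) = 0`.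
  obtain ⟨W, h1, h2⟩ := C.exists_walk (p + 2) (2 * C.k) p (by push_cast; linear_combination -2 * hz)
  have inj2 : ∀ i j : ℕ, i < 2 * C.k + 1 → j < 2 * C.k + 1 →
      C.v (p + 2 + 2 * i) = C.v (p + 2 + 2 * j) → i = j := fun i j hi hj h =>
    cast_inj_of_lt hi hj (two_mul_cancel (add_left_cancel (C.inj h)))
  refine ⟨.cons (C.step p) W, ?_, by simp [h1], fun i hi => ?_⟩
  · rw [SimpleGraph.Walk.cons_isCycle_iff]
    constructor
    · rw [← SimpleGraph.Walk.IsPath.getVert_injOn_iff]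
      intro i hi j hj h
      simp only [Set.mem_ofPred_eq, h1] at hi hj
      rw [h2 i hi, h2 j hj] at h
      exact inj2 i j (by omega) (by omega) h
    · intro h
      rw [SimpleGraph.Walk.mk_mem_edges_iff_exists] at h
      obtain ⟨i, hi, h⟩ := h
      rw [h1] at hi
      rw [h2 i (by omega), h2 (i + 1) (by omega), ← C.E_add_one,
        show p + 2 + 2 * ((i + 1 : ℕ) : ZMod (2 * C.k + 1)) = p + 2 + 2 * i + 2 by push_cast; ring,
        ← C.E_add_one] at h
      have h := C.E_injective h
      have : ((i + 1 : ℕ) : ZMod (2 * C.k + 1)) = (0 : ℕ) := by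
        apply two_mul_cancel
        push_cast
        linear_combination h
      have := cast_inj_of_lt (by omega) (by omega) this
      omega
  · cases i with
    | zero => simp
    | succ i =>
      rw [SimpleGraph.Walk.getVert_cons_succ, h2 i (by omega)]
      congr 1; push_cast; ring

theorem mem_edges_cycle {p : ZMod (2 * C.k + 1)} {W : G.Walk (C.v p) (C.v p)}
    (hl : W.length = 2 * C.k + 1) (hW : ∀ i ≤ 2 * C.k + 1, W.getVert i = C.v (p + 2 * i))
    (e : Sym2 V) : e ∈ W.edges ↔ ∃ q, e = C.E q := by
  induction e with | _ a b =>
  rw [SimpleGraph.Walk.mk_mem_edges_iff_exists]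
  constructor
  · rintro ⟨i, hi, h⟩
    rw [hl] at hi
    refine ⟨p + 2 * i + 1, ?_⟩
    rw [← h, hW i (by omega), hW (i + 1) (by omega), C.E_add_one]
    rw [show p + 2 * ((i + 1 : ℕ) : ZMod (2 * C.k + 1)) = p + 2 * i + 2 by push_cast; ring]
  · rintro ⟨q, h⟩
    obtain ⟨i, hi, h'⟩ := exists_eq_two_mul (q - 1 - p)
    refine ⟨i, by omega, ?_⟩
    obtain rfl : q = p + 2 * i + 1 := by linear_combination h'
    rw [h, hW i (by omega), hW (i + 1) (by omega), C.E_add_one]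
    rw [show p + 2 * ((i + 1 : ℕ) : ZMod (2 * C.k + 1)) = p + 2 * i + 2 by push_cast; ring]

end CycleParam

end Charts
end OddCactus

namespace OddCactus

/-! ### Cycles of a cactus and the projections onto them -/

section Charts

variable {V : Type*} {G : SimpleGraph V}

theorem exists_cycleParam {u : V} (c : G.Walk u u) (hc : c.IsCycle) (ho : Odd c.length) :
    ∃ C : CycleParam G, ∀ e, e ∈ c.edges ↔ ∃ q, e = C.E q := by
  obtain ⟨k, hk⟩ := ho
  have h3 := hc.three_le_length
  -- Halving the parameter makes `2 i` the parameter of the `i`-th vertex of `c`.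
  let v : ZMod (2 * k + 1) → V := fun p => c.getVert (p * (k + 1)).val
  have hv : ∀ i ≤ 2 * k + 1, v (2 * (i : ℕ)) = c.getVert i := by
    intro i hi
    have : (2 * (i : ℕ) : ZMod (2 * k + 1)) * (k + 1) = (i : ℕ) := by
      linear_combination i * half_mul_two k
    simp only [v, this, ZMod.val_natCast]
    rcases hi.lt_or_eq with hi | rfl
    · rw [Nat.mod_eq_of_lt hi]
    · rw [Nat.mod_self, ← hk]; simp
  have hv2 : ∀ i < 2 * k + 1, v (2 * (i : ℕ) + 2) = c.getVert (i + 1) := by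
    intro i hi
    rw [← hv (i + 1) (by omega)]
    congr 1; push_cast; ring
  let C : CycleParam G :=
    { k := k
      hk := by omega
      v := v
      inj := by
        intro p q h
        obtain ⟨i, hi, rfl⟩ := exists_eq_two_mul p
        obtain ⟨j, hj, rfl⟩ := exists_eq_two_mul q
        rw [hv i (by omega), hv j (by omega)] at h
        rw [hc.getVert_injOn' (by simp only [Set.mem_ofPred_eq]; omega)
          (by simp only [Set.mem_ofPred_eq]; omega) h]
      step := by
        intro p
        obtain ⟨i, hi, rfl⟩ := exists_eq_two_mul p
        rw [hv i (by omega), hv2 i hi]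
        exact c.adj_getVert_succ (by omega) }
  refine ⟨C, fun e => ?_⟩
  induction e with | _ a b =>
  rw [SimpleGraph.Walk.mk_mem_edges_iff_exists]
  constructor
  · rintro ⟨i, hi, h⟩
    rw [hk] at hi
    refine ⟨2 * (i : ℕ) + 1, ?_⟩
    rw [← h, C.E_add_one, ← hv i (by omega), ← hv2 i hi]
  · rintro ⟨q, h⟩
    obtain ⟨i, hi, h'⟩ := exists_eq_two_mul (k := k) (q - 1)
    refine ⟨i, by omega, ?_⟩
    obtain rfl : q = 2 * (i : ZMod (2 * k + 1)) + 1 := by linear_combination h'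
    rw [h, C.E_add_one, ← hv i (by omega), ← hv2 i hi]

theorem CycleParam.edges_subset (hG : IsCactus G) (C D : CycleParam G) {p p'}
    (h : C.E p = D.E p') (q) : ∃ q', C.E q = D.E q' := by
  obtain ⟨W, h1, h2, h3⟩ := C.exists_cycle 0
  obtain ⟨W', h1', h2', h3'⟩ := D.exists_cycle 0
  rw [← D.mem_edges_cycle h2' h3']
  refine (hG.2 _ _ W W' h1 h1' ⟨C.E p, ?_, ?_⟩ _).1 ?_
  · rw [C.mem_edges_cycle h2 h3]; exact ⟨p, rfl⟩
  · rw [D.mem_edges_cycle h2' h3']; exact ⟨p', h⟩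
  · rw [C.mem_edges_cycle h2 h3]; exact ⟨q, rfl⟩

/-- Two edges of a cycle of a cactus separate. -/
theorem isBridge_deleteEdges (hG : IsCactus G) (C : CycleParam G) {p q} (hpq : p ≠ q) :
    (G.deleteEdges {C.E q}).IsBridge (C.E p) := by
  have hne : C.E p ≠ C.E q := fun h => hpq (C.E_injective h)
  rw [SimpleGraph.isBridge_iff_forall_cycle_notMem (by
    rw [SimpleGraph.edgeSet_deleteEdges]; exact ⟨C.E_mem p, hne⟩)]
  intro u D hD hp
  have hle : G.deleteEdges {C.E q} ≤ G := SimpleGraph.deleteEdges_le _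
  obtain ⟨W, h1, h2, h3⟩ := C.exists_cycle 0
  have := (hG.2 _ _ W (D.mapLe hle) h1 (hD.mapLe hle) ⟨C.E p, by
    rw [C.mem_edges_cycle h2 h3]; exact ⟨p, rfl⟩, by simpa using hp⟩ (C.E q)).1 (by
    rw [C.mem_edges_cycle h2 h3]; exact ⟨q, rfl⟩)
  have := D.edges_subset_edgeSet (by simpa using this)
  rw [SimpleGraph.edgeSet_deleteEdges] at this
  exact this.2 rfl

/-- A connection outside the cycle, followed by an arc of the cycle, would join the ends of `E (p +
1)` while avoiding both `E (p + 1)` and `E (q + 1)`, although the former is a bridge once the latter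
is deleted. -/
theorem not_reachable_of_ne (hG : IsCactus G) (C : CycleParam G) {p q} (hpq : p ≠ q) :
    ¬ (G.deleteEdges (Set.range C.E)).Reachable (C.v p) (C.v q) := by
  intro h
  obtain ⟨j, hj, hj'⟩ := exists_eq_two_mul (q - p)
  obtain rfl : q = p + 2 * j := by linear_combination hj'
  have hj0 : j ≠ 0 := by rintro rfl; simp at hpq
  have hb := isBridge_deleteEdges hG C (p := p + 1) (q := p + 2 * j + 1)
    (fun h => hpq (add_right_cancel h))
  rw [C.E_add_one p, SimpleGraph.isBridge_iff] at hb
  apply hb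
  rw [SimpleGraph.deleteEdges_deleteEdges]
  have hr : ∀ i, 1 ≤ i → i ≤ j →
      (G.deleteEdges ({C.E (p + 2 * j + 1)} ∪ {s(C.v p, C.v (p + 2))})).Reachable (C.v (p + 2))
        (C.v (p + 2 * i)) := by
    intro i hi
    induction i, hi using Nat.le_induction with
    | base => simp
    | succ i hi ih =>
      intro hij
      refine (ih (by omega)).trans (SimpleGraph.Adj.reachable ?_)
      rw [SimpleGraph.deleteEdges_adj,
        show p + 2 * ((i + 1 : ℕ) : ZMod (2 * C.k + 1)) = p + 2 * i + 2 by push_cast; ring]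
      refine ⟨C.step _, ?_⟩
      rw [← C.E_add_one, ← C.E_add_one, Set.mem_union, Set.mem_singleton_iff, Set.mem_singleton_iff]
      rintro (h | h)
      · have := C.E_injective h
        have := cast_inj_of_lt (by omega) (by omega)
          (two_mul_cancel (add_left_cancel (add_right_cancel this)))
        omega
      · have := C.E_injective h
        have : (i : ZMod (2 * C.k + 1)) = (0 : ℕ) := by
          apply two_mul_cancel
          push_cast
          linear_combination this
        have := cast_inj_of_lt (by omega) (by omega) this
        omega
  have hle : G.deleteEdges (Set.range C.E) ≤
      G.deleteEdges ({C.E (p + 2 * j + 1)} ∪ {s(C.v p, C.v (p + 2))}) := by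
    apply SimpleGraph.deleteEdges_anti
    rintro e (rfl | rfl)
    · exact ⟨_, rfl⟩
    · exact ⟨p + 1, C.E_add_one p⟩
  exact (h.mono hle).trans (hr j (by omega) le_rfl).symm

/-- A parametrized odd cycle together with the projection of the graph onto it. -/
structure Chart (G : SimpleGraph V) extends CycleParam G where
  π : V → ZMod (2 * k + 1)
  π_v : ∀ p, π (v p) = p
  adj : ∀ {x y}, G.Adj x y → π x = π y ∨
    (x = v (π x) ∧ y = v (π y) ∧ (π y = π x + 2 ∨ π x = π y + 2))

/-- Without the edges of the cycle every vertex is still connected to exactly one vertex of the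
cycle, by `not_reachable_of_ne`; that vertex is its projection. -/
theorem CycleParam.exists_chart (hG : IsCactus G) (C : CycleParam G) :
    ∃ D : Chart G, D.toCycleParam = C := by
  have hex : ∀ x, ∃ p, (G.deleteEdges (Set.range C.E)).Reachable x (C.v p) := by
    intro x
    obtain ⟨W⟩ := hG.1.preconnected x (C.v 0)
    suffices ∀ (x y : V) (_ : G.Walk x y), y = C.v 0 →
        ∃ p, (G.deleteEdges (Set.range C.E)).Reachable x (C.v p) from this _ _ W rfl
    intro x y W
    induction W with
    | nil => rintro rfl; exact ⟨0, .refl _⟩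
    | @cons x z y h W ih =>
      intro hy
      obtain ⟨p, hp⟩ := ih hy
      by_cases he : s(x, z) ∈ Set.range C.E
      · obtain ⟨q, hq⟩ := he
        rcases Sym2.eq_iff.1 hq with ⟨h, -⟩ | ⟨-, h⟩
        · exact ⟨_, by rw [h]⟩
        · exact ⟨_, by rw [h]⟩
      · refine ⟨p, SimpleGraph.Reachable.trans (SimpleGraph.Adj.reachable ?_) hp⟩
        rw [SimpleGraph.deleteEdges_adj]
        exact ⟨h, he⟩
  choose π hπ using hex
  have huniq : ∀ x p, (G.deleteEdges (Set.range C.E)).Reachable x (C.v p) → π x = p :=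
    fun x p h => by_contra fun hne => not_reachable_of_ne hG C hne ((hπ x).symm.trans h)
  have hv : ∀ p, π (C.v p) = p := fun p => huniq _ _ (.refl _)
  refine ⟨{ C with π := π, π_v := hv, adj := ?_ }, rfl⟩
  intro x y h
  by_cases he : s(x, y) ∈ Set.range C.E
  · obtain ⟨q, hq⟩ := he
    right
    rcases Sym2.eq_iff.1 hq with ⟨h, h'⟩ | ⟨h, h'⟩
    · rw [← h, ← h', hv, hv]
      exact ⟨rfl, rfl, .inl (by ring)⟩
    · rw [← h, ← h', hv, hv]
      exact ⟨rfl, rfl, .inr (by ring)⟩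
  · left
    have : (G.deleteEdges (Set.range C.E)).Adj x y := by
      rw [SimpleGraph.deleteEdges_adj]; exact ⟨h, he⟩
    exact huniq _ _ (this.reachable.trans (hπ y))

/-- Every edge of an odd cactus is a bridge or lies on a parametrized cycle. -/
theorem isBridge_or_chart (hG : IsOddCactus G) {e : Sym2 V} (he : e ∈ G.edgeSet) :
    G.IsBridge e ∨ ∃ (C : Chart G) (p : _), e = C.E p := by
  by_contra! h
  obtain ⟨h1, h2⟩ := h
  rw [SimpleGraph.isBridge_iff_forall_cycle_notMem he] at h1
  push Not at h1
  obtain ⟨u, c, hc, hec⟩ := h1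
  obtain ⟨C, hC⟩ := exists_cycleParam c hc (hG.2 u c hc)
  obtain ⟨D, rfl⟩ := C.exists_chart hG.1
  obtain ⟨q, hq⟩ := (hC e).1 hec
  exact h2 D q hq

theorem CycleParam.not_isBridge (C : CycleParam G) (p) : ¬ G.IsBridge (C.E p) := by
  obtain ⟨W, h1, h2, h3⟩ := C.exists_cycle 0
  exact fun h => h.notMem_edges_of_isCycle h1 ((C.mem_edges_cycle h2 h3 _).2 ⟨p, rfl⟩)

namespace Chart

variable (C : Chart G)

/-- The projection onto a cycle as a gate. -/
def gate : Gate G (ZMod (2 * C.k + 1)) where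
  v := C.v
  π := C.π
  π_v := C.π_v
  adj h := (C.adj h).imp id fun h => ⟨h.1, h.2.1⟩

/-- Turning a cycle. -/
def shift (s : ZMod (2 * C.k + 1)) : Chart G where
  k := C.k
  hk := C.hk
  v p := C.v (p + s)
  inj p q h := add_right_cancel (C.inj h)
  step p := by
    have := C.step (p + s)
    rwa [add_right_comm] at this
  π x := C.π x - s
  π_v p := by rw [C.π_v]; ring
  adj {x y} h := by
    rcases C.adj h with h | ⟨h1, h2, h3⟩
    · left; rw [h]
    · right
      refine ⟨by rwa [sub_add_cancel], by rwa [sub_add_cancel], ?_⟩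
      rcases h3 with h3 | h3
      · left; rw [h3]; ring
      · right; rw [h3]; ring

/-- Reversing a cycle. -/
def flip : Chart G where
  k := C.k
  hk := C.hk
  v p := C.v (-p)
  inj p q h := neg_injective (C.inj h)
  step p := by
    have := C.step (-p - 2)
    rw [sub_add_cancel, show -p - 2 = -(p + 2) by ring] at this
    exact this.symm
  π x := - C.π x
  π_v p := by rw [C.π_v]; ring
  adj {x y} h := by
    rcases C.adj h with h | ⟨h1, h2, h3⟩
    · left; rw [h]
    · right
      refine ⟨by rwa [neg_neg], by rwa [neg_neg], ?_⟩
      rcases h3 with h3 | h3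
      · right; rw [h3]; ring
      · left; rw [h3]; ring

theorem dist_v (hG : G.Connected) (x : V) (p) :
    G.dist x (C.v p) = G.dist x (C.v (C.π x)) + G.dist (C.v (C.π x)) (C.v p) :=
  C.gate.dist_v hG x p

theorem dist_ne (hG : G.Connected) {x y : V} (h : C.π x ≠ C.π y) :
    G.dist x y = G.dist x (C.v (C.π x)) + G.dist (C.v (C.π x)) (C.v (C.π y))
      + G.dist (C.v (C.π y)) y := C.gate.dist_ne hG h

theorem E_of_adj {x y : V} (h : G.Adj x y) (hne : C.π x ≠ C.π y) : ∃ p, s(x, y) = C.E p := by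
  rcases C.adj h with h | ⟨h1, h2, h3 | h3⟩
  · exact absurd h hne
  · refine ⟨C.π x + 1, ?_⟩
    rw [C.E_add_one, ← h1, ← h3, ← h2]
  · refine ⟨C.π y + 1, ?_⟩
    rw [C.E_add_one, ← h2, ← h3, ← h1, Sym2.eq_swap]

theorem π_ne_of_E {x y : V} {p} (h : s(x, y) = C.E p) : C.π x ≠ C.π y := by
  have h1 : p - 1 ≠ p + 1 := fun h => one_ne_zero_zmod C.hk
    (two_mul_cancel (by linear_combination -h))
  rcases Sym2.eq_iff.1 h with ⟨rfl, rfl⟩ | ⟨rfl, rfl⟩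
  · rw [C.π_v, C.π_v]; exact h1
  · rw [C.π_v, C.π_v]; exact h1.symm

/-- The distance of two residues on a cycle whose edges join residues differing by `2`. -/
def len {k : ℕ} (t : ZMod (2 * k + 1)) : ℕ := (t * (k + 1)).valMinAbs.natAbs

theorem len_neg {k : ℕ} (t : ZMod (2 * k + 1)) : len (-t) = len t := by
  rw [len, neg_mul, ZMod.natAbs_valMinAbs_neg, len]

theorem len_eq_iff {k : ℕ} (s t : ZMod (2 * k + 1)) : len s = len t ↔ s = t ∨ s = -t := by
  have hh := half_mul_two k
  rw [len, len, ZMod.natAbs_valMinAbs_eq_natAbs_valMinAbs]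
  refine or_congr ⟨fun h => ?_, fun h => by rw [h]⟩ ⟨fun h => ?_, fun h => by rw [h]; ring⟩
  · linear_combination 2 * h - (s - t) * hh
  · linear_combination 2 * h - (s + t) * hh

theorem len_zero {k : ℕ} : len (0 : ZMod (2 * k + 1)) = 0 := by simp [len]

theorem len_add_two_le {k : ℕ} (hk : 1 ≤ k) (t : ZMod (2 * k + 1)) : len (t + 2) ≤ len t + 1 := by
  have h1 : (t + 2) * (k + 1) = t * (k + 1) + (1 : ℕ) := by
    push_cast; linear_combination half_mul_two k
  rw [len, h1]
  refine (ZMod.natAbs_valMinAbs_add_le _ _).trans ((Int.natAbs_add_le _ _).trans ?_)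
  rw [ZMod.valMinAbs_natCast_of_le_half (by omega)]
  simp [len]

theorem len_sub_two_le {k : ℕ} (hk : 1 ≤ k) (t : ZMod (2 * k + 1)) : len (t - 2) ≤ len t + 1 := by
  rw [← len_neg, ← len_neg t, neg_sub, show 2 - t = -t + 2 by ring]
  exact len_add_two_le hk _

/-- Modulo `2k + 1`, `1 + 2j` equals `-2 (k - j)`, which is `k - j` steps in the opposite direction.
-/
theorem len_odd {k j : ℕ} (hj : j ≤ k) : len (1 + 2 * j : ZMod (2 * k + 1)) = k - j := by
  have h0 := ZMod.natCast_self (2 * k + 1)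
  have h : (1 + 2 * j : ZMod (2 * k + 1)) * (k + 1) = -((k - j : ℕ) : ZMod (2 * k + 1)) := by
    push_cast [hj] at h0 ⊢; linear_combination (1 + j) * h0
  rw [len, h, ZMod.natAbs_valMinAbs_neg, ZMod.valMinAbs_natCast_of_le_half (by omega)]
  simp

/-- The upper bound is an arc of the cycle. For the lower bound, a step of any walk in `G` fixes the
projection or moves it by `2`, and so changes `len` by at most one. -/
theorem dist_v_v (hG : G.Connected) (p q) : G.dist (C.v p) (C.v q) = len (q - p) := by
  have hh := half_mul_two C.k
  apply le_antisymm
  · have key : ∀ (p q : ZMod (2 * C.k + 1)) (m : ℕ), q = p + 2 * m → G.dist (C.v p) (C.v q) ≤ m := by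
      intro p q m h
      obtain ⟨W, h1, -⟩ := C.exists_walk p m q h
      exact h1 ▸ SimpleGraph.dist_le W
    have hc := ZMod.coe_valMinAbs ((q - p) * ((C.k : ZMod (2 * C.k + 1)) + 1))
    rcases Int.natAbs_eq ((q - p) * ((C.k : ZMod (2 * C.k + 1)) + 1)).valMinAbs with h | h
    · apply key
      rw [h] at hc
      rw [len]
      generalize ((q - p) * ((C.k : ZMod (2 * C.k + 1)) + 1)).valMinAbs.natAbs = m at hc ⊢
      push_cast at hc
      linear_combination -2 * hc - (q - p) * hh
    · rw [G.dist_comm]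
      apply key
      rw [h] at hc
      rw [len]
      generalize ((q - p) * ((C.k : ZMod (2 * C.k + 1)) + 1)).valMinAbs.natAbs = m at hc ⊢
      push_cast at hc
      linear_combination 2 * hc + (q - p) * hh
  · suffices ∀ (x y : V) (W : G.Walk x y), len (C.π y - C.π x) ≤ W.length by
      obtain ⟨W, hW⟩ := hG.exists_walk_length_eq_dist (C.v p) (C.v q)
      have := this _ _ W
      rwa [C.π_v, C.π_v, hW] at this
    intro x y W
    induction W with
    | nil => simp [len_zero]
    | @cons x z y h W ih =>
      rw [SimpleGraph.Walk.length_cons]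
      rcases C.adj h with h | ⟨-, -, h | h⟩
      · rw [h]; omega
      · have := len_add_two_le C.hk (C.π y - C.π z)
        rw [show C.π y - C.π x = C.π y - C.π z + 2 by rw [h]; ring]
        omega
      · have := len_sub_two_le C.hk (C.π y - C.π z)
        rw [show C.π y - C.π x = C.π y - C.π z - 2 by rw [h]; ring]
        omega

end Chart

end Charts
end OddCactus

namespace OddCactus

/-! ### Distances, equidistance and geodesics -/

section Metric

variable {V : Type*} {G : SimpleGraph V}

/-- `w` is at the same distance from the two ends of `e`. -/
def Eqd (G : SimpleGraph V) (w : V) (e : Sym2 V) : Prop :=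
  ∀ a ∈ e, ∀ b ∈ e, G.dist w a = G.dist w b

theorem eqd_mk {w a b : V} : Eqd G w s(a, b) ↔ G.dist w a = G.dist w b := by
  constructor
  · exact fun h => h a (by simp) b (by simp)
  · intro h x hx y hy
    rcases Sym2.mem_iff.1 hx with rfl | rfl <;> rcases Sym2.mem_iff.1 hy with rfl | rfl <;>
      simp [h]

theorem dist_le_of_adj (hG : G.Connected) {a b : V} (h : G.Adj a b) (w : V) :
    G.dist w b ≤ G.dist w a + 1 := by
  have := hG.dist_triangle (u := w) (v := a) (w := b)
  rwa [SimpleGraph.dist_eq_one_iff_adj.2 h] at this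

theorem exists_adj_closer (hG : G.Connected) {x r : V} (h : x ≠ r) :
    ∃ y, G.Adj x y ∧ G.dist r y + 1 = G.dist r x := by
  obtain ⟨W, hW⟩ := hG.exists_walk_length_eq_dist x r
  cases W with
  | nil => exact absurd rfl h
  | @cons _ y _ hy W =>
    refine ⟨y, hy, ?_⟩
    have h1 := SimpleGraph.dist_le W
    have h2 := dist_le_of_adj hG hy.symm r
    rw [SimpleGraph.Walk.length_cons] at hW
    rw [G.dist_comm (u := r) (v := y), G.dist_comm (u := r) (v := x)] at *
    omega

theorem bridge_side (hG : G.Connected) {a b : V} (hab : G.Adj a b) (h : G.IsBridge s(a, b))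
    (w : V) : ((bridgeGate h).π w = true ∧ G.dist w b = G.dist w a + 1) ∨
      ((bridgeGate h).π w = false ∧ G.dist w a = G.dist w b + 1) := by
  have h1 := SimpleGraph.dist_eq_one_iff_adj.2 hab
  have ha : (bridgeGate h).v true = a := rfl
  have hb : (bridgeGate h).v false = b := rfl
  cases hw : (bridgeGate h).π w
  · right
    have := (bridgeGate h).dist_v hG w true
    rw [hw, ha, hb, G.dist_comm (u := b), h1] at this
    exact ⟨rfl, this⟩
  · left
    have := (bridgeGate h).dist_v hG w false
    rw [hw, ha, hb, h1] at this
    exact ⟨rfl, this⟩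

theorem not_eqd_of_isBridge (hG : G.Connected) {e : Sym2 V} (he : e ∈ G.edgeSet)
    (h : G.IsBridge e) (w : V) : ¬ Eqd G w e := by
  induction e with | _ a b =>
  rw [eqd_mk]
  have hab : G.Adj a b := he
  rcases bridge_side hG hab h w with h | h <;> omega

/-- Both distances pass through the projection of `w`, so equality means that the residues `p - 1 -
π w` and `p + 1 - π w` have the same `len`. Being distinct, they are opposite. -/
theorem Chart.eqd_iff (hG : G.Connected) (C : Chart G) {w : V} {p} :
    Eqd G w (C.E p) ↔ C.π w = p := by
  rw [CycleParam.E, eqd_mk, C.dist_v hG w, C.dist_v hG w (p + 1), Nat.add_left_cancel_iff,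
    C.dist_v_v hG, C.dist_v_v hG, len_eq_iff]
  constructor
  · rintro (h | h)
    · exact absurd (two_mul_cancel (by linear_combination -h)) (one_ne_zero_zmod C.hk)
    · exact (two_mul_cancel (by linear_combination h)).symm
  · rintro rfl; right; ring

/-- Vertices in one fibre see `a` and `b` alike. If `yz` is an edge of the cycle, the hypotheses
give `len (d - 2) = len (d + 2)`, where `d` is `π a` minus the projection of `y` or of `z`,
whichever comes first in the direction from `a` to `b`. Hence `d = 0`, and either the two edges
coincide or `len 0` is positive. -/
theorem Chart.not_crossing (hG : G.Connected) (C : Chart G) {a b y z : V} (hab : G.Adj a b)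
    (hπ : C.π b = C.π a + 2) (hyz : G.Adj y z) (hne : s(a, b) ≠ s(y, z))
    (h1 : G.dist y b = G.dist y a + 1) (h2 : G.dist z a = G.dist z b + 1) : False := by
  have h2' : (2 : ZMod (2 * C.k + 1)) ≠ 0 := fun h => one_ne_zero_zmod C.hk
    (two_mul_cancel (by linear_combination h))
  have hab' : C.π a ≠ C.π b := by
    rw [hπ]; intro h; exact h2' (by linear_combination -h)
  obtain ⟨ha, hb⟩ : a = C.v (C.π a) ∧ b = C.v (C.π b) := by
    rcases C.adj hab with h | ⟨h, h', -⟩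
    · exact absurd h hab'
    · exact ⟨h, h'⟩
  have hd : ∀ w, G.dist w a = G.dist w (C.v (C.π w)) + Chart.len (C.π a - C.π w) := fun w => by
    conv_lhs => rw [ha]
    rw [C.dist_v hG w, C.dist_v_v hG]
  have hd' : ∀ w, G.dist w b = G.dist w (C.v (C.π w)) + Chart.len (C.π a - C.π w + 2) := fun w => by
    conv_lhs => rw [hb]
    rw [C.dist_v hG w, C.dist_v_v hG, hπ]; congr 2; ring
  rw [hd, hd'] at h1 h2
  rcases C.adj hyz with h | ⟨hy, hz, h | h⟩
  · rw [h] at h1; omega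
  · rw [h, show C.π a - (C.π y + 2) + 2 = C.π a - C.π y by ring] at h2
    have : Chart.len (C.π a - (C.π y + 2)) = Chart.len (C.π a - C.π y + 2) := by omega
    rw [Chart.len_eq_iff] at this
    rcases this with e | e
    · exact h2' (two_mul_cancel (by linear_combination -e))
    · have e : C.π a = C.π y := two_mul_cancel (by linear_combination e)
      apply hne
      rw [ha, hb, hy, hz, hπ, h, e]
  · rw [h, show C.π a - (C.π z + 2) + 2 = C.π a - C.π z by ring] at h1
    have : Chart.len (C.π a - (C.π z + 2)) = Chart.len (C.π a - C.π z + 2) := by omega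
    rw [Chart.len_eq_iff] at this
    rcases this with e | e
    · exact h2' (two_mul_cancel (by linear_combination -e))
    · have e : C.π a = C.π z := two_mul_cancel (by linear_combination e)
      rw [e, sub_self, Chart.len_zero] at h1
      omega

theorem not_crossing (hG : IsOddCactus G) {a b y z : V} (hab : G.Adj a b) (hyz : G.Adj y z)
    (hne : s(a, b) ≠ s(y, z)) (h1 : G.dist y b = G.dist y a + 1)
    (h2 : G.dist z a = G.dist z b + 1) : False := by
  have hc := hG.1.1
  rcases isBridge_or_chart hG (show s(a, b) ∈ G.edgeSet from hab) with h | ⟨C, p, hp⟩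
  · have hy : (bridgeGate h).π y = true := by
      rcases bridge_side hc hab h y with h | h
      · exact h.1
      · omega
    have hz : (bridgeGate h).π z = false := by
      rcases bridge_side hc hab h z with h | h
      · omega
      · exact h.1
    rcases (bridgeGate h).adj hyz with e | ⟨e, e'⟩
    · rw [hy, hz] at e; cases e
    · rw [hy] at e; rw [hz] at e'
      exact hne (by rw [e, e']; rfl)
  · have hne' := C.π_ne_of_E hp
    rcases C.adj hab with h | ⟨-, -, h | h⟩
    · exact hne' h
    · exact C.not_crossing hc hab h hyz hne h1 h2
    · refine C.not_crossing hc hab.symm h hyz.symm ?_ h2 h1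
      rwa [Sym2.eq_swap (a := b), Sym2.eq_swap (a := z)]

/-- Neither end of `f` is tied between the ends of `e`, and `not_crossing` excludes that they prefer
different ones. -/
theorem polarized (hG : IsOddCactus G) {e f : Sym2 V} (he : e ∈ G.edgeSet) (hf : f ∈ G.edgeSet)
    (hne : e ≠ f) (h : ∀ w ∈ f, ¬ Eqd G w e) :
    ∃ a b, e = s(a, b) ∧ ∀ y ∈ f, G.dist y b = G.dist y a + 1 := by
  have hc := hG.1.1
  induction e with | _ a b =>
  induction f with | _ y z =>
  have hab : G.Adj a b := he
  have hyz : G.Adj y z := hf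
  have hy := h y (by simp)
  have hz := h z (by simp)
  rw [eqd_mk] at hy hz
  have d1 := dist_le_of_adj hc hab y
  have d2 := dist_le_of_adj hc hab.symm y
  have d3 := dist_le_of_adj hc hab z
  have d4 := dist_le_of_adj hc hab.symm z
  rcases lt_or_gt_of_ne hy with hy | hy
  · refine ⟨a, b, rfl, fun w hw => ?_⟩
    rcases Sym2.mem_iff.1 hw with rfl | rfl
    · omega
    · by_contra hw
      exact not_crossing hG hab hyz hne (by omega) (by omega)
  · refine ⟨b, a, Sym2.eq_swap, fun w hw => ?_⟩
    rcases Sym2.mem_iff.1 hw with rfl | rfl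
    · omega
    · by_contra hw
      exact not_crossing hG hab hyz.symm (by rwa [Sym2.eq_swap (a := w)]) (by omega) (by omega)

/-- Here the oddness of cycles makes geodesics unique. If `y` and `z` were the two neighbours of `x`
on one cycle, equal distances would force `x` to be the projection of `r`, and then `x` would be the
nearest. A neighbour in the fibre of `x` is farther away than `x`. -/
theorem unique_parent (hG : IsOddCactus G) {r x y z : V} (hy : G.Adj x y) (hz : G.Adj x z)
    (h1 : G.dist r y + 1 = G.dist r x) (h2 : G.dist r z + 1 = G.dist r x) : y = z := by
  have hc := hG.1.1
  rcases isBridge_or_chart hG (show s(x, y) ∈ G.edgeSet from hy) with h | ⟨C, p, hp⟩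
  · have hx : (bridgeGate h).π x = true := (bridgeGate h).π_v true
    have hr : (bridgeGate h).π r = false := by
      rcases bridge_side hc hy h r with h | h
      · omega
      · exact h.1
    rcases (bridgeGate h).adj hz with e | ⟨-, e⟩
    · have := (bridgeGate h).dist_ne hc (x := r) (y := z) (by rw [hr, ← e, hx]; simp)
      rw [← e] at this
      have h3 := (bridgeGate h).dist_v hc r true
      have h4 : (bridgeGate h).v true = x := rfl
      rw [hx, h4] at this
      rw [h4] at h3
      omega
    · cases hz' : (bridgeGate h).π z
      · rw [hz'] at e; exact e.symm
      · rw [hz'] at e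
        exact absurd (show z = x from e) hz.ne'
  · have hne := C.π_ne_of_E hp
    obtain ⟨hx, hy', hxy⟩ : x = C.v (C.π x) ∧ y = C.v (C.π y) ∧
        (C.π y = C.π x + 2 ∨ C.π x = C.π y + 2) := by
      rcases C.adj hy with h | h
      · exact absurd h hne
      · exact h
    have dx := C.dist_v hc r (C.π x)
    have dy := C.dist_v hc r (C.π y)
    rw [← hx] at dx
    rw [← hy'] at dy
    have hrx : C.π r ≠ C.π x := by
      intro h
      rw [h, ← hx] at dy
      omega
    rcases C.adj hz with e | ⟨-, hz', hxz⟩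
    · have := C.dist_ne hc (x := r) (y := z) (by rwa [← e])
      rw [← e, ← hx] at this
      omega
    · have dz := C.dist_v hc r (C.π z)
      rw [← hz'] at dz
      rw [hx, C.dist_v_v hc] at dx
      rw [hy', C.dist_v_v hc] at dy
      rw [hz', C.dist_v_v hc] at dz
      rw [← hx] at dx
      rw [← hy'] at dy
      rw [← hz'] at dz
      have : Chart.len (C.π y - C.π r) = Chart.len (C.π z - C.π r) := by omega
      rw [Chart.len_eq_iff] at this
      rcases this with e | e
      · have e : C.π y = C.π z := by linear_combination e
        rw [hy', hz', e]
      · rcases hxy with h | h <;> rcases hxz with h' | h'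
        · rw [hy', hz', h, h']
        · exact absurd (two_mul_cancel (by linear_combination -e + h - h')) hrx
        · exact absurd (two_mul_cancel (by linear_combination -e - h + h')) hrx
        · rw [hy', hz', add_right_cancel (h.symm.trans h')]

/-- A geodesic leaves `b` through a neighbour nearer to `d`, and there is only one. -/
theorem mem_edges_of_closer (hG : IsOddCactus G) {b a d : V} (p : G.Walk b d)
    (hp : p.length = G.dist b d) (hba : G.Adj b a) (h : G.dist b d = G.dist a d + 1) :
    s(a, b) ∈ p.edges := by
  cases p with
  | nil => simp at h
  | @cons _ x _ hx q =>
    have h1 := SimpleGraph.dist_le q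
    have h2 := dist_le_of_adj hG.1.1 hx.symm d
    rw [SimpleGraph.Walk.length_cons] at hp
    rw [G.dist_comm (u := d) (v := b), G.dist_comm (u := d)] at h2
    have := unique_parent hG (r := d) hx hba (by rw [G.dist_comm, G.dist_comm (u := d)]; omega)
      (by rw [G.dist_comm, G.dist_comm (u := d)]; omega)
    subst this
    rw [Sym2.eq_swap]
    simp

/-- Two edges none of which has an end equidistant to the ends of the other lie on a common
geodesic, and on every geodesic with the same ends. -/
theorem exists_forall_geodesic_mem (hG : IsOddCactus G) {e f : Sym2 V} (he : e ∈ G.edgeSet)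
    (hf : f ∈ G.edgeSet) (hne : e ≠ f) (h1 : ∀ w ∈ f, ¬ Eqd G w e) (h2 : ∀ w ∈ e, ¬ Eqd G w f) :
    ∃ u v, ∀ p : G.Walk u v, p.length = G.dist u v → e ∈ p.edges ∧ f ∈ p.edges := by
  obtain ⟨a, b, rfl, h1'⟩ := polarized hG he hf hne h1
  obtain ⟨c, d, rfl, h2'⟩ := polarized hG hf he hne.symm h2
  have hab : G.Adj a b := he
  have hcd : G.Adj c d := hf
  -- The witnesses are the outer ends: `f` is on the side of `a` and `e` on the side of `c`, so a
  -- geodesic from `b` to `d` starts with `e` and ends with `f`.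
  refine ⟨b, d, fun p hp => ⟨?_, ?_⟩⟩
  · refine mem_edges_of_closer hG p hp hab.symm ?_
    have := h1' d (by simp)
    rwa [G.dist_comm, G.dist_comm (u := d)] at this
  · have := mem_edges_of_closer hG p.reverse
      (by rw [SimpleGraph.Walk.length_reverse, G.dist_comm, hp]) hcd.symm (by
      have := h2' b (by simp)
      rwa [G.dist_comm, G.dist_comm (u := b)] at this)
    simpa using this

theorem dist_getVert (hG : G.Connected) {u v : V} (p : G.Walk u v) (hp : p.length = G.dist u v)
    {i j : ℕ} (hij : i ≤ j) (hj : j ≤ p.length) :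
    G.dist (p.getVert i) (p.getVert j) = j - i := by
  have key : ∀ {u v : V} (p : G.Walk u v) {i j : ℕ}, i ≤ j → j ≤ p.length →
      G.dist (p.getVert i) (p.getVert j) ≤ j - i := by
    intro u v p i j hij hj
    induction j, hij using Nat.le_induction with
    | base => simp
    | succ j hij ih =>
      have := dist_le_of_adj hG (p.adj_getVert_succ (i := j) (by omega)) (p.getVert i)
      have := ih (by omega)
      omega
  apply le_antisymm (key p hij hj)
  have h1 := key p (Nat.zero_le i) (by omega)
  have h2 := key p hj le_rfl
  rw [SimpleGraph.Walk.getVert_zero] at h1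
  rw [SimpleGraph.Walk.getVert_length] at h2
  have h3 := hG.dist_triangle (u := u) (v := p.getVert i) (w := v)
  have h4 := hG.dist_triangle (u := p.getVert i) (v := p.getVert j) (w := v)
  omega

/-- Distances along a geodesic are differences of indices, and no index is equally far from `i` and
`i + 1`. -/
theorem not_eqd_of_geodesic (hG : G.Connected) {u v : V} (p : G.Walk u v)
    (hp : p.length = G.dist u v) {e : Sym2 V} (he : e ∈ p.edges) {w : V} (hw : w ∈ p.support) :
    ¬ Eqd G w e := by
  induction e with | _ a b =>
  rw [SimpleGraph.Walk.mk_mem_edges_iff_exists] at he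
  obtain ⟨i, hi, he⟩ := he
  rw [SimpleGraph.Walk.mem_support_iff_exists_getVert] at hw
  obtain ⟨j, rfl, hj⟩ := hw
  rw [← he, eqd_mk]
  rcases le_or_gt j i with h | h
  · rw [dist_getVert hG p hp h hi.le, dist_getVert hG p hp (by omega : j ≤ i + 1) hi]
    omega
  · rw [G.dist_comm, dist_getVert hG p hp h.le hj, G.dist_comm,
      dist_getVert hG p hp (by omega : i + 1 ≤ j) hj]
    omega

theorem Chart.exists_adj_closer_fibre (hG : G.Connected) (C : Chart G) {x : V}
    (h : x ≠ C.v (C.π x)) :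
    ∃ y, G.Adj x y ∧ G.dist (C.v (C.π x)) y + 1 = G.dist (C.v (C.π x)) x ∧ C.π y = C.π x := by
  obtain ⟨y, h1, h2⟩ := exists_adj_closer hG h
  exact ⟨y, h1, h2, C.gate.eq_of_adj_of_ne h1 h⟩

theorem isCutVertex_iff_preconnected [Finite V] (hG : G.Connected) (v : V) :
    IsCutVertex G v ↔ ¬ (G.induce ({v}ᶜ : Set V)).Preconnected := by
  have : Nat.card G.ConnectedComponent = 1 := by
    have := hG.nonempty
    have := hG.preconnected.subsingleton_connectedComponent
    exact Nat.card_unique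
  rw [IsCutVertex, this, Finite.one_lt_card_iff_nontrivial, ← not_subsingleton_iff_nontrivial]
  refine not_congr ⟨fun h x y => ?_, fun h => h.subsingleton_connectedComponent⟩
  exact SimpleGraph.ConnectedComponent.exact (Subsingleton.elim _ _)

/-- If the fibre is trivial, removing `C.v p` leaves a path of the cycle, to which every other
vertex descends inside its own fibre. If it is not, walks from the fibre to `C.v (p + 2)` must pass
through `C.v p`. -/
theorem Chart.isCutVertex_iff [Finite V] (hG : G.Connected) (C : Chart G) {p} :
    IsCutVertex G (C.v p) ↔ ∃ x, C.π x = p ∧ x ≠ C.v p := by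
  rw [isCutVertex_iff_preconnected hG]
  constructor
  · intro h
    by_contra! hx
    apply h
    have hmem : ∀ i : ℕ, 1 ≤ i → i ≤ 2 * C.k → C.v (p + 2 * i) ∈ ({C.v p}ᶜ : Set V) := by
      intro i h1 h2 h
      have : (i : ZMod (2 * C.k + 1)) = (0 : ℕ) := two_mul_cancel (by
        have := C.inj h
        push_cast
        linear_combination this)
      have := cast_inj_of_lt (by omega) (by omega) this
      omega
    have h1 : ∀ i (h1 : 1 ≤ i) (h2 : i ≤ 2 * C.k), (G.induce ({C.v p}ᶜ : Set V)).Reachable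
        ⟨C.v (p + 2 * i), hmem i h1 h2⟩ ⟨C.v (p + 2 * (1 : ℕ)), hmem 1 le_rfl (h1.trans h2)⟩ := by
      intro i h1
      induction i, h1 using Nat.le_induction with
      | base => intro _; exact .refl _
      | succ i h1 ih =>
        intro h2
        refine SimpleGraph.Reachable.trans (SimpleGraph.Adj.reachable ?_) (ih (by omega))
        rw [SimpleGraph.induce_adj]
        have := (C.step (p + 2 * i)).symm
        rwa [show p + 2 * (i : ZMod (2 * C.k + 1)) + 2 = p + 2 * ((i + 1 : ℕ) : ZMod _) by
          push_cast; ring] at this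
    have h2 : ∀ n (x : ({C.v p}ᶜ : Set V)), G.dist (C.v (C.π x)) x = n →
        (G.induce ({C.v p}ᶜ : Set V)).Reachable x
          ⟨C.v (p + 2 * (1 : ℕ)), hmem 1 le_rfl (by have := C.hk; omega)⟩ := by
      intro n
      induction n with
      | zero =>
        rintro ⟨x, hxp⟩ hn
        have hxv : C.v (C.π x) = x := hG.dist_eq_zero_iff.1 hn
        obtain ⟨i, hi, hi'⟩ := exists_eq_two_mul (C.π x - p)
        have hix : C.π x = p + 2 * i := by linear_combination hi'
        have hi0 : i ≠ 0 := by
          rintro rfl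
          exact hxp (hx x (by simpa using hix))
        convert h1 i (by omega) (by omega) using 2
        rw [← hix]; exact hxv.symm
      | succ n ih =>
        rintro ⟨x, hxp⟩ hn
        obtain ⟨y, hxy, hy, hπ⟩ := C.exists_adj_closer_fibre hG (x := x) (by
          intro h
          rw [← h] at hn
          simp at hn)
        have hyp : y ≠ C.v p := by
          rintro rfl
          rw [C.π_v] at hπ
          exact hxp (hx x hπ.symm)
        refine SimpleGraph.Reachable.trans (SimpleGraph.Adj.reachable ?_) (ih ⟨y, hyp⟩ ?_)
        · exact hxy
        · show G.dist (C.v (C.π y)) y = n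
          simp only at hn
          rw [hπ]; omega
    exact fun x y => (h2 _ x rfl).trans (h2 _ y rfl).symm
  · rintro ⟨x, rfl, hx⟩ h
    have h2 : C.v (C.π x + 2) ≠ C.v (C.π x) := fun h =>
      one_ne_zero_zmod C.hk (two_mul_cancel (by linear_combination C.inj h))
    obtain ⟨W⟩ := h ⟨x, hx⟩ ⟨C.v (C.π x + 2), h2⟩
    have := C.gate.mem_support (W.map (SimpleGraph.Embedding.induce _).toHom) (by
      left
      show C.π x ≠ C.π (C.v (C.π x + 2))
      rw [C.π_v]
      exact fun h => h2 (by rw [← h]))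
    rw [SimpleGraph.Walk.support_map, List.mem_map] at this
    obtain ⟨⟨z, hz⟩, -, hz'⟩ := this
    exact hz hz'

theorem Chart.exists_mem_fibre_iff_adj (hG : G.Connected) (C : Chart G) {p} :
    (∃ x, C.π x = p ∧ x ≠ C.v p) ↔
      ∃ z, G.Adj (C.v p) z ∧ z ≠ C.v (p + 2) ∧ z ≠ C.v (p - 2) := by
  have h2 : (2 : ZMod (2 * C.k + 1)) ≠ 0 := fun h => one_ne_zero_zmod C.hk
    (two_mul_cancel (by linear_combination h))
  constructor
  · suffices ∀ n x, G.dist (C.v p) x = n + 1 → C.π x = p →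
        ∃ z, G.Adj (C.v p) z ∧ C.π z = p by
      rintro ⟨x, h, hx⟩
      obtain ⟨n, hn⟩ := Nat.exists_eq_succ_of_ne_zero
        (fun h => hx (hG.dist_eq_zero_iff.1 h).symm : G.dist (C.v p) x ≠ 0)
      obtain ⟨z, hz, hzp⟩ := this n x hn h
      refine ⟨z, hz, ?_, ?_⟩
      · rintro rfl
        rw [C.π_v] at hzp
        exact h2 (by linear_combination hzp)
      · rintro rfl
        rw [C.π_v] at hzp
        exact h2 (by linear_combination -hzp)
    intro n
    induction n with
    | zero => exact fun x hx h => ⟨x, SimpleGraph.dist_eq_one_iff_adj.1 hx, h⟩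
    | succ n ih =>
      rintro x hn rfl
      obtain ⟨y, hxy, hy, hπ⟩ := C.exists_adj_closer_fibre hG (x := x) (by
        intro h
        rw [← h] at hn
        simp at hn)
      exact ih y (by omega) hπ
  · rintro ⟨z, hz, h1, h2⟩
    refine ⟨z, ?_, hz.ne'⟩
    rcases C.adj hz with h | ⟨-, hz', h | h⟩
    · rw [← h, C.π_v]
    · rw [C.π_v] at h
      rw [h] at hz'
      exact absurd hz' h1
    · rw [C.π_v] at h
      rw [show C.π z = p - 2 by rw [h]; ring] at hz'
      exact absurd hz' h2

/-- The fibre is nontrivial exactly when there is a neighbour off the cycle. The program recognises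
the cut vertices on cycles by this degree test. -/
theorem Chart.isCutVertex_iff_ncard [Finite V] (hG : G.Connected) (C : Chart G) {p} :
    IsCutVertex G (C.v p) ↔ (G.neighborSet (C.v p)).ncard ≠ 2 := by
  rw [C.isCutVertex_iff hG, C.exists_mem_fibre_iff_adj hG, ← not_iff_not]
  have hne : C.v (p + 2) ≠ C.v (p - 2) := fun h =>
    one_ne_zero_zmod C.hk (two_mul_cancel (two_mul_cancel (by linear_combination C.inj h)))
  have hp := C.step p
  have hm := C.step (p - 2)
  rw [sub_add_cancel] at hm
  have hsub : ({C.v (p + 2), C.v (p - 2)} : Set V) ⊆ G.neighborSet (C.v p) := by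
    rintro z (rfl | rfl)
    · exact hp
    · exact hm.symm
  push Not
  have hc := Set.ncard_pair hne
  constructor
  · intro h
    rw [← hc]
    congr 1
    refine Set.Subset.antisymm (fun z hz => ?_) hsub
    by_cases h' : z = C.v (p + 2)
    · left; exact h'
    · right; exact h z hz h'
  · intro h z hz h'
    rw [← SimpleGraph.mem_neighborSet, ← Set.eq_of_subset_of_ncard_le hsub (h.trans hc.symm).le] at hz
    exact hz.resolve_left h'

end Metric
end OddCactus

namespace OddCactus

/-! ### The key set and an optimal colouring -/

section Colouring

variable {V : Type*} {G : SimpleGraph V}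

/-- The greedy choice of every other unmarked number after a marked one. -/
def Greedy (M : ℕ → Prop) : ℕ → Prop
  | 0 => False
  | i + 1 => ¬ M (i + 1) ∧ ¬ Greedy M i

/-- The vertices of a cycle selected by the greedy choice, cut vertices being marked. -/
def Chart.Opener (C : Chart G) (p : ZMod (2 * C.k + 1)) : Prop :=
  Greedy (fun i => IsCutVertex G (C.v i)) p.val

/-- The recursion closes up around the cycle: `Greedy` is false at `0`, which is right because `0`
is marked. -/
theorem Chart.opener_add_one (C : Chart G) (h0 : IsCutVertex G (C.v 0)) (p) :
    C.Opener (p + 1) ↔ ¬ IsCutVertex G (C.v (p + 1)) ∧ ¬ C.Opener p := by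
  have hp := ZMod.val_lt p
  rcases (show p.val + 1 ≤ 2 * C.k + 1 from hp).lt_or_eq with h | h
  · have hv : (p + 1).val = p.val + 1 := by
      have : p + 1 = ((p.val + 1 : ℕ) : ZMod (2 * C.k + 1)) := by
        push_cast; rw [ZMod.natCast_zmod_val]
      rw [this, ZMod.val_natCast, Nat.mod_eq_of_lt h]
    rw [Chart.Opener, Chart.Opener, hv, Greedy]
    push_cast
    rw [ZMod.natCast_zmod_val]
  · have hv : p + 1 = 0 := by
      have : p + 1 = ((p.val + 1 : ℕ) : ZMod (2 * C.k + 1)) := by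
        push_cast; rw [ZMod.natCast_zmod_val]
      rw [this, h, ZMod.natCast_self]
    rw [hv]
    simp [Chart.Opener, Greedy, h0]

/-- Steps along `D` use no edge of `C`, and only edges of `C` change the projection onto it. -/
theorem Chart.π_const (C D : Chart G) (h : ∀ p q, C.E p ≠ D.E q) (q) :
    C.π (D.v q) = C.π (D.v 0) := by
  obtain ⟨i, -, rfl⟩ := exists_eq_two_mul q
  induction i with
  | zero => simp
  | succ i ih =>
    rw [← ih]
    by_contra hne
    have hs := D.step (2 * i)
    rw [show (2 * i + 2 : ZMod (2 * D.k + 1)) = 2 * ((i + 1 : ℕ) : ZMod _) by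
      push_cast; ring] at hs
    obtain ⟨p, hp⟩ := C.E_of_adj hs (Ne.symm hne)
    apply h p (2 * i + 1)
    rw [← hp, D.E_add_one]
    congr 3
    push_cast; ring

/-- A family of parametrizations of all cycles of an odd cactus that is not a cycle, such that the
parameter `0` belongs to a cut vertex. -/
structure CycleSystem (G : SimpleGraph V) (ι : Type*) where
  C : ι → Chart G
  cut_zero : ∀ i, IsCutVertex G ((C i).v 0)
  cover : ∀ e ∈ G.edgeSet, ¬ G.IsBridge e → ∃ i p, e = (C i).E p
  inj : ∀ i p j q, (C i).E p = (C j).E q →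
    (⟨i, p⟩ : Σ i, ZMod (2 * (C i).k + 1)) = ⟨j, q⟩

namespace CycleSystem

variable {ι : Type*} (S : CycleSystem G ι)

theorem opener_not_cut (i) {p} (h : (S.C i).Opener p) : ¬ IsCutVertex G ((S.C i).v p) := by
  have := (S.C i).opener_add_one (S.cut_zero i) (p - 1)
  rw [sub_add_cancel] at this
  exact (this.1 h).1

theorem opener_sub_one (i) {p} (h : ¬ (S.C i).Opener p) (hc : ¬ IsCutVertex G ((S.C i).v p)) :
    (S.C i).Opener (p - 1) := by
  have := (S.C i).opener_add_one (S.cut_zero i) (p - 1)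
  rw [sub_add_cancel] at this
  by_contra h'
  exact h (this.2 ⟨hc, h'⟩)

theorem not_opener_add_one (i) {p} (h : (S.C i).Opener p) : ¬ (S.C i).Opener (p + 1) := fun h' =>
  (((S.C i).opener_add_one (S.cut_zero i) p).1 h').2 h

theorem E_ne (i j) (h : i ≠ j) (p q) : (S.C i).E p ≠ (S.C j).E q := fun h' =>
  h (congrArg Sigma.fst (S.inj _ _ _ _ h'))

/-- A largest set of edges that must have different colours. -/
def key : Set (Sym2 V) :=
  cutEdges G ∪ {e | ∃ i p, (S.C i).Opener p ∧ e = (S.C i).E p}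

theorem key_subset : S.key ⊆ G.edgeSet := by
  rintro e (he | ⟨i, p, -, rfl⟩)
  · exact he.1
  · exact (S.C i).E_mem p

theorem π_eq_of_ne (C : Chart G) {f : Sym2 V} (hf : f ∈ G.edgeSet) (h : ∀ q, f ≠ C.E q) {w : V}
    (hw : w ∈ f) : ∀ x ∈ f, C.π x = C.π w := by
  induction f with | _ a b =>
  have : C.π a = C.π b := by
    by_contra hne
    obtain ⟨p, hp⟩ := C.E_of_adj hf hne
    exact h p hp
  intro x hx
  rcases Sym2.mem_iff.1 hw with rfl | rfl <;> rcases Sym2.mem_iff.1 hx with rfl | rfl <;>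
    simp [this]

/-- A bridge is equidistant from nothing. For an opener `p`, an equidistant vertex projects to `p`.
On an edge `E q` of the same cycle this makes `p` and `q` consecutive openers; any other edge would
make the fibre over `p` nontrivial, hence `p` marked. -/
theorem not_eqd_of_mem_key [Finite V] (hG : G.Connected) {e f : Sym2 V} (he : e ∈ S.key)
    (hf : f ∈ S.key) (hne : e ≠ f) : ∀ w ∈ f, ¬ Eqd G w e := by
  rintro w hw
  rcases he with he | ⟨i, p, hp, rfl⟩
  · exact not_eqd_of_isBridge hG he.1 he.2 w
  · rw [(S.C i).eqd_iff hG]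
    intro hwp
    by_cases h : ∃ q, f = (S.C i).E q
    · obtain ⟨q, rfl⟩ := h
      have hq : (S.C i).Opener q := by
        rcases hf with hf | ⟨j, q', hq', h⟩
        · exact absurd hf.2 ((S.C i).not_isBridge q)
        · cases S.inj _ _ _ _ h
          exact hq'
      rcases Sym2.mem_iff.1 hw with rfl | rfl
      · rw [(S.C i).π_v] at hwp
        rw [← hwp] at hp
        have := S.not_opener_add_one i hp
        rw [sub_add_cancel] at this
        exact this hq
      · rw [(S.C i).π_v] at hwp
        rw [← hwp] at hp
        exact S.not_opener_add_one i hq hp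
    · push Not at h
      have hfE := S.key_subset hf
      have hall := π_eq_of_ne (S.C i) hfE h hw
      apply S.opener_not_cut i hp
      rw [(S.C i).isCutVertex_iff hG]
      induction f with | _ a b =>
      by_cases hb : b = (S.C i).v p
      · refine ⟨a, (hall a (by simp)).trans hwp, fun ha => ?_⟩
        rw [ha, hb] at hfE
        exact G.loopless.irrefl _ hfE
      · exact ⟨b, (hall b (by simp)).trans hwp, hb⟩

theorem ncard_key_le [Finite V] (hG : IsOddCactus G) {k : ℕ} {c : G.edgeSet → Fin k}
    (hc : IsStrongRainbow G c) : S.key.ncard ≤ k := by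
  have : Function.Injective fun e : S.key => c ⟨e, S.key_subset e.2⟩ := by
    rintro ⟨e, he⟩ ⟨f, hf⟩ h
    by_contra hne
    have hne : e ≠ f := fun h => hne (Subtype.ext h)
    obtain ⟨u, v, huv⟩ := exists_forall_geodesic_mem hG (S.key_subset he) (S.key_subset hf) hne
      (S.not_eqd_of_mem_key hG.1.1 he hf hne) (S.not_eqd_of_mem_key hG.1.1 hf he hne.symm)
    obtain ⟨p, -, hp, hp'⟩ := hc u v
    obtain ⟨h1, h2⟩ := huv p hp
    exact hne (congrArg Subtype.val (hp' _ _ h1 h2 h))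
  have := Nat.card_le_card_of_injective _ this
  rwa [Nat.card_fin, Nat.card_coe_set_eq] at this

/-- Beyond a cut vertex on a cycle there is an edge of the key set. -/
theorem exists_mem_key_fibre [Finite V] (hG : IsOddCactus G) (i) {p}
    (h : IsCutVertex G ((S.C i).v p)) : ∃ f ∈ S.key, ∀ x ∈ f, (S.C i).π x = p := by
  have hc := hG.1.1
  obtain ⟨x₀, hx₀⟩ := ((S.C i).isCutVertex_iff hc).1 h
  -- Take a vertex `w` of the fibre farthest from the cycle, and the edge from it to a nearer vertex
  -- `y`. If this is not a bridge, the extremality of `w` makes its position on the cycle `j` of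
  -- that edge unmarked, so this position or its predecessor is an opener.
  obtain ⟨w, ⟨hw1, hw2⟩, hmax⟩ := Set.exists_max_image
    {x | (S.C i).π x = p ∧ x ≠ (S.C i).v p} (G.dist ((S.C i).v p)) (Set.toFinite _) ⟨x₀, hx₀⟩
  subst hw1
  obtain ⟨y, hwy, hd, hy⟩ := (S.C i).exists_adj_closer_fibre hc hw2
  by_cases hb : G.IsBridge s(w, y)
  · refine ⟨s(w, y), .inl ⟨hwy, hb⟩, fun x hx => ?_⟩
    rcases Sym2.mem_iff.1 hx with rfl | rfl
    · rfl
    · exact hy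
  · obtain ⟨j, q, hq⟩ := S.cover _ hwy hb
    have hij : i ≠ j := by
      rintro rfl
      exact (S.C i).π_ne_of_E hq hy.symm
    have hconst := (S.C i).π_const (S.C j) (S.E_ne i j hij)
    have hne := (S.C j).π_ne_of_E hq
    obtain ⟨hw, hy'⟩ : w = (S.C j).v ((S.C j).π w) ∧ y = (S.C j).v ((S.C j).π y) := by
      rcases (S.C j).adj hwy with h | h
      · exact absurd h hne
      · exact ⟨h.1, h.2.1⟩
    have hall : ∀ q, (S.C i).π ((S.C j).v q) = (S.C i).π w := fun q => by
      conv_rhs => rw [hw]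
      rw [hconst, hconst ((S.C j).π w)]
    -- A vertex `x` behind `w`, as seen from the cycle `j`, would lie in the same fibre of the cycle
    -- `i` and be farther away than `w`.
    have hncut : ¬ IsCutVertex G ((S.C j).v ((S.C j).π w)) := by
      rw [(S.C j).isCutVertex_iff hc]
      rintro ⟨x, hxw, hx⟩
      rw [← hw] at hx
      have hr : (S.C j).π ((S.C i).v ((S.C i).π w)) ≠ (S.C j).π w := by
        intro h
        have := (S.C j).dist_v hc ((S.C i).v ((S.C i).π w)) ((S.C j).π y)
        rw [h, ← hw, ← hy'] at this
        omega
      have h1 := (S.C j).dist_ne hc (x := (S.C i).v ((S.C i).π w)) (y := x) (by rwa [hxw])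
      have h2 := (S.C j).dist_v hc ((S.C i).v ((S.C i).π w)) ((S.C j).π w)
      rw [hxw, ← hw] at h1
      rw [← hw] at h2
      have hpos := hc.pos_dist_of_ne (Ne.symm hx)
      have hxi : (S.C i).π x = (S.C i).π w := by
        by_contra hxi
        have h3 := (S.C i).dist_ne hc (x := w) (y := x) (Ne.symm hxi)
        have h4 := (S.C i).dist_v hc x ((S.C i).π w)
        have h5 := hc.dist_triangle (u := w) (v := (S.C i).v ((S.C i).π w)) (w := x)
        rw [G.dist_comm (u := w)] at h3
        have h6 := hc.pos_dist_of_ne (Ne.symm hw2)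
        rw [G.dist_comm (u := (S.C i).v ((S.C i).π w)) (v := (S.C i).v ((S.C i).π x)),
          G.dist_comm (u := (S.C i).v ((S.C i).π x)) (v := x)] at h3
        rw [G.dist_comm (u := x) (v := (S.C i).v ((S.C i).π w))] at h4
        rw [G.dist_comm (u := x) (v := w)] at *
        omega
      have := hmax x ⟨hxi, fun h => hr (by rw [← hxi, ← hxi.symm, ← h, hxw])⟩
      omega
    by_cases ho : (S.C j).Opener ((S.C j).π w)
    · refine ⟨_, .inr ⟨j, _, ho, rfl⟩, fun x hx => ?_⟩
      rcases Sym2.mem_iff.1 hx with rfl | rfl <;> exact hall _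
    · refine ⟨_, .inr ⟨j, _, S.opener_sub_one j ho hncut, rfl⟩, fun x hx => ?_⟩
      rcases Sym2.mem_iff.1 hx with rfl | rfl <;> exact hall _

/-- `f` may serve as the colour of `e`. -/
def Represents (f e : Sym2 V) : Prop :=
  f = e ∨ (∃ i p, ¬ (S.C i).Opener p ∧ ¬ IsCutVertex G ((S.C i).v p) ∧ e = (S.C i).E p ∧
    f = (S.C i).E (p - 1)) ∨
  ∃ i p, e = (S.C i).E p ∧ ∀ x ∈ f, (S.C i).π x = p

theorem exists_represents [Finite V] (hG : IsOddCactus G) (e : Sym2 V) (he : e ∈ G.edgeSet) :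
    ∃ f ∈ S.key, S.Represents f e := by
  by_cases hb : G.IsBridge e
  · exact ⟨e, .inl ⟨he, hb⟩, .inl rfl⟩
  · obtain ⟨i, p, rfl⟩ := S.cover e he hb
    by_cases hc : IsCutVertex G ((S.C i).v p)
    · obtain ⟨f, hf, h⟩ := S.exists_mem_key_fibre hG i hc
      exact ⟨f, hf, .inr (.inr ⟨i, p, rfl, h⟩)⟩
    · by_cases ho : (S.C i).Opener p
      · exact ⟨_, .inr ⟨i, p, ho, rfl⟩, .inl rfl⟩
      · exact ⟨_, .inr ⟨i, p - 1, S.opener_sub_one i ho hc, rfl⟩,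
          .inr (.inl ⟨i, p, ho, hc, rfl, rfl⟩)⟩

/-- An edge behind `v p` has its ends equidistant from `E p`. This passes to other edges represented
by `f`, because a different cycle projects to a single vertex. -/
theorem eqd_of_fibre_of_represents (hG : IsOddCactus G) {f e₁ e₂ : Sym2 V}
    (hf : f ∈ G.edgeSet) (i) (p) (he₁ : e₁ = (S.C i).E p) (h₁ : ∀ x ∈ f, (S.C i).π x = p)
    (h₂ : S.Represents f e₂) (hne : e₁ ≠ e₂) :
    (∃ w ∈ e₁, Eqd G w e₂) ∨ ∃ w ∈ e₂, Eqd G w e₁ := by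
  have hc := hG.1.1
  subst he₁
  rcases h₂ with rfl | ⟨j, q, -, -, rfl, rfl⟩ | ⟨j, q, rfl, h₂⟩
  · right
    induction f with | _ a b =>
    exact ⟨a, by simp, ((S.C i).eqd_iff hc).2 (h₁ a (by simp))⟩
  · right
    have hij : i ≠ j := by
      rintro rfl
      exact (S.C i).π_ne_of_E (show s(_, _) = (S.C i).E (q - 1) from rfl)
        ((h₁ _ (by simp [CycleParam.E])).trans (h₁ _ (by simp [CycleParam.E])).symm)
    have hconst := (S.C i).π_const (S.C j) (S.E_ne i j hij)
    refine ⟨(S.C j).v (q + 1), by simp [CycleParam.E], ((S.C i).eqd_iff hc).2 ?_⟩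
    rw [← h₁ ((S.C j).v (q - 1 + 1)) (by simp [CycleParam.E]), hconst, hconst (q - 1 + 1)]
  · have hfw : ∃ w, w ∈ f := by
      induction f with | _ a b => exact ⟨a, by simp⟩
    obtain ⟨w, hw⟩ := hfw
    have hw1 := h₁ w hw
    have hw2 := h₂ w hw
    have hij : i ≠ j := by
      rintro rfl
      exact hne (by rw [← hw1, ← hw2])
    have hci := (S.C i).π_const (S.C j) (S.E_ne i j hij)
    have hcj := (S.C j).π_const (S.C i) (S.E_ne j i hij.symm)
    by_cases h1 : (S.C i).π ((S.C j).v 0) = p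
    · right
      refine ⟨(S.C j).v (q + 1), by simp [CycleParam.E], ((S.C i).eqd_iff hc).2 ?_⟩
      rw [hci, h1]
    by_cases h2 : (S.C j).π ((S.C i).v 0) = q
    · left
      refine ⟨(S.C i).v (p + 1), by simp [CycleParam.E], ((S.C j).eqd_iff hc).2 ?_⟩
      rw [hcj, h2]
    -- Now `w` reaches the cycle `j` only through `(S.C i).v p`, and enters it at the projection of
    -- the cycle `i`, which is not at position `q`. So some vertex of the cycle `j` is nearer to `w`
    -- than its own projection, which is impossible.
    exfalso
    have key : ∀ t, G.dist w ((S.C j).v t) =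
        G.dist w ((S.C i).v p) + G.dist ((S.C i).v p) ((S.C j).v t) := by
      intro t
      have e1 := (S.C i).dist_ne hc (x := w) (y := (S.C j).v t) (by rw [hw1, hci]; exact Ne.symm h1)
      have e2 := (S.C i).dist_v hc ((S.C j).v t) p
      rw [hw1] at e1
      rw [G.dist_comm, G.dist_comm (u := (S.C j).v t), G.dist_comm (v := (S.C i).v p)] at e2
      omega
    have k1 := key q
    have k2 := key ((S.C j).π ((S.C i).v 0))
    have d1 := (S.C j).dist_v hc ((S.C i).v p) q
    rw [hcj] at d1
    have d2 := (S.C j).dist_v hc w ((S.C j).π ((S.C i).v 0))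
    rw [hw2] at d2
    have d3 := hc.pos_dist_of_ne (fun h => h2 ((S.C j).inj h))
    rw [G.dist_comm (u := (S.C j).v q)] at d2
    omega

theorem eqd_of_represents (hG : IsOddCactus G) {f e₁ e₂ : Sym2 V} (hf : f ∈ G.edgeSet)
    (h₁ : S.Represents f e₁) (h₂ : S.Represents f e₂) (hne : e₁ ≠ e₂) :
    (∃ w ∈ e₁, Eqd G w e₂) ∨ ∃ w ∈ e₂, Eqd G w e₁ := by
  have hc := hG.1.1
  have hfol : ∀ i p, ∃ w ∈ (S.C i).E (p - 1), Eqd G w ((S.C i).E p) := fun i p =>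
    ⟨(S.C i).v p, by simp [CycleParam.E], ((S.C i).eqd_iff hc).2 ((S.C i).π_v p)⟩
  rcases h₁ with rfl | ⟨i, p, hp, hpc, rfl, hf'⟩ | ⟨i, p, he, h⟩
  · rcases h₂ with rfl | ⟨j, q, -, -, rfl, rfl⟩ | ⟨j, q, he, h⟩
    · exact absurd rfl hne
    · left; exact hfol j q
    · exact (S.eqd_of_fibre_of_represents hG hf j q he h (.inl rfl) hne.symm).symm
  · rcases h₂ with rfl | ⟨j, q, -, -, rfl, hf''⟩ | ⟨j, q, he, h⟩
    · right; rw [hf']; exact hfol i p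
    · rw [hf'] at hf''
      have := S.inj _ _ _ _ hf''
      obtain rfl : i = j := congrArg Sigma.fst this
      have := (S.C i).E_injective hf''
      exact absurd (by rw [sub_left_injective this]) hne
    · exact (S.eqd_of_fibre_of_represents hG hf j q he h
        (.inr (.inl ⟨i, p, hp, hpc, rfl, hf'⟩)) hne.symm).symm
  · exact S.eqd_of_fibre_of_represents hG hf i p he h h₂ hne

/-- Every geodesic is rainbow, since related edges never lie on a common one. -/
theorem isStrongRainbow_of_eqd (hG : G.Connected) {k : ℕ} (c : G.edgeSet → Fin k)
    (h : ∀ e f : G.edgeSet, c e = c f → e ≠ f →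
      (∃ w ∈ (e : Sym2 V), Eqd G w f) ∨ ∃ w ∈ (f : Sym2 V), Eqd G w e) :
    IsStrongRainbow G c := by
  intro u v
  obtain ⟨p, hp, hl⟩ := hG.exists_path_of_dist u v
  refine ⟨p, hp, hl, fun e f he hf hef => ?_⟩
  by_contra hne
  rcases h e f hef hne with ⟨w, hw, h⟩ | ⟨w, hw, h⟩
  · exact not_eqd_of_geodesic hG p hl hf (p.mem_support_of_mem_edges he hw) h
  · exact not_eqd_of_geodesic hG p hl he (p.mem_support_of_mem_edges hf hw) h

theorem src_eq [Finite V] (hG : IsOddCactus G) : src G = S.key.ncard := by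
  have hmem : S.key.ncard ∈ {k : ℕ | ∃ c : G.edgeSet → Fin k, IsStrongRainbow G c} := by
    have hex : ∀ e : G.edgeSet, ∃ f : S.key, S.Represents f e := fun e => by
      obtain ⟨f, hf, h⟩ := S.exists_represents hG e e.2
      exact ⟨⟨f, hf⟩, h⟩
    choose φ hφ using hex
    have eq : S.key ≃ Fin S.key.ncard := Finite.equivFinOfCardEq (Nat.card_coe_set_eq _)
    refine ⟨fun e => eq (φ e), isStrongRainbow_of_eqd hG.1.1 _ fun e f h hne => ?_⟩
    have h := eq.injective h
    exact S.eqd_of_represents hG (S.key_subset (φ e).2) (hφ e) (h ▸ hφ f)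
      (fun h => hne (Subtype.ext h))
  apply le_antisymm (Nat.sInf_le hmem)
  obtain ⟨c, hc⟩ := Nat.sInf_mem ⟨_, hmem⟩
  exact S.ncard_key_le hG hc

end CycleSystem

end Colouring
end OddCactus

namespace OddCactus

/-! ### Segments as runs of unmarked positions, and the formula -/

section Counting

variable {V : Type*} {G : SimpleGraph V}

theorem length_trace {u v : V} (p : G.Walk u v) : (trace p).length = 2 * p.length + 1 := by
  induction p with
  | nil => rfl
  | cons h p ih => simp only [trace, List.length_cons, ih, SimpleGraph.Walk.length_cons]; omega

theorem getElem?_trace {u v : V} (p : G.Walk u v) {j : ℕ} (hj : j ≤ 2 * p.length) :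
    (trace p)[j]? = some (if Even j then Sum.inl (p.getVert (j / 2))
      else Sum.inr s(p.getVert (j / 2), p.getVert (j / 2 + 1))) := by
  induction p generalizing j with
  | nil =>
    obtain rfl : j = 0 := by simpa using hj
    simp [trace]
  | cons h p ih =>
    rw [SimpleGraph.Walk.length_cons] at hj
    match j with
    | 0 => simp [trace]
    | 1 => simp [trace]
    | j + 2 =>
      have := ih (j := j) (by omega)
      simp only [trace, List.getElem?_cons_succ, this, Nat.even_add, even_two, iff_true,
        show (j + 2) / 2 = j / 2 + 1 by omega, SimpleGraph.Walk.getVert_cons_succ]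

namespace CycleParam

variable (C : CycleParam G)

/-- The alternating sequence of the vertices and edges of a cycle. -/
def elem (p₀ ε : ZMod (2 * C.k + 1)) (j : ℕ) : V ⊕ Sym2 V :=
  if Even j then Sum.inl (C.v (p₀ + ε * j)) else Sum.inr (C.E (p₀ + ε * j))

/-- The vertex `C.v p` is followed by the edge `C.E (p + 1)`, so in the alternating sequence each
element moves the parameter by one; `ε` is the direction. -/
theorem trace_eq {u v : V} {c : G.Walk u v} {p₀ ε : ZMod (2 * C.k + 1)} (hε : ε = 1 ∨ ε = -1)
    (hc : ∀ i ≤ c.length, c.getVert i = C.v (p₀ + ε * (2 * i))) :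
    trace c = (List.range (2 * c.length + 1)).map (C.elem p₀ ε) := by
  apply List.ext_getElem?
  intro j
  rcases Nat.lt_or_ge j (2 * c.length + 1) with hj | hj
  · rw [getElem?_trace c (by omega), List.getElem?_map, List.getElem?_range hj, Option.map_some,
      elem]
    congr 1
    obtain ⟨i, rfl | rfl⟩ := Nat.even_or_odd' j
    · rw [if_pos (even_two_mul i), if_pos (even_two_mul i),
        show 2 * i / 2 = i by omega, hc i (by omega)]
      push_cast; rfl
    · have ho : ¬ Even (2 * i + 1) := by simp
      rw [if_neg ho, if_neg ho, show (2 * i + 1) / 2 = i by omega, hc i (by omega),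
        hc (i + 1) (by omega), E]
      rcases hε with rfl | rfl
      · exact congrArg₂ (fun x y => Sum.inr s(C.v x, C.v y)) (by push_cast; ring)
          (by push_cast; ring)
      · rw [Sym2.eq_swap]
        exact congrArg₂ (fun x y => Sum.inr s(C.v x, C.v y)) (by push_cast; ring)
          (by push_cast; ring)
  · rw [List.getElem?_eq_none (by rw [length_trace]; omega),
      List.getElem?_eq_none (by simpa using hj)]

theorem mem_edges_iff (hG : IsCactus G) {u : V} {c : G.Walk u u} (hc : c.IsCycle) {p}
    (hp : C.E p ∈ c.edges) (e : Sym2 V) : e ∈ c.edges ↔ ∃ q, e = C.E q := by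
  obtain ⟨W, h1, h2, h3⟩ := C.exists_cycle 0
  rw [← C.mem_edges_cycle h2 h3]
  exact hG.2 _ _ c W hc h1 ⟨C.E p, hp, (C.mem_edges_cycle h2 h3 _).2 ⟨p, rfl⟩⟩ e

theorem other_end {q a : ZMod (2 * C.k + 1)} {w : V} (h : s(C.v a, w) = C.E q) :
    w = C.v (a + 2) ∨ w = C.v (a - 2) := by
  rcases Sym2.eq_iff.1 h with ⟨h1, rfl⟩ | ⟨h1, rfl⟩
  · left
    exact congrArg C.v (by linear_combination -C.inj h1)
  · right
    exact congrArg C.v (by linear_combination -C.inj h1)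

/-- Each vertex has only two neighbours along the cycle and a cycle does not turn back, so the
direction of the first edge persists. -/
theorem exists_getVert_eq (hG : IsCactus G) {u : V} {c : G.Walk u u} (hc : c.IsCycle) {p}
    (hp : C.E p ∈ c.edges) : ∃ p₀ ε : ZMod (2 * C.k + 1), (ε = 1 ∨ ε = -1) ∧
      ∀ i ≤ c.length, c.getVert i = C.v (p₀ + ε * (2 * i)) := by
  have h3 := hc.three_le_length
  have hE : ∀ i < c.length, ∃ q, s(c.getVert i, c.getVert (i + 1)) = C.E q := by
    intro i hi
    rw [← C.mem_edges_iff hG hc hp, SimpleGraph.Walk.mk_mem_edges_iff_exists]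
    exact ⟨i, hi, rfl⟩
  obtain ⟨p₀, h0⟩ : ∃ p₀, c.getVert 0 = C.v p₀ := by
    obtain ⟨q, hq⟩ := hE 0 (by omega)
    rcases Sym2.eq_iff.1 hq with ⟨h, -⟩ | ⟨h, -⟩
    · exact ⟨_, h⟩
    · exact ⟨_, h⟩
  obtain ⟨ε, hε, h1⟩ : ∃ ε : ZMod (2 * C.k + 1), (ε = 1 ∨ ε = -1) ∧
      c.getVert 1 = C.v (p₀ + ε * 2) := by
    obtain ⟨q, hq⟩ := hE 0 (by omega)
    rw [h0] at hq
    rcases C.other_end hq with h | h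
    · exact ⟨1, .inl rfl, by rw [h, one_mul]⟩
    · exact ⟨-1, .inr rfl, by rw [h]; congr 1; ring⟩
  have key : ∀ i, i + 1 ≤ c.length → c.getVert i = C.v (p₀ + ε * (2 * i)) ∧
      c.getVert (i + 1) = C.v (p₀ + ε * (2 * (i + 1 : ℕ))) := by
    intro i
    induction i with
    | zero => intro _; exact ⟨by simpa using h0, by simpa using h1⟩
    | succ i ih =>
      intro hi
      obtain ⟨e1, e2⟩ := ih (by omega)
      refine ⟨e2, ?_⟩
      obtain ⟨q, hq⟩ := hE (i + 1) (by omega)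
      have hne := hc.getVert_sub_one_ne_getVert_add_one (i := i + 1) (by omega)
      rw [Nat.add_sub_cancel, e1] at hne
      rw [e2] at hq
      rcases C.other_end hq with h | h <;> rcases hε with rfl | rfl
      · rw [h]; congr 1; push_cast; ring
      · exact absurd (h.trans (congrArg C.v (by push_cast; ring))).symm hne
      · exact absurd (h.trans (congrArg C.v (by push_cast; ring))).symm hne
      · rw [h]; congr 1; push_cast; ring
  refine ⟨p₀, ε, hε, fun i hi => ?_⟩
  cases i with
  | zero => simpa using h0
  | succ i => exact (key i hi).2

end CycleParam

namespace CycleSystem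

variable {ι : Type*} (S : CycleSystem G ι)

/-- The vertex of the cycle equidistant from `E p` is `v p`. Thus the vertex and the edge with the
same parameter are marked together, and segments become runs of unmarked parameters. -/
theorem mem_antEdges_iff (hG : IsOddCactus G) (i) (p) :
    (S.C i).E p ∈ antEdges G ↔ IsCutVertex G ((S.C i).v p) := by
  have hc := hG.1.1
  constructor
  · rintro ⟨-, v, ⟨w, c, hcc, -, hv, he, hd⟩, hcut⟩
    have hpi : (S.C i).π v = p := ((S.C i).eqd_iff hc).1 hd
    have : ∃ e ∈ c.edges, v ∈ e := by
      rw [SimpleGraph.Walk.mem_support_iff_exists_getVert] at hv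
      obtain ⟨j, rfl, hj⟩ := hv
      have h3 := hcc.three_le_length
      rcases hj.lt_or_eq with hj | hj
      · exact ⟨_, (SimpleGraph.Walk.mk_mem_edges_iff_exists c).2 ⟨j, hj, rfl⟩, by simp⟩
      · refine ⟨_, (SimpleGraph.Walk.mk_mem_edges_iff_exists c).2 ⟨0, by omega, rfl⟩, ?_⟩
        rw [hj]; simp
    obtain ⟨e, he', hve⟩ := this
    obtain ⟨q, rfl⟩ := ((S.C i).mem_edges_iff hG.1 hcc he e).1 he'
    have : v = (S.C i).v ((S.C i).π v) := by
      rcases Sym2.mem_iff.1 hve with rfl | rfl <;> rw [(S.C i).π_v]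
    rwa [← hpi, ← this]
  · intro h
    obtain ⟨W, h1, h2, h3⟩ := (S.C i).exists_cycle p
    exact ⟨(S.C i).E_mem p, _, ⟨_, W, h1, hG.2 _ W h1, W.start_mem_support,
      ((S.C i).mem_edges_cycle h2 h3 _).2 ⟨p, rfl⟩,
      ((S.C i).eqd_iff hc).2 ((S.C i).π_v p)⟩, h⟩

theorem isMarked_elem (hG : IsOddCactus G) (i) (p₀ ε) (j : ℕ) :
    IsMarked G ((S.C i).elem p₀ ε j) ↔ IsCutVertex G ((S.C i).v (p₀ + ε * j)) := by
  rw [CycleParam.elem]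
  split_ifs
  · rfl
  · exact S.mem_antEdges_iff hG i _

theorem opener_iff_odd (i) (m : ℕ) : ∀ q, IsCutVertex G ((S.C i).v (q - m)) →
    (∀ t < m, ¬ IsCutVertex G ((S.C i).v (q - (t : ℕ)))) → ((S.C i).Opener q ↔ Odd m) := by
  induction m with
  | zero =>
    intro q h _
    simp only [Nat.cast_zero, sub_zero] at h
    simpa using fun h' => S.opener_not_cut i h' h
  | succ m ih =>
    intro q h h'
    have h1 := ih (q - 1) (by rwa [show q - 1 - m = q - (m + 1 : ℕ) by push_cast; ring])
      (fun t ht => by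
        have := h' (t + 1) (by omega)
        rwa [show q - 1 - t = q - (t + 1 : ℕ) by push_cast; ring])
    have h2 := (S.C i).opener_add_one (S.cut_zero i) (q - 1)
    have h3 := h' 0 (by omega)
    rw [Nat.cast_zero, sub_zero] at h3
    rw [sub_add_cancel, h1] at h2
    rw [h2, Nat.odd_add_one]
    exact and_iff_right h3

/-- The elements of the unmarked segment that ends in the edge `E q`, counted backwards. -/
def back (x : Σ i, ZMod (2 * (S.C i).k + 1)) (t : ℕ) : V ⊕ Sym2 V :=
  if Even t then Sum.inr ((S.C x.1).E (x.2 - t)) else Sum.inl ((S.C x.1).v (x.2 - t))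

def seg (x : Σ i, ZMod (2 * (S.C i).k + 1)) : Set (V ⊕ Sym2 V) :=
  {z | ∃ t : ℕ, (∀ s ≤ t, ¬ IsCutVertex G ((S.C x.1).v (x.2 - (s : ℕ)))) ∧ z = S.back x t}

def Marked (x : Σ i, ZMod (2 * (S.C i).k + 1)) : Prop := IsCutVertex G ((S.C x.1).v x.2)

def Opener (x : Σ i, ZMod (2 * (S.C i).k + 1)) : Prop := (S.C x.1).Opener x.2

/-- The next position on the same cycle. -/
def next : Equiv.Perm (Σ i, ZMod (2 * (S.C i).k + 1)) :=
  Equiv.sigmaCongrRight fun _ => Equiv.addRight 1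

/-- The last position of an unmarked run of odd length. In the alternating sequence the boundary
elements of a run of length `m` are `m + 1` places apart, so both can be vertices only for odd `m`;
loners therefore index `𝒮₁`. -/
def Loner (x : Σ i, ZMod (2 * (S.C i).k + 1)) : Prop := S.Opener x ∧ S.Marked (S.next x)

theorem seg_eq (x) (m : ℕ) (h : IsCutVertex G ((S.C x.1).v (x.2 - m)))
    (h' : ∀ t < m, ¬ IsCutVertex G ((S.C x.1).v (x.2 - (t : ℕ)))) :
    S.seg x = {z | ∃ t < m, z = S.back x t} := by
  ext z
  constructor
  · rintro ⟨t, ht, rfl⟩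
    refine ⟨t, ?_, rfl⟩
    by_contra hm
    exact ht m (by omega) h
  · rintro ⟨t, ht, rfl⟩
    exact ⟨t, fun s hs => h' s (by omega), rfl⟩

/-- The position after a loner is marked, so its edge can only be the last element of another
loner's segment, not an inner one. -/
theorem seg_injOn : Set.InjOn S.seg {x | S.Loner x} := by
  rintro ⟨i, q⟩ hq ⟨j, q'⟩ hq' h
  have hmem : Sum.inr ((S.C i).E q) ∈ S.seg ⟨i, q⟩ := by
    refine ⟨0, fun s hs => ?_, ?_⟩
    · obtain rfl : s = 0 := by omega
      simpa using S.opener_not_cut i hq.1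
    · simp [back]
  rw [h] at hmem
  obtain ⟨t, ht, he⟩ := hmem
  rw [back] at he
  split_ifs at he with hev
  have he := S.inj _ _ _ _ (Sum.inr_injective he)
  obtain rfl : i = j := congrArg Sigma.fst he
  have he := eq_of_heq (Sigma.mk.inj he).2
  simp only at he ht
  cases t with
  | zero => rw [he]; simp
  | succ t =>
    exfalso
    apply ht t (by omega)
    have : IsCutVertex G ((S.C i).v (q + 1)) := hq.2
    rwa [he, show q' - ((t + 1 : ℕ) : ZMod (2 * (S.C i).k + 1)) + 1 = q' - t by
      push_cast; ring] at this

end CycleSystem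

/-- Positions are openers, marked ones, or followers that are neither. Followers are exactly the
successors of the openers that are not loners. -/
theorem ncard_opener_loner {T : Type*} [Finite T] (σ : Equiv.Perm T) (Op M : T → Prop)
    (h : ∀ x, Op (σ x) ↔ ¬ M (σ x) ∧ ¬ Op x) :
    Nat.card T + {x | Op x ∧ M (σ x)}.ncard = 2 * {x | Op x}.ncard + {x | M x}.ncard := by
  classical
  have hM : ∀ x, Op x → ¬ M x := fun x hx => by
    have := h (σ.symm x)
    rw [σ.apply_symm_apply] at this
    exact (this.1 hx).1
  have h1 : {x | Op x}.ncard = {x | Op x ∧ M (σ x)}.ncard + {x | Op x ∧ ¬ M (σ x)}.ncard := by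
    rw [← Set.ncard_union_eq (by
      rw [Set.disjoint_left]; exact fun x hx hx' => hx'.2 hx.2)]
    congr 1; ext x; simp only [Set.mem_union, Set.mem_ofPred_eq]; tauto
  have h2 : {x | Op x ∧ ¬ M (σ x)}.ncard = {x | ¬ Op x ∧ ¬ M x}.ncard := by
    rw [← Set.ncard_image_of_injective _ σ.injective]
    congr 1
    ext y
    simp only [Set.mem_image, Set.mem_ofPred_eq]
    constructor
    · rintro ⟨x, ⟨hx, hx'⟩, rfl⟩
      exact ⟨fun h' => ((h x).1 h').2 hx, hx'⟩
    · rintro ⟨hy, hy'⟩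
      have := h (σ.symm y)
      rw [σ.apply_symm_apply] at this
      refine ⟨σ.symm y, ⟨?_, ?_⟩, σ.apply_symm_apply y⟩
      · by_contra hx; exact hy (this.2 ⟨hy', hx⟩)
      · rwa [σ.apply_symm_apply]
  have h3 : Nat.card T = {x | Op x}.ncard + {x | M x}.ncard + {x | ¬ Op x ∧ ¬ M x}.ncard := by
    rw [← Set.ncard_univ, ← Set.ncard_union_eq (by
      rw [Set.disjoint_left]; exact fun x hx hx' => hM x hx hx'), ← Set.ncard_union_eq (by
      rw [Set.disjoint_left]
      rintro x (hx | hx) hx'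
      · exact hx'.1 hx
      · exact hx'.2 hx)]
    congr 1; ext x; simp only [Set.mem_union, Set.mem_ofPred_eq, Set.mem_univ, true_iff]; tauto
  omega

namespace CycleSystem

variable {ι : Type*} (S : CycleSystem G ι)

theorem segments₁_subset (hG : IsOddCactus G) {z} (hz : z ∈ segments₁ G) :
    ∃ x, S.Loner x ∧ S.seg x = z := by
  obtain ⟨w, c, u, v, l, hc, -, ⟨hl, hinf, hu, hv, hlm⟩, rfl⟩ := hz
  have h3 := hc.three_le_length
  have he : s(c.getVert 0, c.getVert 1) ∈ c.edges :=
    (SimpleGraph.Walk.mk_mem_edges_iff_exists c).2 ⟨0, by omega, rfl⟩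
  obtain ⟨i, p, hp⟩ := S.cover _ (c.edges_subset_edgeSet he) (fun h => h.notMem_edges_of_isCycle hc he)
  rw [hp] at he
  obtain ⟨p₀, ε, hε, hg⟩ := (S.C i).exists_getVert_eq hG.1 hc he
  rw [(S.C i).trace_eq hε hg] at hinf
  obtain ⟨a, b, hab⟩ := hinf
  have key : ∀ j (hj : j < l.length + 2), (Sum.inl u :: l ++ [Sum.inl v])[j]? =
      some ((S.C i).elem p₀ ε (a.length + j)) := by
    intro j hj
    have h1 := congrArg (fun L => L[a.length + j]?) hab
    have h2 := congrArg List.length hab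
    simp only [List.length_append, List.length_cons, List.length_nil, List.length_map,
      List.length_range] at h2
    simp only [List.append_assoc] at h1
    rw [List.getElem?_append_right (by omega), Nat.add_sub_cancel_left, ← List.append_assoc,
      List.getElem?_append_left (by simp; omega), List.getElem?_map,
      List.getElem?_range (by omega), Option.map_some] at h1
    exact h1
  have k0 := key 0 (by omega)
  have km := key (l.length + 1) (by omega)
  have kt : ∀ t (ht : t < l.length), l[t] = (S.C i).elem p₀ ε (a.length + (t + 1)) := by
    intro t ht
    have := key (t + 1) (by omega)
    rw [List.cons_append, List.getElem?_cons_succ, List.getElem?_append_left ht,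
      List.getElem?_eq_getElem ht] at this
    exact Option.some_injective _ this
  simp only [List.cons_append, List.getElem?_cons_zero, List.getElem?_cons_succ,
    List.getElem?_concat_length, Option.some.injEq] at k0 km
  rw [k0, S.isMarked_elem hG] at hu
  rw [km, S.isMarked_elem hG] at hv
  have hun : ∀ t < l.length, ¬ IsCutVertex G ((S.C i).v (p₀ + ε * (a.length + (t + 1) : ℕ))) := by
    intro t ht
    rw [← S.isMarked_elem hG, ← kt t ht]
    exact hlm _ (List.getElem_mem ht)
  have heven : Even a.length := by
    rw [CycleParam.elem, add_zero] at k0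
    by_contra h
    rw [if_neg h] at k0
    cases k0
  have hodd : Odd l.length := by
    rw [CycleParam.elem] at km
    split_ifs at km with h
    rw [Nat.even_add, Nat.even_add_one] at h
    rw [← Nat.not_even_iff_odd]
    exact h.1 heven
  have hset : {z | z ∈ l} = {z | ∃ t < l.length, z = (S.C i).elem p₀ ε (a.length + (t + 1))} := by
    ext z
    rw [Set.mem_ofPred_eq, Set.mem_ofPred_eq, List.mem_iff_getElem]
    constructor
    · rintro ⟨t, ht, rfl⟩; exact ⟨t, ht, kt t ht⟩
    · rintro ⟨t, ht, rfl⟩; exact ⟨t, ht, kt t ht⟩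
  rw [hset]
  suffices ∃ q : ZMod (2 * (S.C i).k + 1), IsCutVertex G ((S.C i).v (q + 1)) ∧
      IsCutVertex G ((S.C i).v (q - l.length)) ∧
      (∀ t < l.length, ¬ IsCutVertex G ((S.C i).v (q - (t : ℕ)))) ∧
      {z | ∃ t < l.length, z = (S.C i).elem p₀ ε (a.length + (t + 1))} =
        {z | ∃ t < l.length, z = S.back ⟨i, q⟩ t} by
    obtain ⟨q, h1, h2, h3, h4⟩ := this
    refine ⟨⟨i, q⟩, ⟨(S.opener_iff_odd i _ q h2 h3).2 hodd, h1⟩, ?_⟩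
    rw [h4]
    exact S.seg_eq ⟨i, q⟩ _ h2 h3
  -- The segment is indexed by its edge of largest parameter: its last element in the forward
  -- direction, its first in the backward one.
  rcases hε with rfl | rfl
  · refine ⟨p₀ + a.length + l.length, ?_, ?_, ?_, ?_⟩
    · convert hv using 2; push_cast; ring
    · convert hu using 2; push_cast; ring
    · intro t ht
      have := hun (l.length - (t + 1)) (by omega)
      convert this using 3
      rw [show l.length - (t + 1) + 1 = l.length - t by omega]
      push_cast [ht.le]; ring
    · have hb : ∀ t < l.length, (S.C i).elem p₀ 1 (a.length + (l.length - (t + 1) + 1)) =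
          S.back ⟨i, p₀ + a.length + l.length⟩ t := by
        intro t ht
        have hpos : p₀ + 1 * ((a.length + (l.length - (t + 1) + 1) : ℕ) : ZMod (2 * (S.C i).k + 1))
            = p₀ + a.length + l.length - t := by
          rw [show l.length - (t + 1) + 1 = l.length - t by omega]
          push_cast [ht.le]; ring
        have hpar : Even (a.length + (l.length - (t + 1) + 1)) ↔ ¬ Even t := by
          rw [show l.length - (t + 1) + 1 = l.length - t by omega, Nat.even_add,
            Nat.even_sub ht.le]
          have := Nat.not_even_iff_odd.2 hodd
          tauto
        rw [CycleParam.elem, back, hpos]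
        by_cases h : Even t
        · rw [if_neg (by tauto), if_pos h]
        · rw [if_pos (by tauto), if_neg h]
      ext z
      constructor
      · rintro ⟨t, ht, rfl⟩
        refine ⟨l.length - (t + 1), by omega, ?_⟩
        rw [← hb _ (by omega)]
        congr 2; omega
      · rintro ⟨t, ht, rfl⟩
        exact ⟨l.length - (t + 1), by omega, (hb t ht).symm⟩
  · refine ⟨p₀ - a.length - 1, ?_, ?_, ?_, ?_⟩
    · convert hu using 2; push_cast; ring
    · convert hv using 2; push_cast; ring
    · intro t ht
      convert hun t ht using 3
      push_cast; ring
    · have hb : ∀ t < l.length, (S.C i).elem p₀ (-1) (a.length + (t + 1)) =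
          S.back ⟨i, p₀ - a.length - 1⟩ t := by
        intro t ht
        have hpos : p₀ + (-1) * ((a.length + (t + 1) : ℕ) : ZMod (2 * (S.C i).k + 1))
            = p₀ - a.length - 1 - t := by
          push_cast; ring
        have hpar : Even (a.length + (t + 1)) ↔ ¬ Even t := by
          rw [Nat.even_add, Nat.even_add_one]
          tauto
        rw [CycleParam.elem, back, hpos]
        by_cases h : Even t
        · rw [if_neg (by tauto), if_pos h]
        · rw [if_pos (by tauto), if_neg h]
      ext z
      constructor
      · rintro ⟨t, ht, rfl⟩; exact ⟨t, ht, hb t ht⟩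
      · rintro ⟨t, ht, rfl⟩; exact ⟨t, ht, (hb t ht).symm⟩

theorem seg_mem_segments₁ (hG : IsOddCactus G) {x} (hx : S.Loner x) : S.seg x ∈ segments₁ G := by
  classical
  obtain ⟨i, q⟩ := x
  have hq1 : IsCutVertex G ((S.C i).v (q + 1)) := hx.2
  have hex : ∃ m : ℕ, IsCutVertex G ((S.C i).v (q - (m : ℕ))) :=
    ⟨q.val, by rw [ZMod.natCast_zmod_val, sub_self]; exact S.cut_zero i⟩
  obtain ⟨m, hm, hmin, hmq⟩ : ∃ m : ℕ, IsCutVertex G ((S.C i).v (q - (m : ℕ))) ∧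
      (∀ t < m, ¬ IsCutVertex G ((S.C i).v (q - (t : ℕ)))) ∧ m ≤ q.val :=
    ⟨Nat.find hex, Nat.find_spec hex, fun t ht => Nat.find_min hex ht, Nat.find_min' hex (by
      rw [ZMod.natCast_zmod_val, sub_self]; exact S.cut_zero i)⟩
  have hodd := (S.opener_iff_odd i m q hm hmin).1 hx.1
  obtain ⟨W, h1, h2, h3⟩ := (S.C i).exists_cycle 0
  have htr := (S.C i).trace_eq (c := W) (p₀ := 0) (ε := 1) (.inl rfl) (fun j hj => by
    rw [h3 j (by omega), one_mul])
  have hqv := ZMod.val_lt q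
  -- The alternating sequence goes through the parameters twice, with opposite parities of the
  -- index. An even index makes the left boundary element a vertex rather than an edge.
  obtain ⟨s, hs, hse, hsl⟩ : ∃ s : ℕ, (s : ZMod (2 * (S.C i).k + 1)) = q - m ∧ Even s ∧
      s + m + 1 ≤ 2 * (2 * (S.C i).k + 1) := by
    by_cases h : Even (q.val - m)
    · exact ⟨q.val - m, by push_cast [hmq]; rw [ZMod.natCast_zmod_val], h, by omega⟩
    · refine ⟨q.val - m + (2 * (S.C i).k + 1), ?_, ?_, by omega⟩
      · have := ZMod.natCast_self (2 * (S.C i).k + 1)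
        rw [Nat.cast_add, this]
        push_cast [hmq]
        rw [ZMod.natCast_zmod_val, add_zero]
      · rw [Nat.even_add]
        simp [h]
  have hX : ∀ j, (S.C i).elem 0 1 j = if Even j then Sum.inl ((S.C i).v (j : ℕ))
      else Sum.inr ((S.C i).E (j : ℕ)) := fun j => by rw [CycleParam.elem, zero_add, one_mul]
  refine ⟨_, W, (S.C i).v s, (S.C i).v (s + m + 1 : ℕ),
    (List.range' (s + 1) m).map ((S.C i).elem 0 1), h1, S.cut_zero i, ⟨?_, ?_, ?_, ?_, ?_⟩, ?_⟩
  · intro h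
    rw [List.map_eq_nil_iff, List.range'_eq_nil_iff] at h
    subst h
    exact absurd hodd (by decide)
  · rw [htr]
    have e0 : (Sum.inl ((S.C i).v s) : V ⊕ Sym2 V) = (S.C i).elem 0 1 s := by
      rw [hX, if_pos hse]
    have e1 : (Sum.inl ((S.C i).v (s + m + 1 : ℕ)) : V ⊕ Sym2 V)
        = (S.C i).elem 0 1 (s + 1 + m) := by
      rw [hX, if_pos, show s + 1 + m = s + m + 1 by ring]
      rw [Nat.even_add, Nat.even_add_one]
      have := Nat.not_even_iff_odd.2 hodd
      tauto
    rw [e0, e1]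
    have : (S.C i).elem 0 1 s :: (List.range' (s + 1) m).map ((S.C i).elem 0 1) ++
        [(S.C i).elem 0 1 (s + 1 + m)] = (List.range' s (m + 2)).map ((S.C i).elem 0 1) := by
      rw [List.range'_succ, List.map_cons, List.range'_concat, List.map_append, List.cons_append]
      simp
    rw [this]
    apply List.IsInfix.map
    refine ⟨List.range' 0 s, List.range' (s + (m + 2)) (2 * W.length + 1 - (s + (m + 2))), ?_⟩
    rw [List.range_eq_range']
    have e2 := List.range'_append_1 (s := 0) (m := s) (n := m + 2)
    rw [zero_add] at e2
    rw [e2]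
    have e3 := List.range'_append_1 (s := 0) (m := s + (m + 2))
      (n := 2 * W.length + 1 - (s + (m + 2)))
    rw [zero_add] at e3
    rw [e3]
    congr 1
    omega
  · show IsCutVertex G _
    rw [hs]; exact hm
  · show IsCutVertex G _
    push_cast
    rw [hs, sub_add_cancel]; exact hq1
  · intro z hz
    rw [List.mem_map] at hz
    obtain ⟨j, hj, rfl⟩ := hz
    rw [List.mem_range'_1] at hj
    rw [S.isMarked_elem hG]
    have := hmin (s + m - j) (by omega)
    convert this using 3
    rw [Nat.cast_sub (by omega)]
    push_cast
    rw [hs]; ring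
  · rw [S.seg_eq ⟨i, q⟩ m hm hmin]
    have hb : ∀ t < m, S.back ⟨i, q⟩ t = (S.C i).elem 0 1 (s + m - t) := by
      intro t ht
      have hc : ((s + m - t : ℕ) : ZMod (2 * (S.C i).k + 1)) = q - t := by
        rw [Nat.cast_sub (by omega)]
        push_cast
        rw [hs]; ring
      have hpar : Even (s + m - t) ↔ ¬ Even t := by
        rw [Nat.even_sub (by omega), Nat.even_add]
        have := Nat.not_even_iff_odd.2 hodd
        tauto
      rw [hX, back, hc]
      by_cases h : Even t
      · rw [if_pos h, if_neg (by tauto)]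
      · rw [if_neg h, if_pos (by tauto)]
    ext z
    rw [Set.mem_ofPred_eq, Set.mem_ofPred_eq, List.mem_map]
    constructor
    · rintro ⟨t, ht, rfl⟩
      exact ⟨s + m - t, List.mem_range'_1.2 (by omega), (hb t ht).symm⟩
    · rintro ⟨j, hj, rfl⟩
      rw [List.mem_range'_1] at hj
      refine ⟨s + m - j, by omega, ?_⟩
      rw [hb _ (by omega)]
      congr 1; omega

/-- The edge opposite to a position. -/
def edge (x : Σ i, ZMod (2 * (S.C i).k + 1)) : Sym2 V := (S.C x.1).E x.2

theorem edge_injective : Function.Injective S.edge := fun x y h => S.inj x.1 x.2 y.1 y.2 h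

include S in
theorem finite_positions [Finite V] : Finite (Σ i, ZMod (2 * (S.C i).k + 1)) :=
  Finite.of_injective _ S.edge_injective

theorem ncard_segments₁ (hG : IsOddCactus G) :
    (segments₁ G).ncard = {x | S.Loner x}.ncard := by
  rw [← S.seg_injOn.ncard_image]
  congr 1
  ext z
  constructor
  · intro hz
    obtain ⟨x, hx, rfl⟩ := S.segments₁_subset hG hz
    exact ⟨x, hx, rfl⟩
  · rintro ⟨x, hx, rfl⟩
    exact S.seg_mem_segments₁ hG hx

theorem ncard_antEdges (hG : IsOddCactus G) :
    (antEdges G).ncard = {x | S.Marked x}.ncard := by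
  rw [← Set.ncard_image_of_injective _ S.edge_injective]
  congr 1
  ext e
  constructor
  · intro he
    obtain ⟨i, p, rfl⟩ := S.cover e he.1 (by
      obtain ⟨-, v, ⟨w, c, hc, -, -, hec, -⟩, -⟩ := he
      exact fun h => h.notMem_edges_of_isCycle hc hec)
    exact ⟨⟨i, p⟩, (S.mem_antEdges_iff hG i p).1 he, rfl⟩
  · rintro ⟨⟨i, p⟩, h, rfl⟩
    exact (S.mem_antEdges_iff hG i p).2 h

theorem ncard_edgeSet [Finite V] :
    G.edgeSet.ncard = (cutEdges G).ncard + Nat.card (Σ i, ZMod (2 * (S.C i).k + 1)) := by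
  rw [← Set.ncard_univ, ← Set.ncard_image_of_injective _ S.edge_injective,
    ← Set.ncard_union_eq (by
      rw [Set.disjoint_left]
      rintro e he ⟨⟨i, p⟩, -, rfl⟩
      exact (S.C i).not_isBridge p he.2)]
  congr 1
  ext e
  constructor
  · intro he
    by_cases hb : G.IsBridge e
    · exact .inl ⟨he, hb⟩
    · obtain ⟨i, p, rfl⟩ := S.cover e he hb
      exact .inr ⟨⟨i, p⟩, trivial, rfl⟩
  · rintro (he | ⟨⟨i, p⟩, -, rfl⟩)
    · exact he.1
    · exact (S.C i).E_mem p

theorem ncard_key [Finite V] :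
    S.key.ncard = (cutEdges G).ncard + {x | S.Opener x}.ncard := by
  rw [← Set.ncard_image_of_injective _ S.edge_injective,
    ← Set.ncard_union_eq (by
      rw [Set.disjoint_left]
      rintro e he ⟨⟨i, p⟩, -, rfl⟩
      exact (S.C i).not_isBridge p he.2)]
  congr 1
  ext e
  constructor
  · rintro (he | ⟨i, p, hp, rfl⟩)
    · exact .inl he
    · exact .inr ⟨⟨i, p⟩, hp, rfl⟩
  · rintro (he | ⟨⟨i, p⟩, hp, rfl⟩)
    · exact .inl he
    · exact .inr ⟨i, p, hp, rfl⟩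

theorem formula_count [Finite V] (hG : IsOddCactus G) :
    G.edgeSet.ncard + (cutEdges G).ncard + (segments₁ G).ncard =
      2 * S.key.ncard + (antEdges G).ncard := by
  have := S.finite_positions
  have h := ncard_opener_loner S.next S.Opener S.Marked fun x =>
    (S.C x.1).opener_add_one (S.cut_zero x.1) x.2
  have h1 := S.ncard_edgeSet
  have h2 := S.ncard_key
  have h3 := S.ncard_antEdges hG
  have h4 : (segments₁ G).ncard = {x | S.Opener x ∧ S.Marked (S.next x)}.ncard :=
    S.ncard_segments₁ hG
  omega

end CycleSystem

end Counting
end OddCactus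

namespace OddCactus

/-! ### Cycles seen from a root: horizontal edges -/

section Rooted

variable {V : Type*} {G : SimpleGraph V}

theorem exists_chart_of_eqd (hG : IsOddCactus G) {r a b : V} (hab : G.Adj a b)
    (h : G.dist r a = G.dist r b) :
    ∃ C : Chart G, C.π r = 0 ∧ C.v (-1) = a ∧ C.v 1 = b := by
  have hc := hG.1.1
  rcases isBridge_or_chart hG (show s(a, b) ∈ G.edgeSet from hab) with hb | ⟨C, p, hp⟩
  · exact absurd (eqd_mk.2 h) (not_eqd_of_isBridge hc hab hb r)
  · have hπ : C.π r = p := by rw [← C.eqd_iff hc, ← hp, eqd_mk, h]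
    rcases Sym2.eq_iff.1 hp with ⟨h1, h2⟩ | ⟨h1, h2⟩
    · refine ⟨C.shift p, ?_, ?_, ?_⟩
      · show C.π r - p = (0 : ZMod (2 * C.k + 1))
        rw [hπ, sub_self]
      · rw [h1]
        exact congrArg C.v (show (-1 + p : ZMod (2 * C.k + 1)) = p - 1 by ring)
      · rw [h2]
        exact congrArg C.v (show (1 + p : ZMod (2 * C.k + 1)) = p + 1 by ring)
    · refine ⟨(C.shift p).flip, ?_, ?_, ?_⟩
      · show -(C.π r - p) = (0 : ZMod (2 * C.k + 1))
        rw [hπ, sub_self, neg_zero]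
      · rw [h1]
        exact congrArg C.v (show (-(-1) + p : ZMod (2 * C.k + 1)) = p + 1 by ring)
      · rw [h2]
        exact congrArg C.v (show (-1 + p : ZMod (2 * C.k + 1)) = p - 1 by ring)

/-- A horizontal edge is opposite to the projection of `r` on its cycle, which determines it; a
neighbour in the fibre of `x` is farther from `r`. One memory cell per vertex therefore suffices for
horizontal edges. -/
theorem unique_mate (hG : IsOddCactus G) {r x y z : V} (hy : G.Adj x y) (hz : G.Adj x z)
    (h1 : G.dist r x = G.dist r y) (h2 : G.dist r x = G.dist r z) : y = z := by
  have hc := hG.1.1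
  obtain ⟨C, hr, hx, hy'⟩ := exists_chart_of_eqd hG hy h1
  have hπx : C.π x = -1 := by rw [← hx, C.π_v]
  have hne : C.π r ≠ C.π x := by
    rw [hr, hπx]
    intro h
    exact one_ne_zero_zmod C.hk (by linear_combination h)
  by_cases h : C.π x = C.π z
  · have := C.dist_ne hc (x := r) (y := z) (by rwa [← h])
    have h3 := C.dist_v hc r (C.π x)
    have h4 : C.v (C.π x) = x := by rw [hπx, hx]
    rw [← h, h4, SimpleGraph.dist_eq_one_iff_adj.2 hz] at this
    rw [h4] at h3
    omega
  · obtain ⟨q, hq⟩ := C.E_of_adj hz h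
    have e : s(x, z) = C.E 0 := by
      rw [hq, ← hr, (C.eqd_iff hc).1 (show Eqd G r (C.E q) by rw [← hq, eqd_mk, h2])]
    rw [CycleParam.E, zero_sub, zero_add, hx, hy'] at e
    rcases Sym2.eq_iff.1 e with ⟨-, h⟩ | ⟨h, h'⟩
    · exact h.symm
    · rw [h'] at hz; exact absurd hz (G.loopless.irrefl _)

/-- The edges whose ends are at the same distance from `r`, as increasing pairs. -/
def Hor [LinearOrder V] (G : SimpleGraph V) (r : V) : Type _ :=
  {h : V × V // G.Adj h.1 h.2 ∧ G.dist r h.1 = G.dist r h.2 ∧ h.1 < h.2}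

/-- The cycle opposite to the root `r` through an edge of `Hor G r`. -/
noncomputable def horChart [LinearOrder V] (hG : IsOddCactus G) {r : V} (h : Hor G r) : Chart G :=
  (exists_chart_of_eqd hG h.2.1 h.2.2.1).choose

section

variable [LinearOrder V] (hG : IsOddCactus G) {r : V} (h : Hor G r)

theorem horChart_π : (horChart hG h).π r = 0 :=
  (exists_chart_of_eqd hG h.2.1 h.2.2.1).choose_spec.1

theorem horChart_neg_one : (horChart hG h).v (-1) = h.1.1 :=
  (exists_chart_of_eqd hG h.2.1 h.2.2.1).choose_spec.2.1

theorem horChart_one : (horChart hG h).v 1 = h.1.2 :=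
  (exists_chart_of_eqd hG h.2.1 h.2.2.1).choose_spec.2.2

theorem horChart_E_zero : (horChart hG h).E 0 = s(h.1.1, h.1.2) := by
  rw [CycleParam.E, zero_sub, zero_add, horChart_neg_one, horChart_one]

end

/-- The base of a cycle is either `r`, of degree other than two, or has `r` behind it. Hence the
base can serve as the marked position `0`. -/
theorem isCutVertex_of_root [Finite V] (hG : G.Connected) {r : V}
    (hr : (G.neighborSet r).ncard ≠ 2) (C : Chart G) : IsCutVertex G (C.v (C.π r)) := by
  by_cases h : r = C.v (C.π r)
  · rw [C.isCutVertex_iff_ncard hG, ← h]; exact hr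
  · rw [C.isCutVertex_iff hG]; exact ⟨r, rfl, h⟩

theorem ncard_base {ι : Type*} (S : CycleSystem G ι) :
    {x : Σ i, ZMod (2 * (S.C i).k + 1) | x.2 = 0}.ncard = Nat.card ι := by
  have : {x : Σ i, ZMod (2 * (S.C i).k + 1) | x.2 = 0} =
      (fun i => (⟨i, 0⟩ : Σ i, ZMod (2 * (S.C i).k + 1))) '' Set.univ := by
    ext ⟨i, p⟩
    constructor
    · rintro (h : p = 0); subst h; exact ⟨i, trivial, rfl⟩
    · rintro ⟨j, -, h⟩; cases h; rfl
  rw [this, Set.ncard_image_of_injective _ (fun i j h => congrArg Sigma.fst h), Set.ncard_univ]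

variable [LinearOrder V]

/-- All cycles of an odd cactus, seen from a root that is not of degree two. -/
noncomputable def rootedSystem [Finite V] (hG : IsOddCactus G) (r : V)
    (hr : (G.neighborSet r).ncard ≠ 2) : CycleSystem G (Hor G r) where
  C := horChart hG
  cut_zero h := by
    have := isCutVertex_of_root hG.1.1 hr (horChart hG h)
    rwa [horChart_π] at this
  cover e he hb := by
    rcases isBridge_or_chart hG he with h | ⟨C, p, rfl⟩
    · exact absurd h hb
    -- The edge opposite to the projection of `r` is the horizontal edge of the cycle.
    have hE := C.E_mem (C.π r)
    have hd := (C.eqd_iff hG.1.1).2 (rfl : C.π r = _)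
    rw [CycleParam.E] at hE hd
    rw [eqd_mk] at hd
    have hadj : G.Adj (C.v (C.π r - 1)) (C.v (C.π r + 1)) := hE
    obtain ⟨h, hh⟩ : ∃ h : Hor G r, s(h.1.1, h.1.2) = C.E (C.π r) := by
      rcases lt_or_gt_of_ne hadj.ne with h | h
      · exact ⟨⟨(_, _), hadj, hd, h⟩, rfl⟩
      · exact ⟨⟨(_, _), hadj.symm, hd.symm, h⟩, Sym2.eq_swap⟩
    obtain ⟨q, hq⟩ := C.edges_subset hG.1 (horChart hG h).toCycleParam
      (p := C.π r) (p' := 0) (by rw [horChart_E_zero, hh]) p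
    exact ⟨h, q, hq⟩
  inj h p h' q he := by
    obtain ⟨q', hq'⟩ := CycleParam.edges_subset hG.1 _ _ he 0
    have hd : Eqd G r ((horChart hG h').E q') := by
      rw [← hq', (horChart hG h).eqd_iff hG.1.1, horChart_π]
    rw [(horChart hG h').eqd_iff hG.1.1, horChart_π] at hd
    rw [← hd, horChart_E_zero, horChart_E_zero] at hq'
    obtain rfl : h = h' := by
      obtain ⟨⟨a, b⟩, h1, h2, h3⟩ := h
      obtain ⟨⟨a', b'⟩, h1', h2', h3'⟩ := h'
      rcases Sym2.eq_iff.1 hq' with ⟨e1, e2⟩ | ⟨e1, e2⟩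
      · simp only at e1 e2; subst e1; subst e2; rfl
      · simp only at e1 e2 h3 h3'; subst e1; subst e2
        exact absurd h3 h3'.asymm
    rw [(horChart hG h).E_injective he]

instance [Finite V] (r : V) : Finite (Hor G r) := Subtype.finite

/-- Every edge joins a vertex other than `r` to its unique parent or is horizontal. -/
theorem ncard_edgeSet_rooted [Finite V] (hG : IsOddCactus G) (r : V) :
    G.edgeSet.ncard + 1 = Nat.card V + Nat.card (Hor G r) := by
  have hc := hG.1.1
  have hex : ∀ x : ({r}ᶜ : Set V), ∃ y, G.Adj x y ∧ G.dist r y + 1 = G.dist r x := fun x =>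
    exists_adj_closer hc x.2
  choose par hadj hpar using hex
  let f : ({r}ᶜ : Set V) → Sym2 V := fun x => s((x : V), par x)
  let g : Hor G r → Sym2 V := fun h => s(h.1.1, h.1.2)
  have hf : Function.Injective f := by
    intro x y h
    rcases Sym2.eq_iff.1 h with ⟨h, -⟩ | ⟨h1, h2⟩
    · exact Subtype.ext h
    · have h3 := hpar x
      have h4 := hpar y
      rw [h2] at h3; rw [← h1] at h4
      omega
  have hg : Function.Injective g := by
    rintro ⟨⟨a, b⟩, h1, h2, h3⟩ ⟨⟨a', b'⟩, h1', h2', h3'⟩ h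
    rcases Sym2.eq_iff.1 h with ⟨e1, e2⟩ | ⟨e1, e2⟩
    · simp only at e1 e2; subst e1; subst e2; rfl
    · simp only at e1 e2 h3 h3'; subst e1; subst e2
      exact absurd h3 h3'.asymm
  have hE : G.edgeSet = f '' Set.univ ∪ g '' Set.univ := by
    ext e
    constructor
    · induction e with | _ a b =>
      intro he
      have hab : G.Adj a b := he
      have key : ∀ a b, G.Adj a b → G.dist r a < G.dist r b → s(a, b) ∈ f '' Set.univ := by
        intro a b hab hlt
        have hbr : b ∈ ({r}ᶜ : Set V) := by
          rintro rfl; simp at hlt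
        refine ⟨⟨b, hbr⟩, trivial, ?_⟩
        have := dist_le_of_adj hc hab r
        have := unique_parent hG (r := r) (hadj ⟨b, hbr⟩) hab.symm (hpar ⟨b, hbr⟩)
          (show G.dist r a + 1 = G.dist r b by omega)
        simp only [f]
        rw [this, Sym2.eq_swap]
      rcases lt_trichotomy (G.dist r a) (G.dist r b) with h | h | h
      · exact .inl (key a b hab h)
      · right
        rcases lt_or_gt_of_ne hab.ne with h' | h'
        · exact ⟨⟨(a, b), hab, h, h'⟩, trivial, rfl⟩
        · exact ⟨⟨(b, a), hab.symm, h.symm, h'⟩, trivial, Sym2.eq_swap⟩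
      · left; rw [Sym2.eq_swap]; exact key b a hab.symm h
    · rintro (⟨x, -, rfl⟩ | ⟨h, -, rfl⟩)
      · exact hadj x
      · exact h.2.1
  have hdis : Disjoint (f '' Set.univ) (g '' Set.univ) := by
    rw [Set.disjoint_left]
    rintro _ ⟨x, -, rfl⟩ ⟨h, -, he⟩
    have hx := hpar x
    rcases Sym2.eq_iff.1 he with ⟨e1, e2⟩ | ⟨e1, e2⟩
    · have := h.2.2.1
      rw [e1, e2] at this; omega
    · have := h.2.2.1
      rw [e1, e2] at this; omega
  rw [hE, Set.ncard_union_eq hdis, Set.ncard_image_of_injective _ hf,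
    Set.ncard_image_of_injective _ hg, Set.ncard_univ, Set.ncard_univ, Nat.card_coe_set_eq]
  have := Set.ncard_add_ncard_compl ({r} : Set V)
  rw [Set.ncard_singleton] at this
  omega

section Counts

variable [Finite V] (hG : IsOddCactus G) (r : V)

/-- The number of positions other than the base that are not selected, over all cycles. -/
theorem ncard_key_add (hr : (G.neighborSet r).ncard ≠ 2) :
    (rootedSystem hG r hr).key.ncard + {x | x.2 ≠ 0 ∧ ¬ (rootedSystem hG r hr).Opener x}.ncard + 1
      = Nat.card V := by
  set S := rootedSystem hG r hr
  have := S.finite_positions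
  have h1 := S.ncard_edgeSet
  have h2 := S.ncard_key
  have h3 := ncard_edgeSet_rooted hG r
  have h4 := ncard_base S
  have h5 : Nat.card (Σ i, ZMod (2 * (S.C i).k + 1)) = {x | S.Opener x}.ncard +
      {x : Σ i, ZMod (2 * (S.C i).k + 1) | x.2 = 0}.ncard +
      {x | x.2 ≠ 0 ∧ ¬ S.Opener x}.ncard := by
    rw [← Set.ncard_univ, ← Set.ncard_union_eq (by
      rw [Set.disjoint_left]
      rintro ⟨i, p⟩ hx (rfl : p = 0)
      exact S.opener_not_cut i hx (S.cut_zero i)), ← Set.ncard_union_eq (by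
      rw [Set.disjoint_left]
      rintro x (hx | hx) hx'
      · exact hx'.2 hx
      · exact hx'.1 hx)]
    congr 1; ext x
    simp only [Set.mem_union, Set.mem_ofPred_eq, Set.mem_univ, true_iff]
    tauto
  -- Combine `m = |E_cut| + #positions` with `m + 1 = n + #cycles`; each cycle has one base.
  omega

/-- These bounds make the running time linear: the first for walking around all cycles, the second
for scanning all adjacency lists. -/
theorem ncard_not_base (hr : (G.neighborSet r).ncard ≠ 2) :
    {x : Σ h : Hor G r, ZMod (2 * (horChart hG h).k + 1) | x.2 ≠ 0}.ncard + 1 ≤ Nat.card V ∧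
      G.edgeSet.ncard ≤ 2 * Nat.card V := by
  have hfin : ∃ S : CycleSystem G (Hor G r), S.C = horChart hG :=
    ⟨rootedSystem hG r hr, rfl⟩
  obtain ⟨S, hS⟩ := hfin
  have := S.finite_positions
  have h1 := S.ncard_edgeSet
  have h3 := ncard_edgeSet_rooted hG r
  have h4 := ncard_base S
  have h5 := Set.ncard_add_ncard_compl {x : Σ i, ZMod (2 * (S.C i).k + 1) | x.2 = 0}
  have h6 : {x : Σ i, ZMod (2 * (S.C i).k + 1) | x.2 = 0}ᶜ = {x | x.2 ≠ 0} := rfl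
  have h7 : {x : Σ i, ZMod (2 * (S.C i).k + 1) | x.2 ≠ 0}.ncard =
    {x : Σ h : Hor G r, ZMod (2 * (horChart hG h).k + 1) | x.2 ≠ 0}.ncard := by rw [hS]
  have h8 : Nat.card (Hor G r) ≤ {x : Σ i, ZMod (2 * (S.C i).k + 1) | x.2 ≠ 0}.ncard := by
    rw [← Set.ncard_univ]
    refine Set.ncard_le_ncard_of_injOn (fun i => ⟨i, 1⟩) (fun i _ => ?_) ?_
    · exact one_ne_zero_zmod (S.C i).hk
    · intro i _ j _ h; exact congrArg Sigma.fst h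
  rw [h6] at h5
  omega

end Counts

end Rooted

/-! ### Graphs that are odd cycles -/

section Cycles

variable {V : Type*} {G : SimpleGraph V}

/-- A vertex farthest from `r` has a second neighbour besides its parent, necessarily on the same
level, so there is a cycle. As no vertex on it is a cut vertex, all its fibres are trivial. -/
theorem exists_surjective_chart [Finite V] (hG : IsOddCactus G)
    (h2 : ∀ v, (G.neighborSet v).ncard = 2) : ∃ C : Chart G, Function.Surjective C.v := by
  have hc := hG.1.1
  obtain ⟨r⟩ := hc.nonempty
  obtain ⟨w, hw⟩ := @Finite.exists_max V _ _ ⟨r⟩ _ (G.dist r)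
  have hwr : w ≠ r := by
    rintro rfl
    obtain ⟨a, b, -, hab⟩ := Set.ncard_eq_two.1 (h2 w)
    have ha : G.Adj w a := by
      rw [← SimpleGraph.mem_neighborSet, hab]; simp
    have := hw a
    rw [SimpleGraph.dist_eq_one_iff_adj.2 ha, SimpleGraph.dist_self] at this
    omega
  obtain ⟨y, hwy, hy⟩ := exists_adj_closer hc hwr
  obtain ⟨z, hwz, hz⟩ : ∃ z ∈ G.neighborSet w, z ≠ y :=
    Set.exists_ne_of_one_lt_ncard (by rw [h2]; omega) y
  have hwz : G.Adj w z := hwz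
  have hlev : G.dist r w = G.dist r z := by
    have h3 := hw z
    have h4 := dist_le_of_adj hc hwz.symm r
    by_contra hne
    exact hz (unique_parent hG (r := r) hwz hwy (by omega) hy)
  obtain ⟨C, -⟩ := exists_chart_of_eqd hG hwz hlev
  refine ⟨C, fun x => ⟨C.π x, ?_⟩⟩
  by_contra hx
  exact (C.isCutVertex_iff_ncard hc).1 ((C.isCutVertex_iff hc).2 ⟨x, rfl, fun h => hx h.symm⟩) (h2 _)

theorem Chart.card_eq (C : Chart G) (hC : Function.Surjective C.v) :
    Nat.card V = 2 * C.k + 1 := by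
  rw [← Nat.card_congr (Equiv.ofBijective C.v ⟨C.inj, hC⟩), Nat.card_zmod]

theorem Chart.isCycleOfLength (C : Chart G) (hC : Function.Surjective C.v) :
    IsCycleOfLength G (2 * C.k + 1) := by
  refine ⟨by have := C.hk; omega, ⟨RelIso.symm ⟨(Equiv.ofBijective (fun i : Fin (2 * C.k + 1) =>
    C.v (2 * ZMod.finEquiv _ i)) ⟨?_, ?_⟩), ?_⟩⟩⟩
  · intro i j h
    exact (ZMod.finEquiv _).injective (two_mul_cancel (C.inj h))
  · intro x
    obtain ⟨p, rfl⟩ := hC x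
    obtain ⟨j, -, rfl⟩ := exists_eq_two_mul p
    exact ⟨(ZMod.finEquiv _).symm j, by simp⟩
  · intro i j
    have hval : ∀ x : Fin (2 * C.k + 1), x.val = 1 ↔ ZMod.finEquiv _ x = 1 := by
      intro x
      rw [← map_one (ZMod.finEquiv (2 * C.k + 1)), (ZMod.finEquiv _).injective.eq_iff, Fin.ext_iff,
        Fin.val_one', Nat.mod_eq_of_lt (by have := C.hk; omega)]
    rw [SimpleGraph.cycleGraph_adj', hval, hval, map_sub, map_sub]
    show G.Adj (C.v (2 * ZMod.finEquiv _ i)) (C.v (2 * ZMod.finEquiv _ j)) ↔ _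
    generalize ZMod.finEquiv _ i = a
    generalize ZMod.finEquiv _ j = b
    constructor
    · intro h
      rcases C.adj h with h' | ⟨-, -, h' | h'⟩
      · rw [C.π_v, C.π_v] at h'
        rw [h'] at h
        exact absurd h (G.loopless.irrefl _)
      · rw [C.π_v, C.π_v] at h'
        right
        exact two_mul_cancel (by linear_combination h')
      · rw [C.π_v, C.π_v] at h'
        left
        exact two_mul_cancel (by linear_combination h')
    · rintro (h | h)
      · have := (C.step (2 * b)).symm
        rwa [show 2 * b + 2 = 2 * a by linear_combination -2 * h] at this
      · have := C.step (2 * a)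
        rwa [show 2 * a + 2 = 2 * b by linear_combination -2 * h] at this

theorem ncard_of_isCycleOfLength {n : ℕ} (h : IsCycleOfLength G n) (v : V) :
    (G.neighborSet v).ncard = 2 := by
  obtain ⟨h3, ⟨φ⟩⟩ := h
  obtain ⟨m, rfl⟩ := Nat.exists_eq_add_of_le' h3
  rw [← Nat.card_coe_set_eq, Nat.card_congr (φ.mapNeighborSet v), Nat.card_eq_fintype_card,
    SimpleGraph.card_neighborSet_eq_degree, SimpleGraph.cycleGraph_degree_three_le]

theorem formula_of_forall [Finite V] (hG : IsOddCactus G)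
    (h2 : ∀ v, (G.neighborSet v).ncard = 2) : Odd (Nat.card V) ∧ 3 ≤ Nat.card V ∧
      formula G = if Nat.card V = 3 then 1 else ((Nat.card V : ℚ) + 1) / 2 := by
  obtain ⟨C, hC⟩ := exists_surjective_chart hG h2
  have hcard := C.card_eq hC
  have ho : Odd (Nat.card V) := ⟨_, hcard⟩
  have := C.hk
  refine ⟨ho, by omega, ?_⟩
  rw [formula, if_pos ⟨ho, by rw [hcard]; exact C.isCycleOfLength hC⟩]

theorem formula_of_exists [Finite V] (hG : IsOddCactus G) {ι : Type*} (S : CycleSystem G ι)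
    {r : V} (hr : (G.neighborSet r).ncard ≠ 2) : formula G = S.key.ncard := by
  rw [formula, if_neg (fun h => hr (ncard_of_isCycleOfLength h.2 r))]
  have := S.formula_count hG
  have : (G.edgeSet.ncard : ℚ) + (cutEdges G).ncard + (segments₁ G).ncard =
      2 * S.key.ncard + (antEdges G).ncard := by exact_mod_cast this
  linarith

namespace Chart

variable (C : Chart G)

theorem exists_eq_E (hC : Function.Surjective C.v) (e : G.edgeSet) : ∃ p, (e : Sym2 V) = C.E p := by
  obtain ⟨e, he⟩ := e
  induction e with | _ a b =>
  obtain ⟨p, rfl⟩ := hC a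
  obtain ⟨q, rfl⟩ := hC b
  refine C.E_of_adj he fun h => ?_
  rw [C.π_v, C.π_v] at h
  rw [h] at he
  exact G.loopless.irrefl _ he

theorem eqd_of_adjacent (hG : G.Connected) {p q} (h : q = p + 1 ∨ p = q + 1) :
    ∃ w ∈ C.E p, Eqd G w (C.E q) := by
  refine ⟨C.v q, ?_, (C.eqd_iff hG).2 (C.π_v q)⟩
  rcases h with rfl | rfl <;> simp [CycleParam.E]

/-- The ends of `E q` project to `q - 1` and `q + 1`. For non-consecutive `p`, `q` neither edge has
an end equidistant from the other, so some pair of vertices forces both onto every geodesic. -/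
theorem adjacent_of_color_eq (hG : IsOddCactus G) {k : ℕ} {c : G.edgeSet → Fin k}
    (hc : IsStrongRainbow G c) {p q} (hpq : p ≠ q)
    (h : c ⟨C.E p, C.E_mem p⟩ = c ⟨C.E q, C.E_mem q⟩) : q = p + 1 ∨ p = q + 1 := by
  by_contra! hne
  have key : ∀ p q, p ≠ q + 1 → q ≠ p + 1 → ∀ w ∈ C.E q, ¬ Eqd G w (C.E p) := by
    intro p q h1 h2 w hw
    rw [C.eqd_iff hG.1.1]
    rintro rfl
    rcases Sym2.mem_iff.1 hw with rfl | rfl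
    · rw [C.π_v] at h2; exact h2 (by ring)
    · rw [C.π_v] at h1; exact h1 rfl
  obtain ⟨u, v, huv⟩ := exists_forall_geodesic_mem hG (C.E_mem p) (C.E_mem q)
    (fun h => hpq (C.E_injective h)) (key p q hne.2 hne.1) (key q p hne.1 hne.2)
  obtain ⟨W, -, hW, hW'⟩ := hc u v
  obtain ⟨h1, h2⟩ := huv W hW
  exact hpq (C.E_injective (congrArg Subtype.val (hW' _ _ h1 h2 h)))

theorem src_triangle (hG : IsOddCactus G) (hC : Function.Surjective C.v) (hk : C.k = 1) :
    src G = 1 := by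
  have hmem : 1 ∈ {k : ℕ | ∃ c : G.edgeSet → Fin k, IsStrongRainbow G c} := by
    refine ⟨fun _ => 0, CycleSystem.isStrongRainbow_of_eqd hG.1.1 _ fun e f _ hne => .inl ?_⟩
    obtain ⟨p, hp⟩ := C.exists_eq_E hC e
    obtain ⟨q, hq⟩ := C.exists_eq_E hC f
    rw [hp, hq]
    apply C.eqd_of_adjacent hG.1.1
    have hpq : p ≠ q := fun h => hne (Subtype.ext (by rw [hp, hq, h]))
    clear hp hq
    obtain ⟨j, hj, hj'⟩ := exists_eq_two_mul (q - p)
    have hk' : (C.k : ZMod (2 * C.k + 1)) = 1 := by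
      rw [show (C.k : ZMod (2 * C.k + 1)) = ((1 : ℕ) : ZMod (2 * C.k + 1)) from congrArg _ hk,
        Nat.cast_one]
    have h3 : (3 : ZMod (2 * C.k + 1)) = 0 := by
      have := ZMod.natCast_self (2 * C.k + 1)
      push_cast at this
      linear_combination this - 2 * hk'
    have : j = 0 ∨ j = 1 ∨ j = 2 := by omega
    rcases this with rfl | rfl | rfl
    · exact absurd (by push_cast at hj'; linear_combination -hj') hpq
    · right; push_cast at hj'; linear_combination -hj' - h3
    · left; push_cast at hj'; linear_combination hj' + h3
  apply le_antisymm (Nat.sInf_le hmem)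
  obtain ⟨c, -⟩ := Nat.sInf_mem ⟨_, hmem⟩
  exact (Nat.zero_le _).trans_lt (c ⟨C.E 0, C.E_mem 0⟩).2

/-- Pairing consecutive positions uses `k + 1` colours. Three pairwise consecutive residues would
give `1 = 0` or `3 = 0`, so for `k ≥ 2` a colour occurs at most twice among the `2k + 1` edges. -/
theorem src_cycle (hG : IsOddCactus G) (hC : Function.Surjective C.v) (hk : 2 ≤ C.k) :
    src G = C.k + 1 := by
  have hc := hG.1.1
  have hmem : C.k + 1 ∈ {k : ℕ | ∃ c : G.edgeSet → Fin k, IsStrongRainbow G c} := by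
    choose φ hφ using C.exists_eq_E hC
    refine ⟨fun e => ⟨(φ e).val / 2, by have := ZMod.val_lt (φ e); omega⟩,
      CycleSystem.isStrongRainbow_of_eqd hc _ fun e f h hne => .inl ?_⟩
    rw [hφ e, hφ f]
    apply C.eqd_of_adjacent hc
    have hpq : φ e ≠ φ f := fun h => hne (Subtype.ext (by rw [hφ e, hφ f, h]))
    have hv : (φ e).val ≠ (φ f).val := fun h => hpq (ZMod.val_injective _ h)
    have h : (φ e).val / 2 = (φ f).val / 2 := congrArg Fin.val h
    have : (φ f).val = (φ e).val + 1 ∨ (φ e).val = (φ f).val + 1 := by omega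
    rw [← ZMod.natCast_zmod_val (φ e), ← ZMod.natCast_zmod_val (φ f)]
    rcases this with h | h
    · left; rw [h]; push_cast; rfl
    · right; rw [h]; push_cast; rfl
  apply le_antisymm (Nat.sInf_le hmem)
  obtain ⟨c, hcol⟩ := Nat.sInf_mem ⟨_, hmem⟩
  change G.edgeSet → Fin (src G) at c
  change IsStrongRainbow G c at hcol
  classical
  have hle := Finset.card_le_mul_card_image (f := fun p => c ⟨C.E p, C.E_mem p⟩) Finset.univ 2 (by
    intro b _
    by_contra hlt
    obtain ⟨x, hx, y, hy, z, hz, hxy, hxz, hyz⟩ := Finset.two_lt_card.1 (not_le.1 hlt)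
    simp only [Finset.mem_filter, Finset.mem_univ, true_and] at hx hy hz
    have h1 : (1 : ZMod (2 * C.k + 1)) ≠ 0 := one_ne_zero_zmod C.hk
    have h3 : (3 : ZMod (2 * C.k + 1)) ≠ 0 := fun h => by
      have := cast_inj_of_lt (k := C.k) (i := 3) (j := 0) (by omega) (by omega) (by simpa using h)
      omega
    rcases C.adjacent_of_color_eq hG hcol hxy (hx.trans hy.symm) with e1 | e1 <;>
    rcases C.adjacent_of_color_eq hG hcol hxz (hx.trans hz.symm) with e2 | e2 <;>
    rcases C.adjacent_of_color_eq hG hcol hyz (hy.trans hz.symm) with e3 | e3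
    · exact h1 (by linear_combination e2 - e1 - e3)
    · exact h1 (by linear_combination e1 - e2 - e3)
    · exact h3 (by linear_combination -e2 - e1 - e3)
    · exact h1 (by linear_combination -e2 - e1 + e3)
    · exact h1 (by linear_combination -e2 - e1 + e3)
    · exact h3 (by linear_combination -e2 - e1 - e3)
    · exact h1 (by linear_combination e1 - e2 - e3)
    · exact h1 (by linear_combination e2 - e1 - e3))
  have h2 := Finset.card_le_univ (Finset.univ.image fun p => c ⟨C.E p, C.E_mem p⟩)
  rw [Fintype.card_fin] at h2
  rw [Finset.card_univ, ZMod.card] at hle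
  show C.k + 1 ≤ src G
  omega

end Chart

theorem src_eq_formula [Finite V] (hG : IsOddCactus G) : (src G : ℚ) = formula G := by
  by_cases h2 : ∀ v, (G.neighborSet v).ncard = 2
  · obtain ⟨-, -, hf⟩ := formula_of_forall hG h2
    obtain ⟨C, hC⟩ := exists_surjective_chart hG h2
    rw [hf, C.card_eq hC]
    have := C.hk
    by_cases hk : C.k = 1
    · rw [C.src_triangle hG hC hk, if_pos (by omega)]; simp
    · rw [C.src_cycle hG hC (by omega), if_neg (by omega)]
      push_cast; ring
  · push Not at h2
    obtain ⟨r, hr⟩ := h2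
    obtain ⟨m, ⟨eq⟩⟩ := Finite.exists_equiv_fin V
    let _ : LinearOrder V := LinearOrder.lift' eq eq.injective
    rw [formula_of_exists hG (rootedSystem hG r hr) hr, (rootedSystem hG r hr).src_eq hG]

end Cycles
end OddCactus

namespace OddCactus

/-! ### Reasoning about bounded runs of programs -/

section Machine

/-- Started in `σ`, the program `P` halts after at most `T` steps in a state satisfying `Q`. -/
def Run (P : Prog) (σ : State) (T : ℕ) (Q : State → Prop) : Prop :=
  ∃ t τ, Exec P σ t τ ∧ t ≤ T ∧ Q τ

namespace Run

variable {P P' : Prog} {σ : State} {S T : ℕ} {Q R : State → Prop}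

theorem mono (h : Run P σ S Q) (hST : S ≤ T) (hQ : ∀ τ, Q τ → R τ) : Run P σ T R := by
  obtain ⟨t, τ, h1, h2, h3⟩ := h
  exact ⟨t, τ, h1, h2.trans hST, hQ τ h3⟩

theorem instr {i : Instr} (h : Q (i.run σ)) : Run (.instr i) σ 1 Q :=
  ⟨1, _, .instr i σ, le_rfl, h⟩

theorem seq (h : Run P σ S R) (h' : ∀ τ, R τ → Run P' τ T Q) : Run (.seq P P') σ (S + T) Q := by
  obtain ⟨s, τ, h1, h2, h3⟩ := h
  obtain ⟨t, ρ, h4, h5, h6⟩ := h' τ h3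
  exact ⟨s + t, ρ, .seq h1 h4, by omega, h6⟩

theorem step {i : Instr} (h : Run P (i.run σ) T Q) : Run (.seq (.instr i) P) σ (1 + T) Q :=
  seq (R := fun τ => τ = i.run σ) (instr rfl) (by rintro _ rfl; exact h)

theorem ite {b : Test} (h : b.holds σ → Run P σ T Q) (h' : ¬ b.holds σ → Run P' σ T Q) :
    Run (.ite b P P') σ (T + 1) Q := by
  by_cases hb : b.holds σ
  · obtain ⟨t, τ, h1, h2, h3⟩ := h hb
    exact ⟨t + 1, τ, .iteTrue hb h1, by omega, h3⟩
  · obtain ⟨t, τ, h1, h2, h3⟩ := h' hb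
    exact ⟨t + 1, τ, .iteFalse hb h1, by omega, h3⟩

/-- Loops: the invariant carries a bound for the number of remaining steps. -/
theorem loop {b : Test} {I : ℕ → State → Prop}
    (h : ∀ N σ, I N σ → b.holds σ → ∃ t N', t + 1 + N' ≤ N ∧ Run P σ t (I N')) :
    ∀ N σ, I N σ → Run (.loop b P) σ (N + 1) fun τ => ¬ b.holds τ ∧ ∃ N', I N' τ := by
  intro N
  induction N using Nat.strong_induction_on with | _ N ih =>
  intro σ hσ
  by_cases hb : b.holds σ
  · obtain ⟨t, N', hN, s, τ, h1, h2, h3⟩ := h N σ hσ hb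
    obtain ⟨s', ρ, h4, h5, h6⟩ := ih N' (by omega) τ h3
    exact ⟨s + s' + 1, ρ, .loopStep hb h1 h4, by omega, h6⟩
  · exact ⟨1, σ, .loopStop hb, by omega, hb, N, hσ⟩

end Run

namespace State

variable (σ : State)

@[simp] theorem reg_setReg (r x s : ℕ) :
    (σ.setReg r x).reg s = if s = r then x else σ.reg s := Function.update_apply ..

@[simp] theorem arr_setReg (r x : ℕ) : (σ.setReg r x).arr = σ.arr := rfl

@[simp] theorem reg_setCell (a i x : ℕ) : (σ.setCell a i x).reg = σ.reg := rfl

@[simp] theorem arr_setCell_self (a i x : ℕ) :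
    (σ.setCell a i x).arr a = Function.update (σ.arr a) i x := Function.update_self ..

@[simp] theorem arr_setCell_of_ne {a b : ℕ} (h : b ≠ a) (i x : ℕ) :
    (σ.setCell a i x).arr b = σ.arr b := Function.update_of_ne h ..

end State

/-- The concatenation of instructions. -/
def Prog.block : Instr → List Instr → Prog
  | i, [] => .instr i
  | i, j :: l => .seq (.instr i) (block j l)

theorem Run.block {Q : State → Prop} {l : List Instr} {i : Instr} {σ : State} {T : ℕ}
    (hT : l.length + 1 ≤ T) (h : Q (l.foldl Instr.run (i.run σ))) : Run (.block i l) σ T Q := by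
  induction l generalizing i σ T with
  | nil => exact (Run.instr h).mono hT fun _ => id
  | cons j l ih => exact (Run.step (ih le_rfl h)).mono (by simp at hT ⊢; omega) fun _ => id

end Machine

/-! ### Reading the adjacency lists -/

section Input

variable {n : ℕ} {G : SimpleGraph (Fin n)} {adj : Fin n → List (Fin n)}

theorem inputState_offset_succ (u : Fin n) :
    (inputState adj).arr 0 (u + 1) = (inputState adj).arr 0 u + (adj u).length := by
  have h1 : (u : ℕ) + 1 ≤ n := u.2
  have h2 : (u : ℕ) ≤ n := u.2.le
  simp only [inputState, if_true, if_pos h1, if_pos h2]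
  rw [List.take_succ_eq_append_getElem (by simp)]
  simp

theorem inputState_getElem (u : Fin n) (t : ℕ) (ht : t < (adj u).length) :
    (inputState adj).arr 1 ((inputState adj).arr 0 u + t) = ((adj u)[t] : Fin n) := by
  have h2 : (u : ℕ) ≤ n := u.2.le
  simp only [inputState, if_true, if_pos h2, one_ne_zero, if_false]
  have h : List.ofFn adj = (List.ofFn adj).take u ++ adj u :: (List.ofFn adj).drop (u + 1) := by
    conv_lhs => rw [← List.take_append_drop u (List.ofFn adj)]
    congr 1
    rw [List.drop_eq_getElem_cons (by simp)]
    simp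
  have h' : (List.ofFn adj).flatten = ((List.ofFn adj).take u).flatten ++
      (adj u ++ ((List.ofFn adj).drop (u + 1)).flatten) := by
    conv_lhs => rw [h]
    rw [List.flatten_append, List.flatten_cons]
  rw [h', List.map_append, List.map_append, List.getElem?_append_right (by rw [List.length_map]; exact Nat.le_add_right ..),
    List.length_map, Nat.add_sub_cancel_left, List.getElem?_append_left (by simpa),
    List.getElem?_map, List.getElem?_eq_getElem ht]
  rfl

theorem IsAdjList.length (h : IsAdjList G adj) (u : Fin n) :
    (adj u).length = (G.neighborSet u).ncard := by
  rw [← List.toFinset_card_of_nodup (h u).1, ← Set.ncard_coe_finset]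
  congr 1; ext w
  simp [(h u).2 w]

theorem IsAdjList.sum_length (h : IsAdjList G adj) :
    ∑ u, (adj u).length = 2 * G.edgeSet.ncard := by
  classical
  rw [← SimpleGraph.coe_edgeFinset, Set.ncard_coe_finset, ← G.sum_degrees_eq_twice_card_edges]
  refine Finset.sum_congr rfl fun u _ => ?_
  rw [h.length, ← SimpleGraph.card_neighborSet_eq_degree, ← Nat.card_eq_fintype_card,
    Nat.card_coe_set_eq]

end Input
end OddCactus

namespace OddCactus

/-! ### Finding a root, and the value for cycles -/

section Scan

variable {n : ℕ} {G : SimpleGraph (Fin n)} {adj : Fin n → List (Fin n)}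

/-- Puts `v + 1` into register `4`, where `v` is the last vertex whose degree is not two. -/
def findRoot : Prog :=
  -- Degree two is tested by adding two to the start of a list and comparing with the start of the
  -- next. Register `1` is already incremented when it is copied, so `0` in register `4` means that
  -- there is no root.
  .loop (.lt 1 0) (.seq (.block (.load 2 0 1) [.inc 2, .inc 2, .inc 1, .load 3 0 1])
    (.ite (.eq 2 3) (.instr (.move 4 4)) (.instr (.move 4 1))))

theorem run_findRoot (hadj : IsAdjList G adj) :
    Run findRoot (inputState adj) (8 * n + 1) fun τ =>
      τ.arr = (inputState adj).arr ∧ τ.reg 0 = n ∧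
        (τ.reg 4 = 0 ∧ (∀ v, (G.neighborSet v).ncard = 2) ∨
          ∃ v : Fin n, τ.reg 4 = v + 1 ∧ (G.neighborSet v).ncard ≠ 2) := by
  refine (Run.loop (I := fun N τ => τ.arr = (inputState adj).arr ∧ τ.reg 0 = n ∧
      τ.reg 1 ≤ n ∧ N = 8 * (n - τ.reg 1) ∧
        (τ.reg 4 = 0 ∧ (∀ v : Fin n, v < τ.reg 1 → (G.neighborSet v).ncard = 2) ∨
          ∃ v : Fin n, τ.reg 4 = v + 1 ∧ (G.neighborSet v).ncard ≠ 2))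
      ?_ (8 * n) _ ⟨rfl, rfl, Nat.zero_le _, rfl, .inl ⟨rfl, fun v hv => by simp [inputState] at hv⟩⟩).mono
      le_rfl ?_
  · rintro N σ ⟨h1, h2, h3, rfl, h5⟩ hb
    have hlt : σ.reg 1 < n := by rw [← h2]; exact hb
    refine ⟨7, 8 * (n - (σ.reg 1 + 1)), by omega, ?_⟩
    obtain ⟨v, hv⟩ : ∃ v : Fin n, (v : ℕ) = σ.reg 1 := ⟨⟨_, hlt⟩, rfl⟩
    have hoff := inputState_offset_succ (adj := adj) v
    rw [hadj.length, hv] at hoff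
    refine Run.seq (S := 5) (T := 2) (R := fun τ => τ.arr = (inputState adj).arr ∧ τ.reg 0 = n ∧
      τ.reg 1 = v + 1 ∧ τ.reg 4 = σ.reg 4 ∧ (τ.reg 2 = τ.reg 3 ↔ (G.neighborSet v).ncard = 2))
      (Run.block (by simp) ?_) ?_
    · simp only [Instr.run, List.foldl_cons, List.foldl_nil, State.reg_setReg, State.arr_setReg, h1]
      refine ⟨trivial, by simp [h2], by simp [hv], by simp, ?_⟩
      simp only [OfNat.ofNat_ne_one, Nat.reduceEqDiff, if_true, if_false, OfNat.one_ne_ofNat, hoff]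
      omega
    · rintro τ ⟨g1, g2, g3, g4, g5⟩
      refine Run.ite (T := 1) (fun h => Run.instr ?_) (fun h => Run.instr ?_)
      · have hd := g5.1 h
        refine ⟨g1, by simpa [Instr.run], by simp [Instr.run, g3], by simp [Instr.run, g3, hv], ?_⟩
        simp only [Instr.run, State.reg_setReg, if_true, g3, g4]
        refine h5.imp (fun ⟨h, h'⟩ => ⟨h, fun w hw => ?_⟩) id
        simp only [OfNat.one_ne_ofNat, if_false] at hw
        rcases Nat.lt_succ_iff_lt_or_eq.1 hw with hw | hw
        · exact h' w (hv ▸ hw)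
        · rw [Fin.ext hw]; exact hd
      · have hd := fun e => h (g5.2 e)
        exact ⟨g1, by simpa [Instr.run], by simp [Instr.run, g3], by simp [Instr.run, g3, hv],
          .inr ⟨v, by simp [Instr.run, g3], hd⟩⟩
  · rintro τ ⟨hb, N, h1, h2, h3, -, h5⟩
    refine ⟨h1, h2, h5.imp (fun ⟨h, h'⟩ => ⟨h, fun v => h' v ?_⟩) id⟩
    have : ¬ τ.reg 1 < τ.reg 0 := hb
    have := v.2
    omega

/-- The value of the formula for an odd cycle. -/
def cycleValue : Prog :=
  .seq (.instr (.const 6 3)) (.ite (.eq 0 6) (.instr (.const 0 1))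
    (.seq (.block (.const 1 0) [.move 2 0])
      -- Counting up from `0` and down from `2k + 1` until the registers cross leaves `k + 1` in
      -- register `1`.
      (.seq (.loop (.lt 1 2) (.block (.inc 1) [.dec 2])) (.instr (.move 0 1)))))

theorem run_cycleValue {σ : State} (hn : Odd (σ.reg 0)) :
    Run cycleValue σ (3 * σ.reg 0 + 6) fun τ =>
      τ.reg 0 = if σ.reg 0 = 3 then 1 else (σ.reg 0 + 1) / 2 := by
  obtain ⟨k, hk⟩ := hn
  refine (Run.step (Run.ite (T := 2 + (3 * σ.reg 0 + 1 + 1)) (fun h => ?_) fun h => ?_)).mono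
    (by omega) fun _ => id
  · have h : σ.reg 0 = 3 := by simpa [Test.holds, Instr.run] using h
    exact (Run.instr (by simp [Instr.run, h])).mono (by omega) fun _ => id
  · have h : σ.reg 0 ≠ 3 := by simpa [Test.holds, Instr.run] using h
    refine Run.seq (S := 2) (R := fun τ => τ.reg 1 = 0 ∧ τ.reg 2 = 2 * k + 1)
      (Run.block (by simp) (by simp [Instr.run, hk])) fun τ hτ => ?_
    refine Run.seq (Run.loop (I := fun N τ => τ.reg 1 + τ.reg 2 = 2 * k + 1 ∧
      τ.reg 1 ≤ τ.reg 2 + 1 ∧ N = 3 * τ.reg 2) ?_ (3 * σ.reg 0) τ (by omega)) ?_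
    · rintro N ρ ⟨h1, h2, rfl⟩ hb
      have hb : ρ.reg 1 < ρ.reg 2 := hb
      refine ⟨2, 3 * (ρ.reg 2 - 1), by omega, Run.block (by simp) ?_⟩
      simp [Instr.run]
      omega
    · rintro ρ ⟨hb, N, h1, h2, -⟩
      have hb : ¬ ρ.reg 1 < ρ.reg 2 := hb
      refine Run.instr ?_
      simp [Instr.run, h]
      omega

end Scan
end OddCactus

namespace OddCactus

section Parent

variable {V : Type*} {G : SimpleGraph V}

open Classical in
/-- A neighbour of `x` that is closer to `r`, for `x ≠ r`. -/
noncomputable def parent (hG : G.Connected) (r x : V) : V :=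
  if h : x ≠ r then (exists_adj_closer hG h).choose else r

theorem parent_spec (hG : G.Connected) {r x : V} (h : x ≠ r) :
    G.Adj x (parent hG r x) ∧ G.dist r (parent hG r x) + 1 = G.dist r x := by
  rw [parent, dif_pos h]
  exact (exists_adj_closer hG h).choose_spec

theorem parent_self (hG : G.Connected) (r : V) : parent hG r r = r := by
  rw [parent, dif_neg (by simp)]

theorem eq_parent (hG : IsOddCactus G) {r x y : V} (h : G.Adj x y)
    (hd : G.dist r y + 1 = G.dist r x) : y = parent hG.1.1 r x := by
  have hx : x ≠ r := by rintro rfl; simp at hd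
  exact unique_parent hG h (parent_spec hG.1.1 hx).1 hd (parent_spec hG.1.1 hx).2

end Parent

/-! ### Breadth-first search -/

section Search

variable {n : ℕ} {G : SimpleGraph (Fin n)} {adj : Fin n → List (Fin n)}

/-- The state of a breadth-first search from `r`: the vertices found so far form the list `Q`, the
scanned arcs are those of `A`, and `M` is the memory. -/
structure Bfs (hG : G.Connected) (r : Fin n) (Q : List (Fin n)) (A : Fin n → Fin n → Prop)
    (M : ℕ → ℕ → ℕ) : Prop where
  root : r ∈ Q
  nodup : Q.Nodup
  queue : ∀ i (h : i < Q.length), M 4 i = Q[i]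
  seen : ∀ x : Fin n, M 2 x = if x ∈ Q then 1 else 0
  par : ∀ x ∈ Q, M 3 x = parent hG r x
  sorted : Q.Pairwise fun x y => G.dist r x ≤ G.dist r y
  closed : ∀ y ∈ Q, ∀ x, G.dist r x < G.dist r y → x ∈ Q
  scanned : ∀ x y, A x y → G.Adj x y ∧ y ∈ Q ∧ (G.dist r x = G.dist r y → M 5 y = x)
  origin : ∀ x ∈ Q, x ≠ r → A (parent hG r x) x
  -- The value `0` may mean mate `0` or no mate. Only mates larger than `x` are used later, so the
  -- ambiguity is harmless.
  mate : ∀ x : Fin n, M 5 x ≠ 0 → ∃ u : Fin n, M 5 x = u ∧ G.Adj u x ∧ G.dist r u = G.dist r x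

namespace Bfs

variable {r : Fin n} {Q : List (Fin n)} {A : Fin n → Fin n → Prop} {M M' : ℕ → ℕ → ℕ}
  {u w : Fin n}

theorem init (hG : G.Connected) (r : Fin n) (h2 : M 2 = Function.update (0 : ℕ → ℕ) r 1) (h3 : M 3 r = r)
    (h4 : M 4 0 = r) (h5 : M 5 = 0) : Bfs hG r [r] (fun _ _ => False) M where
  root := by simp
  nodup := by simp
  queue i h := by
    obtain rfl : i = 0 := by simpa using h
    simpa
  seen x := by
    rw [h2, Function.update_apply]
    simp [Fin.ext_iff]
  par x hx := by
    obtain rfl : x = r := by simpa using hx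
    rw [h3, parent_self]
  sorted := by simp
  closed y hy x hx := by
    obtain rfl : y = r := by simpa using hy
    simp at hx
  scanned _ _ h := h.elim
  origin x hx h := absurd (by simpa using hx) h
  mate x h := absurd (by rw [h5]; rfl) h

variable (hG : IsOddCactus G)

/-- All arcs leaving lower levels are scanned, so an unseen neighbour of `u` is one level above `u`,
with `u` as its parent. No vertex found so far is on a higher level, and the queue stays sorted. -/
theorem push (h : Bfs hG.1.1 r Q A M) (hu : u ∈ Q) (huw : G.Adj u w) (hw : w ∉ Q)
    (hlow : ∀ x y, G.dist r x < G.dist r u → G.Adj x y → A x y)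
    (hA : ∀ x y, A x y → G.dist r x ≤ G.dist r u)
    (h2 : M' 2 = Function.update (M 2) w 1) (h3 : M' 3 = Function.update (M 3) w u)
    (h4 : M' 4 = Function.update (M 4) Q.length w) (h5 : M' 5 = M 5) :
    Bfs hG.1.1 r (Q ++ [w]) (fun x y => A x y ∨ x = u ∧ y = w) M' := by
  have hc := hG.1.1
  have hwr : w ≠ r := fun e => hw (e ▸ h.root)
  have hge : G.dist r u ≤ G.dist r w := not_lt.1 fun hlt => hw (h.closed u hu w hlt)
  have hd : G.dist r u + 1 = G.dist r w := by
    have h6 := dist_le_of_adj hc huw r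
    by_contra hne
    obtain ⟨h7, h8⟩ := parent_spec hc hwr
    exact hw (h.scanned _ _ (hlow _ w (by omega) h7.symm)).2.1
  have hp : u = parent hc r w := eq_parent hG huw.symm hd
  have hle : ∀ x ∈ Q, G.dist r x ≤ G.dist r w := by
    intro x hx
    by_cases hxr : x = r
    · rw [hxr, SimpleGraph.dist_self]; exact Nat.zero_le _
    · have := hA _ _ (h.origin x hx hxr)
      have := (parent_spec hc hxr).2
      omega
  exact {
    root := by simp [h.root]
    nodup := by
      rw [List.nodup_append]
      exact ⟨h.nodup, by simp, by rintro a ha b hb rfl; simp at hb; exact hw (hb ▸ ha)⟩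
    queue := fun i hi => by
      rw [h4, Function.update_apply, List.getElem_append]
      by_cases hi' : i < Q.length
      · rw [if_neg hi'.ne, dif_pos hi', h.queue]
      · have : i = Q.length := by simp at hi; omega
        simp [this]
    seen := fun x => by
      rw [h2, Function.update_apply, h.seen]
      by_cases hx : x = w
      · simp [hx]
      · have : (x : ℕ) ≠ w := fun e => hx (Fin.ext e)
        simp [hx, this]
    par := fun x hx => by
      rw [h3, Function.update_apply]
      by_cases hx' : x = w
      · rw [hx', if_pos rfl, ← hp]
      · have : (x : ℕ) ≠ w := fun e => hx' (Fin.ext e)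
        rw [if_neg this, h.par x (by simpa [hx'] using hx)]
    sorted := by
      rw [List.pairwise_append]
      exact ⟨h.sorted, by simp, fun a ha b hb => by simp at hb; exact hb ▸ hle a ha⟩
    closed := fun y hy x hx => by
      rw [List.mem_append, List.mem_singleton] at hy ⊢
      rcases hy with hy | rfl
      · exact .inl (h.closed y hy x hx)
      · rcases Nat.lt_or_ge (G.dist r x) (G.dist r u) with h6 | h6
        · exact .inl (h.closed u hu x h6)
        · by_cases hxr : x = r
          · exact .inl (hxr ▸ h.root)
          obtain ⟨h7, h8⟩ := parent_spec hc hxr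
          exact .inl (h.scanned _ _ (hlow _ x (by omega) h7.symm)).2.1
    scanned := by
      rintro x y (hxy | ⟨rfl, rfl⟩)
      · obtain ⟨h6, h7, h8⟩ := h.scanned x y hxy
        exact ⟨h6, by simp [h7], by rwa [h5]⟩
      · exact ⟨huw, by simp, fun e => by omega⟩
    origin := fun x hx hxr => by
      rw [List.mem_append, List.mem_singleton] at hx
      rcases hx with hx | rfl
      · exact .inl (h.origin x hx hxr)
      · exact .inr ⟨hp.symm, rfl⟩
    mate := by rw [h5]; exact h.mate }

theorem skip (h : Bfs hG.1.1 r Q A M) (hu : u ∈ Q) (huw : G.Adj u w) (hw : w = parent hG.1.1 r u) :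
    Bfs hG.1.1 r Q (fun x y => A x y ∨ x = u ∧ y = w) M := by
  have hur : u ≠ r := by
    rintro rfl
    rw [hw, parent_self] at huw
    exact G.loopless.irrefl _ huw
  have h6 := (parent_spec hG.1.1 hur).2
  rw [← hw] at h6
  refine { h with scanned := ?_, origin := fun x hx hxr => .inl (h.origin x hx hxr) }
  rintro x y (hxy | ⟨rfl, rfl⟩)
  · exact h.scanned x y hxy
  · exact ⟨huw, h.closed x hu y (by omega), fun e => by omega⟩

/-- Were `w` lower, it would be the parent of `u`; were it higher, it would have been found along
the arc from its parent `u`, which is not yet scanned. So the edge is horizontal. -/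
theorem meet (h : Bfs hG.1.1 r Q A M) (hu : u ∈ Q) (huw : G.Adj u w) (hw : w ∈ Q)
    (hw' : w ≠ parent hG.1.1 r u) (hA : ¬ A u w)
    (h2 : M' 2 = M 2) (h3 : M' 3 = M 3) (h4 : M' 4 = M 4)
    (h5 : M' 5 = Function.update (M 5) w u) :
    Bfs hG.1.1 r Q (fun x y => A x y ∨ x = u ∧ y = w) M' := by
  have hd : G.dist r u = G.dist r w := by
    have h6 := dist_le_of_adj hG.1.1 huw r
    have h7 := dist_le_of_adj hG.1.1 huw.symm r
    rcases lt_trichotomy (G.dist r u) (G.dist r w) with h8 | h8 | h8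
    · have hwr : w ≠ r := by rintro rfl; simp at h8
      have := h.origin w hw hwr
      rw [← eq_parent hG huw.symm (by omega)] at this
      exact absurd this hA
    · exact h8
    · exact absurd (eq_parent hG huw (by omega)) hw'
  refine { h with
    queue := by rw [h4]; exact h.queue
    seen := by rw [h2]; exact h.seen
    par := by rw [h3]; exact h.par
    scanned := ?_
    origin := fun x hx hxr => .inl (h.origin x hx hxr)
    mate := fun x => ?_ }
  · rintro x y (hxy | ⟨rfl, rfl⟩)
    · obtain ⟨h6, h7, h8⟩ := h.scanned x y hxy
      refine ⟨h6, h7, fun e => ?_⟩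
      rw [h5, Function.update_apply]
      split_ifs with hyw
      · obtain rfl := Fin.ext hyw
        rw [unique_mate hG (r := r) h6.symm huw.symm e.symm hd.symm]
      · exact h8 e
    · exact ⟨huw, hw, fun _ => by rw [h5, Function.update_self]⟩
  · rw [h5, Function.update_apply]
    split_ifs with hxw
    · obtain rfl := Fin.ext hxw
      exact fun _ => ⟨u, rfl, huw, hd⟩
    · exact h.mate x

end Bfs

/-- Scans the adjacency list of the vertex in register `9`. -/
def scanList : Prog :=
  .loop (.lt 10 11) (.seq (.block (.load 12 1 10) [.load 14 2 12])
    (.seq (.ite (.eq 14 5) (.block (.store 2 12 15) [.store 3 12 9, .store 4 8 12, .inc 8])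
      (.ite (.eq 12 13) (.instr (.move 12 12)) (.instr (.store 5 12 9)))) (.instr (.inc 10))))

/-- Breadth-first search from the vertex whose successor is in register `4`. -/
def search : Prog :=
  .seq (.block (.dec 4) [.const 5 0, .const 15 1, .const 7 0, .const 8 1, .store 4 7 4,
    .store 2 4 15, .store 3 4 4])
  (.loop (.lt 7 8) (.seq (.block (.load 9 4 7) [.load 10 0 9, .move 14 9, .inc 14, .load 11 0 14,
    .load 13 3 9]) (.seq scanList (.instr (.inc 7)))))

/-- The contents of memory and registers that stay the same during the search. -/
structure Frame (adj : Fin n → List (Fin n)) (σ : State) : Prop where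
  arr_zero : σ.arr 0 = (inputState adj).arr 0
  arr_one : σ.arr 1 = (inputState adj).arr 1
  reg_zero : σ.reg 0 = n
  reg_five : σ.reg 5 = 0
  reg_fifteen : σ.reg 15 = 1

theorem run_scanList (hG : IsOddCactus G) (hadj : IsAdjList G adj) {r u : Fin n}
    {D R : List (Fin n)} {σ : State} (hF : Frame adj σ) (h7 : σ.reg 7 = D.length)
    (h8 : σ.reg 8 = (D ++ u :: R).length) (h9 : σ.reg 9 = u)
    (h10 : σ.reg 10 = σ.arr 0 u) (h11 : σ.reg 11 = σ.arr 0 u + (adj u).length)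
    (h13 : σ.reg 13 = parent hG.1.1 r u)
    (hB : Bfs hG.1.1 r (D ++ u :: R) (fun x y => G.Adj x y ∧ x ∈ D) σ.arr) :
    Run scanList σ (9 * (adj u).length + 1) fun τ => Frame adj τ ∧ τ.reg 7 = D.length ∧ ∃ R',
      τ.reg 8 = (D ++ u :: R').length ∧
      Bfs hG.1.1 r (D ++ u :: R') (fun x y => G.Adj x y ∧ x ∈ D ++ [u]) τ.arr := by
  refine (Run.loop (I := fun N τ => Frame adj τ ∧ τ.reg 7 = D.length ∧ τ.reg 9 = u ∧
    τ.reg 11 = τ.arr 0 u + (adj u).length ∧ τ.reg 13 = parent hG.1.1 r u ∧ ∃ R' t,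
      t ≤ (adj u).length ∧ τ.reg 10 = τ.arr 0 u + t ∧ N = 9 * ((adj u).length - t) ∧
      τ.reg 8 = (D ++ u :: R').length ∧ Bfs hG.1.1 r (D ++ u :: R')
        (fun x y => G.Adj x y ∧ (x ∈ D ∨ x = u ∧ y ∈ (adj u).take t)) τ.arr) ?_ _ σ
    ⟨hF, h7, h9, h11, h13, R, 0, Nat.zero_le _, h10, rfl, h8, by simpa using hB⟩).mono le_rfl ?_
  · clear hF h7 h8 h9 h10 h11 h13 hB
    rintro N σ ⟨hF, h7, h9, h11, h13, R, t, ht, h10, rfl, h8, hB⟩ hb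
    have hb : σ.reg 10 < σ.reg 11 := hb
    have ht : t < (adj u).length := by omega
    set w := (adj u)[t] with hw
    have huw : G.Adj u w := ((hadj u).2 w).1 (List.getElem_mem ht)
    have harc : σ.arr 1 (σ.reg 10) = w := by
      rw [h10, hF.arr_one, hF.arr_zero, inputState_getElem u t ht]
    have huD : u ∉ D := fun h =>
      (List.nodup_append.1 hB.nodup).2.2 u h u (by simp) rfl
    have huQ : u ∈ D ++ u :: R := by simp
    have hlow : ∀ x y, G.dist r x < G.dist r u → G.Adj x y →
        G.Adj x y ∧ (x ∈ D ∨ x = u ∧ y ∈ (adj u).take t) := by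
      intro x y hx hxy
      refine ⟨hxy, .inl ?_⟩
      have h1 := hB.closed u huQ x hx
      rw [List.mem_append, List.mem_cons] at h1
      rcases h1 with h1 | rfl | h1
      · exact h1
      · exact absurd hx (lt_irrefl _)
      · have h2 := (List.pairwise_append.1 hB.sorted).2.1
        have := (List.pairwise_cons.1 h2).1 x h1
        omega
    have hle : ∀ x y, G.Adj x y ∧ (x ∈ D ∨ x = u ∧ y ∈ (adj u).take t) →
        G.dist r x ≤ G.dist r u := by
      rintro x y ⟨-, h | ⟨rfl, -⟩⟩
      · exact (List.pairwise_append.1 hB.sorted).2.2 x h u (by simp)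
      · exact le_rfl
    have hnot : ¬ (G.Adj u w ∧ (u ∈ D ∨ u = u ∧ w ∈ (adj u).take t)) := by
      rintro ⟨-, h | ⟨-, h⟩⟩
      · exact huD h
      · obtain ⟨i, hi, hi'⟩ := List.mem_take_iff_getElem.1 h
        have := (hadj u).1.getElem_inj_iff.1 hi'
        omega
    have hnext : (fun x y => (G.Adj x y ∧ (x ∈ D ∨ x = u ∧ y ∈ (adj u).take t)) ∨ x = u ∧ y = w) =
        fun x y => G.Adj x y ∧ (x ∈ D ∨ x = u ∧ y ∈ (adj u).take (t + 1)) := by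
      funext x y
      rw [List.take_succ_eq_append_getElem ht, List.mem_append, List.mem_singleton, ← hw]
      refine propext ⟨?_, ?_⟩
      · rintro (⟨h, h'⟩ | ⟨rfl, rfl⟩)
        · exact ⟨h, h'.imp id (And.imp id .inl)⟩
        · exact ⟨huw, .inr ⟨rfl, .inr rfl⟩⟩
      · tauto
    -- Two loads, at most five steps in the branches and one increment; with the loop test this
    -- makes nine.
    refine ⟨2 + (5 + 1 + 1 - 1 + 0), 9 * ((adj u).length - (t + 1)), by omega, ?_⟩
    refine Run.seq (S := 2) (T := 6) (R := fun τ => Frame adj τ ∧ τ.arr = σ.arr ∧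
      τ.reg 7 = D.length ∧ τ.reg 8 = (D ++ u :: R).length ∧ τ.reg 9 = u ∧ τ.reg 10 = σ.reg 10 ∧
      τ.reg 11 = σ.reg 11 ∧ τ.reg 12 = w ∧ τ.reg 13 = σ.reg 13 ∧ τ.reg 14 = σ.arr 2 w)
      (Run.block (by simp) ?_) ?_
    · refine ⟨⟨hF.arr_zero, hF.arr_one, ?_, ?_, ?_⟩, rfl, ?_, ?_, ?_, ?_, ?_, ?_, ?_, ?_⟩ <;>
        simp [Instr.run, harc, hF.reg_zero, hF.reg_five, hF.reg_fifteen, h7, h8, h9]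
    rintro τ ⟨gF, g, g7, g8, g9, g10, g11, g12, g13, g14⟩
    refine Run.seq (S := 5) (T := 1) (R := fun ρ => Frame adj ρ ∧ ρ.reg 7 = D.length ∧
      ρ.reg 9 = u ∧ ρ.reg 10 = σ.reg 10 ∧ ρ.reg 11 = σ.reg 11 ∧ ρ.reg 13 = σ.reg 13 ∧ ∃ R',
      ρ.reg 8 = (D ++ u :: R').length ∧ Bfs hG.1.1 r (D ++ u :: R')
        (fun x y => G.Adj x y ∧ (x ∈ D ∨ x = u ∧ y ∈ (adj u).take (t + 1))) ρ.arr)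
      (Run.ite (T := 4) (fun hb' => ?_) fun hb' => ?_) ?_
    · have hwQ : w ∉ D ++ u :: R := by
        intro h
        have hb' : τ.reg 14 = τ.reg 5 := hb'
        rw [g14, gF.reg_five, hB.seen, if_pos h] at hb'
        exact one_ne_zero hb'
      refine Run.block (by simp) ⟨⟨?_, ?_, ?_, ?_, ?_⟩, ?_, ?_, ?_, ?_, ?_, R ++ [w], ?_, ?_⟩
      iterate 10 simp [Instr.run, gF.arr_zero, gF.arr_one, gF.reg_zero, gF.reg_five,
        gF.reg_fifteen, g7, g9, g10, g11, g13]
      · simp [Instr.run, g8]; omega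
      · rw [← hnext]
        have := hB.push hG huQ huw hwQ hlow hle (M' := (List.foldl Instr.run
          (Instr.run τ (.store 2 12 15)) [.store 3 12 9, .store 4 8 12, .inc 8]).arr)
          (by simp [Instr.run, g12, g, gF.reg_fifteen]) (by simp [Instr.run, g12, g9, g])
          (by simp [Instr.run, g12, g8, g]) (by simp [Instr.run, g])
        simpa only [List.append_assoc, List.cons_append] using this
    · have hwQ : w ∈ D ++ u :: R := by
        by_contra h
        apply hb'
        show τ.reg 14 = τ.reg 5
        rw [g14, gF.reg_five, hB.seen, if_neg h]
      refine (Run.ite (T := 1) (fun hp => Run.instr ?_) fun hp => Run.instr ?_).mono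
        (by omega) fun _ => id
      · have hp : τ.reg 12 = τ.reg 13 := hp
        rw [g12, g13, h13] at hp
        have := hB.skip hG huQ huw (Fin.ext hp)
        rw [hnext, ← g] at this
        refine ⟨⟨gF.arr_zero, gF.arr_one, ?_, ?_, ?_⟩, ?_, ?_, ?_, ?_, ?_, R, ?_, this⟩ <;>
          simp [Instr.run, gF.reg_zero, gF.reg_five, gF.reg_fifteen, g7, g8, g9, g10, g11, g13]
      · have hp' : w ≠ parent hG.1.1 r u := by
          rintro e
          apply hp
          show τ.reg 12 = τ.reg 13
          rw [g12, g13, h13, e]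
        refine ⟨⟨?_, ?_, gF.reg_zero, gF.reg_five, gF.reg_fifteen⟩, g7, g9, g10, g11, g13, R, g8, ?_⟩
        · simp [Instr.run, gF.arr_zero]
        · simp [Instr.run, gF.arr_one]
        · rw [← hnext]
          exact hB.meet hG huQ huw hwQ hp' hnot (by simp [Instr.run, g]) (by simp [Instr.run, g])
            (by simp [Instr.run, g]) (by simp [Instr.run, g, g9, g12])
    · rintro ρ ⟨kF, k7, k9, k10, k11, k13, R', k8, kB⟩
      have e : ρ.arr 0 = σ.arr 0 := by rw [kF.arr_zero, hF.arr_zero]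
      refine Run.instr ⟨⟨kF.arr_zero, kF.arr_one, ?_, ?_, ?_⟩, ?_, ?_, ?_, ?_, R', t + 1, ht, ?_, rfl,
        ?_, kB⟩ <;>
        simp [Instr.run, kF.reg_zero, kF.reg_five, kF.reg_fifteen, k7, k8, k9, k10, k11, k13, e,
          h10, h11, h13]
      omega
  · rintro τ ⟨hb, N, gF, g7, -, g11, -, R', t, ht, g10, -, g8, gB⟩
    have hb : ¬ τ.reg 10 < τ.reg 11 := hb
    obtain rfl : t = (adj u).length := by omega
    refine ⟨gF, g7, R', g8, ?_⟩
    have e : (fun x y => G.Adj x y ∧ x ∈ D ++ [u]) = fun x y =>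
        G.Adj x y ∧ (x ∈ D ∨ x = u ∧ y ∈ (adj u).take (adj u).length) := by
      funext x y
      rw [List.take_length, List.mem_append, List.mem_singleton, (hadj u).2]
      refine propext ⟨?_, by tauto⟩
      rintro ⟨h, h' | rfl⟩
      · exact ⟨h, .inl h'⟩
      · exact ⟨h, .inr ⟨rfl, h⟩⟩
    rw [e]
    exact gB

/-- A memory state that records the parent of every vertex and the end of the edge at it whose ends
are at the same distance from `r`. -/
structure Searched (hG : G.Connected) (r : Fin n) (σ : State) : Prop where
  par : ∀ x : Fin n, σ.arr 3 x = parent hG r x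
  scanned : ∀ x y : Fin n, G.Adj x y → G.dist r x = G.dist r y → σ.arr 5 y = x
  mate : ∀ x : Fin n, σ.arr 5 x ≠ 0 →
    ∃ u : Fin n, σ.arr 5 x = u ∧ G.Adj u x ∧ G.dist r u = G.dist r x

theorem Bfs.searched (hG : G.Connected) {r : Fin n} {Q : List (Fin n)} {σ : State}
    (h : Bfs hG r Q (fun x y => G.Adj x y ∧ x ∈ Q) σ.arr) : Searched hG r σ := by
  have hQ : ∀ x, x ∈ Q := by
    intro x
    obtain ⟨p⟩ := hG.preconnected r x
    have key : ∀ x y (p : G.Walk x y), x ∈ Q → y ∈ Q := by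
      intro x y p
      induction p with
      | nil => exact id
      | cons hxy _ ih => exact fun hx => ih (h.scanned _ _ ⟨hxy, hx⟩).2.1
    exact key _ _ p h.root
  exact ⟨fun x => h.par x (hQ x), fun x y hxy => (h.scanned x y ⟨hxy, hQ x⟩).2.2, h.mate⟩

theorem run_search (hG : IsOddCactus G) (hadj : IsAdjList G adj) {r : Fin n} {σ : State}
    (harr : σ.arr = (inputState adj).arr) (h0 : σ.reg 0 = n) (h4 : σ.reg 4 = r + 1) :
    Run search σ (9 * (n + 2 * G.edgeSet.ncard) + 9) fun τ => Frame adj τ ∧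
      Searched hG.1.1 r τ := by
  -- Processing `u` costs `9 (deg u + 1)` steps. As the queue has no repetitions, this sum bounds
  -- the whole search.
  have hsum : ∑ u, 9 * ((adj u).length + 1) = 9 * (n + 2 * G.edgeSet.ncard) := by
    rw [← Finset.mul_sum, Finset.sum_add_distrib, hadj.sum_length]
    simp
    ring
  have hzero : ∀ a, 2 ≤ a → σ.arr a = 0 := by
    intro a ha
    rw [harr]
    funext i
    simp [inputState, show a ≠ 0 by omega, show a ≠ 1 by omega]
  refine (Run.seq (S := 8) (T := 9 * (n + 2 * G.edgeSet.ncard) + 1) (R := fun τ => Frame adj τ ∧ τ.reg 7 = 0 ∧ τ.reg 8 = 1 ∧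
    Bfs hG.1.1 r [r] (fun _ _ => False) τ.arr) (Run.block (by simp) ?_) ?_).mono (by omega)
    fun _ => id
  · refine ⟨⟨?_, ?_, ?_, ?_, ?_⟩, ?_, ?_, Bfs.init hG.1.1 r ?_ ?_ ?_ ?_⟩ <;>
      simp [Instr.run, harr, h0, h4]
    all_goals simp [← harr, hzero]
  · rintro τ ⟨gF, g7, g8, gB⟩
    refine (Run.loop (I := fun N τ => Frame adj τ ∧ ∃ D R,
      τ.reg 7 = D.length ∧ τ.reg 8 = (D ++ R).length ∧
      N + (D.map fun u => 9 * ((adj u).length + 1)).sum = 9 * (n + 2 * G.edgeSet.ncard) ∧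
      Bfs hG.1.1 r (D ++ R) (fun x y => G.Adj x y ∧ x ∈ D) τ.arr) ?_ _ τ
      ⟨gF, [], [r], g7, g8, rfl, by simpa using gB⟩).mono le_rfl ?_
    · clear! σ τ
      rintro N σ ⟨hF, D, R, h7, h8, hN, hB⟩ hb
      have hb : σ.reg 7 < σ.reg 8 := hb
      obtain ⟨u, R, rfl⟩ : ∃ u R', R = u :: R' := by
        cases R with
        | nil => simp at h8; omega
        | cons u R => exact ⟨u, R, rfl⟩
      have hle : ((D ++ [u]).map fun u => 9 * ((adj u).length + 1)).sum ≤
          9 * (n + 2 * G.edgeSet.ncard) := by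
        have hnd : (D ++ [u]).Nodup := by
          have := hB.nodup
          rw [List.append_cons] at this
          exact (List.nodup_append.1 this).1
        rw [← List.sum_toFinset _ hnd, ← hsum]
        exact Finset.sum_le_sum_of_subset (Finset.subset_univ _)
      obtain ⟨N', hN'⟩ := Nat.exists_eq_add_of_le' hle
      have hq : σ.arr 4 (σ.reg 7) = u := by
        rw [h7, hB.queue _ (by simp)]
        simp
      have hp : σ.arr 3 u = parent hG.1.1 r u := hB.par u (by simp)
      have hoff := inputState_offset_succ (adj := adj) u
      refine ⟨6 + (9 * (adj u).length + 1 + 1), N', ?_, ?_⟩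
      · simp at hN'
        omega
      refine Run.seq (R := fun τ => Frame adj τ ∧ τ.arr = σ.arr ∧ τ.reg 7 = D.length ∧
        τ.reg 8 = (D ++ u :: R).length ∧ τ.reg 9 = u ∧ τ.reg 10 = τ.arr 0 u ∧
        τ.reg 11 = τ.arr 0 u + (adj u).length ∧ τ.reg 13 = parent hG.1.1 r u)
        (Run.block (by simp) ?_) ?_
      · refine ⟨⟨hF.arr_zero, hF.arr_one, ?_, ?_, ?_⟩, rfl, ?_, ?_, ?_, ?_, ?_, ?_⟩ <;>
          simp [Instr.run, hF.reg_zero, hF.reg_five, hF.reg_fifteen, hq, hp, hF.arr_zero, hoff]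
        · exact h7
        · simpa using h8
      · rintro τ ⟨gF, g, g7, g8, g9, g10, g11, g13⟩
        refine Run.seq (run_scanList hG hadj gF g7 g8 g9 g10 g11 g13 (by rwa [g])) ?_
        rintro ρ ⟨kF, k7, R', k8, kB⟩
        refine Run.instr ⟨⟨kF.arr_zero, kF.arr_one, ?_, ?_, ?_⟩, D ++ [u], R', ?_, ?_, hN'.symm, ?_⟩
        iterate 5 simp [Instr.run, kF.reg_zero, kF.reg_five, kF.reg_fifteen, k7, k8]
        simpa [Instr.run] using kB
    · rintro τ ⟨hb, N, gF, D, R, g7, g8, -, gB⟩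
      have hb : ¬ τ.reg 7 < τ.reg 8 := hb
      obtain rfl : R = [] := List.length_eq_zero_iff.1 (by simp at g8; omega)
      rw [List.append_nil] at gB
      exact ⟨gF, gB.searched⟩

end Search
end OddCactus

namespace OddCactus

/-- The vertices `v (±(1 + 2j))` are `k - j` steps from the base, so parent pointers climb both
sides of the cycle from the ends of the horizontal edge to `v 0`. -/
theorem Chart.parent_v {V : Type*} {G : SimpleGraph V} (C : Chart G) (hG : IsOddCactus G) {r : V}
    (hr : C.π r = 0) {j : ℕ} (hj : j < C.k) :
    parent hG.1.1 r (C.v (1 + 2 * j)) = C.v (1 + 2 * (j + 1 : ℕ)) ∧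
      parent hG.1.1 r (C.v (-(1 + 2 * j))) = C.v (-(1 + 2 * (j + 1 : ℕ))) := by
  have hc := hG.1.1
  have h1 := len_odd (k := C.k) hj.le
  have h2 := len_odd (k := C.k) (j := j + 1) hj
  have hd : ∀ p, G.dist r (C.v p) = G.dist r (C.v 0) + len p := by
    intro p
    rw [C.dist_v hc, hr, C.dist_v_v hc, sub_zero]
  constructor <;> symm <;> apply eq_parent hG
  · have := C.step (1 + 2 * j)
    rwa [show (1 + 2 * j + 2 : ZMod (2 * C.k + 1)) = 1 + 2 * (j + 1 : ℕ) by push_cast; ring] at this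
  · rw [hd, hd (1 + 2 * j), h1, h2]; omega
  · have := (C.step (-(1 + 2 * (j + 1 : ℕ)))).symm
    rwa [show (-(1 + 2 * (j + 1 : ℕ)) + 2 : ZMod (2 * C.k + 1)) = -(1 + 2 * j) by
      push_cast; ring] at this
  · rw [hd, hd (-(1 + 2 * j)), len_neg, len_neg, h1, h2]; omega

/-! ### Processing one cycle -/

section Count

variable {n : ℕ} {G : SimpleGraph (Fin n)} {adj : Fin n → List (Fin n)}

open Classical in
/-- The number of positions in `{i + 1, …, 2k}` that are not selected. -/
noncomputable def Chart.waste (C : Chart G) (i : ℕ) : ℕ :=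
  ∑ j ∈ Finset.Ico (i + 1) (2 * C.k + 1),
    if Greedy (fun i => IsCutVertex G (C.v i)) j then 0 else 1

open Classical in
/-- Register `13` tells whether position `i` is selected, and the positions after `i` that are not
selected have yet to be subtracted from register `0`. -/
structure Tally (C : Chart G) (K i : ℕ) (σ : State) : Prop where
  flag : σ.reg 13 = if Greedy (fun i => IsCutVertex G (C.v i)) i then 1 else 0
  count : σ.reg 0 = K + C.waste i

/-- The registers and cells that do not change while the cycles are processed. -/
structure Settled (adj : Fin n → List (Fin n)) (hG : G.Connected) (r : Fin n) (σ : State) :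
    Prop where
  arr_zero : σ.arr 0 = (inputState adj).arr 0
  searched : Searched hG r σ
  reg_two : σ.reg 2 = n
  reg_five : σ.reg 5 = 0
  reg_fifteen : σ.reg 15 = 1

theorem Settled.congr {hG : G.Connected} {r : Fin n} {σ τ : State} (h : Settled adj hG r σ)
    (h0 : τ.arr 0 = σ.arr 0) (h3 : τ.arr 3 = σ.arr 3) (h5 : τ.arr 5 = σ.arr 5)
    (g2 : τ.reg 2 = σ.reg 2) (g5 : τ.reg 5 = σ.reg 5) (g15 : τ.reg 15 = σ.reg 15) :
    Settled adj hG r τ :=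
  ⟨by rw [h0, h.arr_zero], ⟨by rw [h3]; exact h.searched.par, by rw [h5]; exact h.searched.scanned,
    by rw [h5]; exact h.searched.mate⟩, by rw [g2, h.reg_two], by rw [g5, h.reg_five],
    by rw [g15, h.reg_fifteen]⟩

/-- Visits the vertex in register `s`, as the next one of a cycle. -/
def visit (s : ℕ) : Prog :=
  .seq (.block (.load 6 0 s) [.inc 6, .inc 6, .move 3 s, .inc 3, .load 3 0 3])
    (.ite (.eq 6 3) (.ite (.eq 13 5) (.instr (.move 13 15)) (.block (.move 13 5) [.dec 0]))
      (.block (.move 13 5) [.dec 0]))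

/-- One step of the greedy recursion: degree two means unmarked, and register `0` drops by one
exactly when the new position is not selected. -/
theorem run_visit (hG : G.Connected) (hadj : IsAdjList G adj) (C : Chart G) {K i s : ℕ} {σ : State}
    (hi : i < 2 * C.k) (hs6 : s ≠ 6) (harr : σ.arr 0 = (inputState adj).arr 0)
    (h5 : σ.reg 5 = 0) (h15 : σ.reg 15 = 1) (hs : σ.reg s = C.v (i + 1 : ℕ)) (hT : Tally C K i σ) :
    Run (visit s) σ 10 fun τ => τ.arr = σ.arr ∧
      (∀ x, x ≠ 0 → x ≠ 3 → x ≠ 6 → x ≠ 13 → τ.reg x = σ.reg x) ∧ Tally C K (i + 1) τ := by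
  have hoff := inputState_offset_succ (adj := adj) (C.v (i + 1 : ℕ))
  rw [hadj.length] at hoff
  have hcut := C.isCutVertex_iff_ncard hG (p := (i + 1 : ℕ))
  have hw : C.waste i = (open Classical in
      if Greedy (fun i => IsCutVertex G (C.v i)) (i + 1) then 0 else 1) + C.waste (i + 1) := by
    rw [Chart.waste, Finset.sum_eq_sum_Ico_succ_bot (by omega)]
    rfl
  have hg : Greedy (fun i => IsCutVertex G (C.v i)) (i + 1) ↔
    ¬ IsCutVertex G (C.v (i + 1 : ℕ)) ∧ ¬ Greedy (fun i => IsCutVertex G (C.v i)) i := Iff.rfl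
  have hcount := hT.count
  have hflag := hT.flag
  have hdec : ∀ τ : State, τ.arr = σ.arr → τ.reg 0 = σ.reg 0 → τ.reg 5 = 0 →
      (∀ x, x ≠ 0 → x ≠ 3 → x ≠ 6 → x ≠ 13 → τ.reg x = σ.reg x) →
      ¬ Greedy (fun i => IsCutVertex G (C.v i)) (i + 1) →
      Run (.block (.move 13 5) [.dec 0]) τ 2 fun τ => τ.arr = σ.arr ∧
      (∀ x, x ≠ 0 → x ≠ 3 → x ≠ 6 → x ≠ 13 → τ.reg x = σ.reg x) ∧ Tally C K (i + 1) τ := by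
    intro τ g g0 g5 gx hng
    rw [if_neg hng] at hw
    refine Run.block (by simp) ⟨g, fun x x0 x3 x6 x13 => ?_, ?_, ?_⟩
    · simp [Instr.run, x0, x13, gx x x0 x3 x6 x13]
    · rw [if_neg hng]; simp [Instr.run, g5]
    · simp [Instr.run, g0]; omega
  refine Run.seq (S := 6) (T := 4) (R := fun τ => τ.arr = σ.arr ∧ τ.reg 0 = σ.reg 0 ∧
    τ.reg 13 = σ.reg 13 ∧ τ.reg 5 = 0 ∧ τ.reg 15 = 1 ∧
    (∀ x, x ≠ 0 → x ≠ 3 → x ≠ 6 → x ≠ 13 → τ.reg x = σ.reg x) ∧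
    (τ.reg 6 = τ.reg 3 ↔ ¬ IsCutVertex G (C.v (i + 1 : ℕ)))) (Run.block (by simp) ?_) ?_
  · refine ⟨rfl, ?_, ?_, ?_, ?_, fun x x0 x3 x6 x13 => ?_, ?_⟩
    iterate 5 simp [Instr.run, *]
    simp only [Instr.run, List.foldl_cons, List.foldl_nil, State.reg_setReg, State.arr_setReg, hs,
      harr, hs6, hcut, hoff, Nat.reduceEqDiff, if_true, if_false]
    omega
  rintro τ ⟨g, g0, g13, g5, g15, gx, gc⟩
  refine Run.ite (T := 3) (fun hb => Run.ite (T := 2) (fun hb' => ?_) fun hb' => ?_) fun hb => ?_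
  · have hnc := gc.1 hb
    have hng : ¬ Greedy (fun i => IsCutVertex G (C.v i)) i := by
      intro h
      have hb' : τ.reg 13 = τ.reg 5 := hb'
      rw [g13, g5, hflag, if_pos h] at hb'
      exact one_ne_zero hb'
    rw [if_pos (hg.2 ⟨hnc, hng⟩)] at hw
    refine (Run.instr ⟨g, fun x x0 x3 x6 x13 => ?_, ?_, ?_⟩).mono (by omega) fun _ => id
    · simp [Instr.run, x13, gx x x0 x3 x6 x13]
    · rw [if_pos (hg.2 ⟨hnc, hng⟩)]; simp [Instr.run, g15]
    · simp [Instr.run, g0]; omega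
  · refine hdec τ g g0 g5 gx fun h => hb' ?_
    show τ.reg 13 = τ.reg 5
    rw [g13, g5, hflag, if_neg (hg.1 h).2]
  · exact (hdec τ g g0 g5 gx fun h => hb (gc.2 (hg.1 h).1)).mono (by omega) fun _ => id

/-- Subtracts from register `0` the number of positions that are not selected, on the cycle opposite
to the root through the edge with ends in registers `1` and `9`. -/
def processCycle : Prog :=
  .seq (.block (.const 10 0) [.move 11 1, .move 12 9])
    (.seq (.loop (.ne 11 12) (.block (.store 6 10 11) [.inc 10, .load 11 3 11, .load 12 3 12]))
      (.seq (.instr (.const 13 0))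
        (.loop (.ne 9 12) (.seq (visit 9) (.seq (.block (.dec 10) [.load 14 6 10])
          (.seq (visit 14) (.instr (.load 9 3 9))))))))

theorem run_processCycle (hG : IsOddCactus G) (hadj : IsAdjList G adj) (C : Chart G) {r : Fin n}
    (hr : C.π r = 0) {K : ℕ} {σ : State} (hS : Settled adj hG.1.1 r σ) (h1 : σ.reg 1 = C.v (-1))
    (h9 : σ.reg 9 = C.v 1) (h0 : σ.reg 0 = K + C.waste 0) :
    Run processCycle σ (29 * C.k + 6) fun τ => Settled adj hG.1.1 r τ ∧ τ.reg 1 = σ.reg 1 ∧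
      τ.reg 0 = K := by
  have hz := ZMod.natCast_self (2 * C.k + 1)
  push_cast at hz
  refine (Run.seq (S := 3) (T := 5 * C.k + 1 + (1 + (24 * C.k + 1))) (R := fun τ =>
    Settled adj hG.1.1 r τ ∧ τ.reg 0 = σ.reg 0 ∧ τ.reg 1 = σ.reg 1 ∧ τ.reg 9 = C.v 1 ∧
    τ.reg 10 = 0 ∧ τ.reg 11 = C.v (-1) ∧ τ.reg 12 = C.v 1) (Run.block (by simp) ?_) ?_).mono
    (by omega) fun _ => id
  · refine ⟨hS.congr rfl rfl rfl ?_ ?_ ?_, ?_, ?_, ?_, ?_, ?_, ?_⟩ <;> simp [Instr.run, *]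
  rintro τ ⟨gS, g0, g1, g9, g10, g11, g12⟩
  -- Climb both sides at once, stacking the vertices of the side that starts at `v (-1)`.
  refine Run.seq (R := fun ρ => Settled adj hG.1.1 r ρ ∧ ρ.reg 0 = σ.reg 0 ∧
    ρ.reg 1 = σ.reg 1 ∧ ρ.reg 9 = C.v 1 ∧ ρ.reg 10 = C.k ∧ ρ.reg 12 = C.v 0 ∧
    ∀ i < C.k, ρ.arr 6 i = C.v (-(1 + 2 * i))) ((Run.loop (I := fun N ρ =>
      Settled adj hG.1.1 r ρ ∧ ρ.reg 0 = σ.reg 0 ∧ ρ.reg 1 = σ.reg 1 ∧ ρ.reg 9 = C.v 1 ∧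
      ∃ j ≤ C.k, N = 5 * (C.k - j) ∧ ρ.reg 10 = j ∧ ρ.reg 11 = C.v (-(1 + 2 * j)) ∧
        ρ.reg 12 = C.v (1 + 2 * j) ∧ ∀ i < j, ρ.arr 6 i = C.v (-(1 + 2 * i))) ?_ (5 * C.k) τ
      ⟨gS, g0, g1, g9, 0, Nat.zero_le _, rfl, g10, by simp [g11], by simp [g12],
        fun i hi => absurd hi (Nat.not_lt_zero _)⟩).mono le_rfl ?_) ?_
  · clear gS g0 g1 g9 g10 g11 g12 τ
    rintro N τ ⟨gS, g0, g1, g9, j, hj, rfl, g10, g11, g12, g6⟩ hb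
    have hb : τ.reg 11 ≠ τ.reg 12 := hb
    have hjk : j < C.k := by
      refine lt_of_le_of_ne hj ?_
      rintro rfl
      rw [g11, g12] at hb
      exact hb (congrArg (fun p => ((C.v p : Fin n) : ℕ)) (by linear_combination -2 * hz))
    obtain ⟨hp1, hp2⟩ := C.parent_v hG hr hjk
    refine ⟨4, 5 * (C.k - (j + 1)), by omega, Run.block (by simp)
      ⟨gS.congr ?_ ?_ ?_ ?_ ?_ ?_, ?_, ?_, ?_, j + 1, hjk, rfl, ?_, ?_, ?_, ?_⟩⟩
    iterate 10 simp [Instr.run, g0, g1, g9, g10]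
    · simp only [Instr.run, List.foldl_cons, List.foldl_nil, State.reg_setReg, State.arr_setReg,
        State.arr_setCell_of_ne _ (show 3 ≠ 6 by omega), State.reg_setCell, g11, gS.searched.par,
        hp2, Nat.reduceEqDiff, if_true, if_false]
    · simp [Instr.run, g12, gS.searched.par, hp1]
    · intro i hi
      rcases Nat.lt_succ_iff_lt_or_eq.1 hi with hi | rfl
      · simp [Instr.run, g10, hi.ne, g6 i hi]
      · simp [Instr.run, g10, g11]
  · rintro ρ ⟨hb, N, kS, k0, k1, k9, j, hj, -, k10, k11, k12, k6⟩
    have hb : ρ.reg 11 = ρ.reg 12 := not_not.1 hb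
    obtain rfl : j = C.k := by
      rw [k11, k12] at hb
      have h := C.inj (Fin.ext hb)
      have h2 := cast_inj_of_lt (k := C.k) (i := 1 + 2 * j) (j := 0)
      by_contra hne
      have := h2 (by omega) (by omega) (two_mul_cancel (by push_cast; linear_combination -h))
      omega
    refine ⟨kS, k0, k1, k9, k10, ?_, k6⟩
    rw [k12]
    exact congrArg (fun p => ((C.v p : Fin n) : ℕ)) (by linear_combination hz)
  clear gS g0 g1 g9 g10 g11 g12 τ
  rintro τ ⟨gS, g0, g1, g9, g10, g12, g6⟩
  refine Run.seq (R := fun ρ => Settled adj hG.1.1 r ρ ∧ ρ.arr 6 = τ.arr 6 ∧ ρ.reg 1 = σ.reg 1 ∧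
    ρ.reg 9 = C.v 1 ∧ ρ.reg 10 = C.k ∧ ρ.reg 12 = C.v 0 ∧ Tally C K 0 ρ) (Run.instr ?_) ?_
  · refine ⟨gS.congr rfl rfl rfl ?_ ?_ ?_, rfl, ?_, ?_, ?_, ?_, ?_, ?_⟩ <;>
      simp [Instr.run, Greedy, *]
  rintro ρ ⟨kS, k6, k1, k9, k10, k12, kT⟩
  -- Since `-(1 + 2 (k - 1 - j)) = 2j + 2`, popping the stack yields `v 2, v 4, …, v (2k)`.
  -- Interleaved with `v 1, v 3, …` from the other side, the positions `1, …, 2k` come in increasing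
  -- order.
  refine (Run.loop (I := fun N ρ => Settled adj hG.1.1 r ρ ∧ ρ.arr 6 = τ.arr 6 ∧
    ρ.reg 1 = σ.reg 1 ∧ ρ.reg 12 = C.v 0 ∧ ∃ j i, j + i = C.k ∧ N = 24 * i ∧
      ρ.reg 9 = C.v (1 + 2 * j) ∧ ρ.reg 10 = i ∧ Tally C K (2 * j) ρ) ?_ (24 * C.k) ρ
    ⟨kS, k6, k1, k12, 0, C.k, by omega, rfl, by simp [k9], k10, kT⟩).mono le_rfl ?_
  · clear kS k6 k1 k9 k10 k12 kT ρ
    rintro N ρ ⟨kS, k6, k1, k12, j, i, hji, rfl, k9, k10, kT⟩ hb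
    have hb : ρ.reg 9 ≠ ρ.reg 12 := hb
    obtain ⟨i, rfl⟩ : ∃ i', i = i' + 1 := by
      refine Nat.exists_eq_succ_of_ne_zero ?_
      rintro rfl
      obtain rfl : j = C.k := by omega
      rw [k9, k12] at hb
      exact hb (congrArg (fun p => ((C.v p : Fin n) : ℕ)) (by linear_combination hz))
    have hji' : (j + (i + 1) : ZMod (2 * C.k + 1)) = C.k := by
      exact_mod_cast congrArg (Nat.cast (R := ZMod (2 * C.k + 1))) hji
    refine ⟨10 + (2 + (10 + 1)), 24 * i, by omega, ?_⟩
    refine Run.seq (run_visit hG.1.1 hadj C (by omega) (by omega) kS.arr_zero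
      kS.reg_five kS.reg_fifteen (by rw [k9]; push_cast; ring_nf) kT) ?_
    rintro τ' ⟨e, ex, eT⟩
    refine Run.seq (R := fun τ'' => τ''.arr = ρ.arr ∧ τ''.reg 14 = C.v (2 * j + 2 : ℕ) ∧
      τ''.reg 10 = i ∧ (∀ x, x ≠ 0 → x ≠ 3 → x ≠ 6 → x ≠ 13 → x ≠ 14 → x ≠ 10 →
        τ''.reg x = ρ.reg x) ∧ Tally C K (2 * j + 1) τ'') (Run.block (by simp) ?_) ?_
    · have k10' : τ'.reg 10 = i + 1 := by
        rw [ex _ (by omega) (by omega) (by omega) (by omega), k10]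
      refine ⟨e, ?_, ?_, fun x x0 x3 x6 x13 x14 x10 => ?_, ?_, ?_⟩
      · simp [Instr.run, k10', e, k6, g6 i (by omega)]
        exact congrArg (fun p => ((C.v p : Fin n) : ℕ)) (by linear_combination -2 * hji' - hz)
      · simp [Instr.run, k10']
      · simp [Instr.run, x10, x14, ex x x0 x3 x6 x13]
      · simp [Instr.run, eT.flag]
      · simp [Instr.run, eT.count]
    rintro τ'' ⟨e', e14, e10, ex', eT'⟩
    refine Run.seq (run_visit hG.1.1 hadj C (by omega) (by omega)
      (by rw [e', kS.arr_zero]) (by rw [ex', kS.reg_five] <;> omega)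
      (by rw [ex', kS.reg_fifteen] <;> omega) e14 eT') ?_
    rintro υ ⟨f, fx, fT⟩
    rw [e'] at f
    have f9 : υ.reg 9 = C.v (1 + 2 * j) := by
      rw [fx, ex', k9] <;> omega
    refine Run.instr ⟨kS.congr ?_ ?_ ?_ ?_ ?_ ?_, ?_, ?_, ?_, j + 1, i, by omega, rfl, ?_, ?_, ?_, ?_⟩
    iterate 3 simp [Instr.run, f]
    iterate 3 simp [Instr.run, fx, ex']
    · simp [Instr.run, f, k6]
    · simp [Instr.run, fx, ex', k1]
    · simp [Instr.run, fx, ex', k12]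
    · simp only [Instr.run, State.reg_setReg, if_true, f, f9, kS.searched.par]
      rw [(C.parent_v hG hr (by omega)).1]
    · simp [Instr.run, fx, e10]
    · simp only [Instr.run, State.reg_setReg, Nat.reduceEqDiff, if_false]
      exact fT.flag
    · simpa [Instr.run, mul_add] using fT.count
  · rintro υ ⟨hb, N, fS, -, f1, f12, j, i, hji, -, f9, -, fT⟩
    have hb : υ.reg 9 = υ.reg 12 := not_not.1 hb
    obtain rfl : j = C.k := by
      rw [f9, f12] at hb
      have h := C.inj (Fin.ext hb)
      by_contra hne
      have := cast_inj_of_lt (k := C.k) (i := 1 + 2 * j) (j := 0) (by omega) (by omega)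
        (by push_cast; exact h)
      omega
    refine ⟨fS, f1, ?_⟩
    rw [fT.count, Chart.waste, Finset.Ico_self, Finset.sum_empty, add_zero]

end Count
end OddCactus

namespace OddCactus

/-! ### All cycles, and the complete program -/

section Total

variable {n : ℕ} {G : SimpleGraph (Fin n)} {adj : Fin n → List (Fin n)}

theorem Chart.ncard_not_opener (C : Chart G) :
    {p | p ≠ 0 ∧ ¬ C.Opener p}.ncard = C.waste 0 := by
  classical
  simp_rw [Chart.waste, ← ite_not (p := Greedy _ _)]
  rw [← Finset.card_filter, ← Set.ncard_coe_finset]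
  symm
  refine Set.ncard_congr (fun i _ => (i : ZMod (2 * C.k + 1))) ?_ ?_ ?_
  · intro i hi
    simp only [Finset.coe_filter, Finset.mem_Ico, Set.mem_ofPred_eq] at hi
    refine ⟨fun h => ?_, ?_⟩
    · have := cast_inj_of_lt (k := C.k) (i := i) (j := 0) (by omega) (by omega) (by simpa using h)
      omega
    · rw [Chart.Opener, ZMod.val_cast_of_lt hi.1.2]; exact hi.2
  · intro i j hi hj h
    simp only [Finset.coe_filter, Finset.mem_Ico, Set.mem_ofPred_eq] at hi hj
    exact cast_inj_of_lt hi.1.2 hj.1.2 h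
  · rintro p ⟨hp, hp'⟩
    refine ⟨p.val, ?_, ZMod.natCast_zmod_val p⟩
    simp only [Finset.coe_filter, Finset.mem_Ico, Set.mem_ofPred_eq]
    exact ⟨⟨Nat.pos_of_ne_zero fun h => hp ((ZMod.val_eq_zero p).1 h), ZMod.val_lt p⟩, hp'⟩

theorem ncard_sigma {ι : Type*} [Fintype ι] {α : ι → Type*} [∀ i, Finite (α i)]
    (P : ∀ i, α i → Prop) : {x : Σ i, α i | P x.1 x.2}.ncard = ∑ i, {a | P i a}.ncard := by
  rw [← Nat.card_coe_set_eq, Nat.card_congr (show {x : Σ i, α i | P x.1 x.2} ≃ Σ i, {a | P i a} from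
    { toFun := fun x => ⟨x.1.1, x.1.2, x.2⟩
      invFun := fun x => ⟨⟨x.1, x.2.1⟩, x.2.2⟩
      left_inv := fun _ => rfl
      right_inv := fun _ => rfl }), Nat.card_sigma]
  rfl

noncomputable instance (r : Fin n) : Fintype (Hor G r) := Fintype.ofFinite _

theorem hor_injective (hG : IsOddCactus G) (r : Fin n) :
    Function.Injective fun h : Hor G r => h.1.1 := by
  rintro ⟨⟨a, b⟩, h1, h2, h3⟩ ⟨⟨a', b'⟩, h1', h2', h3'⟩ e
  obtain rfl : a = a' := e
  obtain rfl : b = b' := unique_mate hG h1 h1' h2 h2'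
  rfl

open Classical in
/-- Transport of a function on the edges of `Hor G r` to their smaller ends. -/
noncomputable def atEnd {r : Fin n} (f : Hor G r → ℕ) (i : ℕ) : ℕ :=
  if h : ∃ h : Hor G r, (h.1.1 : ℕ) = i then f h.choose else 0

theorem atEnd_apply (hG : IsOddCactus G) {r : Fin n} (f : Hor G r → ℕ) (h : Hor G r) :
    atEnd f h.1.1 = f h := by
  have hex : ∃ h' : Hor G r, (h'.1.1 : ℕ) = h.1.1 := ⟨h, rfl⟩
  rw [atEnd, dif_pos hex, hor_injective hG r (Fin.ext hex.choose_spec)]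

theorem sum_atEnd (hG : IsOddCactus G) {r : Fin n} (f : Hor G r → ℕ) :
    ∑ i ∈ Finset.Ico 0 n, atEnd f i = ∑ h, f h := by
  symm
  refine Finset.sum_of_injOn (fun h => (h.1.1 : ℕ)) ?_ ?_ ?_ ?_
  · intro h _ h' _ e
    exact hor_injective hG r (Fin.ext e)
  · intro h _
    simp
  · intro i _ hi
    rw [atEnd, dif_neg]
    rintro ⟨h, rfl⟩
    exact hi ⟨h, by simp, rfl⟩
  · intro h _
    exact (atEnd_apply hG f h).symm

/-- Processes all cycles, starting from register `0` containing the number of vertices. -/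
def processCycles : Prog :=
  .seq (.block (.const 1 0) [.move 2 0, .dec 0])
    (.loop (.lt 1 2) (.seq (.instr (.load 9 5 1))
      (.seq (.ite (.lt 1 9) processCycle (.instr (.move 9 9))) (.instr (.inc 1)))))

theorem run_processCycles (hG : IsOddCactus G) (hadj : IsAdjList G adj) {r : Fin n}
    (hr : (G.neighborSet r).ncard ≠ 2) {σ : State} (hF : Frame adj σ)
    (hS : Searched hG.1.1 r σ) :
    Run processCycles σ (39 * n + 4) fun τ => τ.reg 0 = (rootedSystem hG r hr).key.ncard := by
  set K := (rootedSystem hG r hr).key.ncard with hK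
  -- Each cycle is charged to the smaller end of its horizontal edge, where the loop over the
  -- vertices processes it.
  set cost : ℕ → ℕ := atEnd fun h : Hor G r => (horChart hG h).waste 0
  set size : ℕ → ℕ := atEnd fun h : Hor G r => (horChart hG h).k
  have htotal : n - 1 = K + ∑ i ∈ Finset.Ico 0 n, cost i := by
    have h1 := ncard_key_add hG r hr
    have h2 := ncard_sigma (ι := Hor G r) (α := fun h => ZMod (2 * (horChart hG h).k + 1))
      fun h p => p ≠ 0 ∧ ¬ (horChart hG h).Opener p
    simp_rw [Chart.ncard_not_opener] at h2
    rw [← sum_atEnd hG] at h2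
    have h3 : {x | x.2 ≠ 0 ∧ ¬ (rootedSystem hG r hr).Opener x}.ncard =
        ∑ i ∈ Finset.Ico 0 n, cost i := h2
    rw [h3, Nat.card_fin] at h1
    omega
  -- A cycle has `2k ≥ k` positions other than its base, and over all cycles there are fewer than
  -- `n` of these.
  have hsize : ∑ i ∈ Finset.Ico 0 n, size i ≤ n := by
    have h1 := (ncard_not_base hG r hr).1
    have h2 := ncard_sigma (ι := Hor G r) (α := fun h => ZMod (2 * (horChart hG h).k + 1))
      fun h p => p ≠ 0
    rw [h2, Nat.card_fin] at h1
    rw [sum_atEnd hG]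
    refine (Finset.sum_le_sum fun h _ => ?_).trans ((Nat.le_succ _).trans h1)
    have h3 := Set.ncard_add_ncard_compl ({0} : Set (ZMod (2 * (horChart hG h).k + 1)))
    rw [Set.ncard_singleton, Nat.card_zmod] at h3
    have h4 : {p : ZMod (2 * (horChart hG h).k + 1) | p ≠ 0} = {0}ᶜ := rfl
    rw [h4]
    omega
  have hlt : 0 < n := r.pos
  refine (Run.seq (S := 3) (T := ∑ i ∈ Finset.Ico 0 n, (29 * size i + 10) + 1) (R := fun τ =>
    Settled adj hG.1.1 r τ ∧ τ.reg 1 = 0 ∧ τ.reg 0 = n - 1) (Run.block (by simp) ?_) ?_).mono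
    ?_ fun _ => id
  · refine ⟨⟨hF.arr_zero, ⟨hS.par, hS.scanned, hS.mate⟩, ?_, ?_, ?_⟩, ?_, ?_⟩ <;>
      simp [Instr.run, hF.reg_zero, hF.reg_five, hF.reg_fifteen]
  · rintro τ ⟨gS, g1, g0⟩
    refine (Run.loop (I := fun N τ => Settled adj hG.1.1 r τ ∧ τ.reg 1 ≤ n ∧
      N = ∑ i ∈ Finset.Ico (τ.reg 1) n, (29 * size i + 10) ∧
      τ.reg 0 = K + ∑ i ∈ Finset.Ico (τ.reg 1) n, cost i) ?_ _ τ
      ⟨gS, by omega, by rw [g1], by rw [g0, g1, htotal]⟩).mono le_rfl ?_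
    · clear! σ τ
      rintro N σ ⟨hS, h1, rfl, h0⟩ hb
      have hb : σ.reg 1 < σ.reg 2 := hb
      rw [hS.reg_two] at hb
      obtain ⟨x, hx⟩ : ∃ x : Fin n, (x : ℕ) = σ.reg 1 := ⟨⟨_, hb⟩, rfl⟩
      rw [Finset.sum_eq_sum_Ico_succ_bot hb] at h0 ⊢
      refine ⟨1 + (29 * size (σ.reg 1) + 6 + 1 + 1), ∑ i ∈ Finset.Ico (σ.reg 1 + 1) n, (29 * size i + 10), by omega, ?_⟩
      refine Run.step (Run.seq (S := 29 * size (σ.reg 1) + 6 + 1)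
        (R := fun τ => Settled adj hG.1.1 r τ ∧ τ.reg 1 = σ.reg 1 ∧
        τ.reg 0 = K + ∑ i ∈ Finset.Ico (σ.reg 1 + 1) n, cost i)
        (Run.ite (T := 29 * size (σ.reg 1) + 6) (fun hm => ?_) fun hm => ?_) ?_)
      · have hm : σ.reg 1 < σ.arr 5 (σ.reg 1) := by simpa [Test.holds, Instr.run] using hm
        rw [← hx] at hm
        obtain ⟨y, hy, hyx, hd⟩ := hS.searched.mate x (by omega)
        rw [hy] at hm
        let h : Hor G r := ⟨(x, y), hyx.symm, hd.symm, hm⟩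
        have hcost : cost (σ.reg 1) = (horChart hG h).waste 0 := by
          rw [← hx]; exact atEnd_apply hG _ h
        have hsz : 29 * size (σ.reg 1) + 6 = 29 * (horChart hG h).k + 6 := by
          rw [← hx]; exact congrArg (29 * · + 6) (atEnd_apply hG _ h)
        refine (run_processCycle hG hadj (horChart hG h) (horChart_π hG h)
          (σ := Instr.run σ (.load 9 5 1)) (K := K + ∑ i ∈ Finset.Ico (σ.reg 1 + 1) n, cost i)
          (hS.congr rfl rfl rfl ?_ ?_ ?_) ?_ ?_ ?_).mono hsz.symm.le ?_
        iterate 3 simp [Instr.run]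
        · rw [horChart_neg_one]
          simp [Instr.run, ← hx, h]
        · rw [horChart_one]
          simp [Instr.run, ← hx, hy, h]
        · simp [Instr.run, h0, hcost]
          omega
        · rintro τ ⟨gS, g1, g0⟩
          exact ⟨gS, g1, g0⟩
      · have hm : ¬ σ.reg 1 < σ.arr 5 (σ.reg 1) := by simpa [Test.holds, Instr.run] using hm
        have hcost : cost (σ.reg 1) = 0 := by
          refine dif_neg ?_
          rintro ⟨h, hh⟩
          rw [← hh, hS.searched.scanned _ _ h.2.1.symm h.2.2.1.symm] at hm
          exact hm h.2.2.2
        rw [hcost, zero_add] at h0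
        refine (Run.instr ⟨hS.congr rfl rfl rfl ?_ ?_ ?_, ?_, ?_⟩).mono (by omega) fun _ => id <;>
          simp [Instr.run, h0]
      · rintro τ ⟨gS, g1, g0⟩
        refine Run.instr ⟨gS.congr rfl rfl rfl ?_ ?_ ?_, ?_, ?_, ?_⟩
        iterate 3 simp [Instr.run]
        · simp [Instr.run, g1]; omega
        · simp [Instr.run, g1]
        · simp [Instr.run, g1, g0]
    · rintro τ ⟨hb, N, gS, g1, -, g0⟩
      have hb : ¬ τ.reg 1 < τ.reg 2 := hb
      rw [gS.reg_two] at hb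
      rw [g0, Finset.Ico_eq_empty (by omega), Finset.sum_empty, add_zero]
  · rw [Finset.sum_add_distrib, ← Finset.mul_sum]
    simp only [Finset.sum_const, Nat.card_Ico, smul_eq_mul]
    omega

/-- The program that evaluates the formula. -/
def formulaProgram : Prog :=
  .seq findRoot (.seq (.instr (.const 5 0))
    (.ite (.eq 4 5) cycleValue (.seq search processCycles)))

theorem run_formulaProgram (hG : IsOddCactus G) (hadj : IsAdjList G adj) :
    Run formulaProgram (inputState adj) (200 * n) fun τ => (τ.reg 0 : ℚ) = formula G := by
  have hn : 0 < n := by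
    obtain ⟨x⟩ := hG.1.1.nonempty
    exact x.pos
  -- With at most `2n` edges the search takes `45n + 9` steps and the cycles take `39n + 4`; the
  -- constants are absorbed because `n ≥ 1`.
  refine (Run.seq (run_findRoot hadj) (T := 1 + (84 * n + 13 + 1)) ?_).mono
    (by omega) fun _ => id
  rintro τ ⟨harr, h0, h4⟩
  refine Run.step (Run.ite (T := 84 * n + 13) (fun hb => ?_) fun hb => ?_)
  · have hb : τ.reg 4 = 0 := by simpa [Test.holds, Instr.run] using hb
    obtain ⟨-, h2⟩ | ⟨v, hv, -⟩ := h4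
    · obtain ⟨ho, h3, hf⟩ := formula_of_forall hG h2
      rw [Nat.card_fin] at ho h3 hf
      have h0' : (Instr.run τ (.const 5 0)).reg 0 = n := by simp [Instr.run, h0]
      refine (run_cycleValue (by rwa [h0'])).mono (by rw [h0']; omega) fun ρ hρ => ?_
      rw [hρ, hf, h0']
      split_ifs
      · simp
      · obtain ⟨k, rfl⟩ := ho
        rw [show (2 * k + 1 + 1) / 2 = k + 1 by omega]
        push_cast
        ring
    · omega
  · have hb : τ.reg 4 ≠ 0 := by simpa [Test.holds, Instr.run] using hb
    obtain ⟨h, -⟩ | ⟨r, h4, hr⟩ := h4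
    · exact absurd h hb
    have hm := (ncard_not_base hG r hr).2
    rw [Nat.card_fin] at hm
    refine (Run.seq (run_search hG hadj (r := r) (σ := Instr.run τ (.const 5 0)) harr (by simp [Instr.run, h0])
      (by simp [Instr.run, h4])) fun ρ hρ => (run_processCycles hG hadj hr hρ.1 hρ.2)).mono
      (by omega) fun υ hυ => ?_
    rw [hυ, formula_of_exists hG _ hr]

end Total
end OddCactus

/-- For every finite odd cactus, the strong rainbow connection number is given by the formula, and
some program evaluates the formula for odd cacti on `n` vertices, given by adjacency lists, in
`O(n)` steps (the result is left in register `0`). -/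
theorem mainTheorem1 :
    (∀ (V : Type*) [Finite V] (G : SimpleGraph V), OddCactus.IsOddCactus G →
      (OddCactus.src G : ℚ) = OddCactus.formula G) ∧
    (∃ (P : OddCactus.Prog) (C : ℕ), ∀ (n : ℕ) (G : SimpleGraph (Fin n)),
      OddCactus.IsOddCactus G → ∀ adj : Fin n → List (Fin n), OddCactus.IsAdjList G adj →
        ∃ (t : ℕ) (τ : OddCactus.State),
          OddCactus.Exec P (OddCactus.inputState adj) t τ ∧ t ≤ C * n ∧
            (τ.reg 0 : ℚ) = OddCactus.formula G) := by
  refine ⟨fun V _ G hG => OddCactus.src_eq_formula hG, OddCactus.formulaProgram, 200,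
    fun n G hG adj hadj => ?_⟩
  obtain ⟨t, τ, h1, h2, h3⟩ := OddCactus.run_formulaProgram hG hadj
  exact ⟨t, τ, h1, h2, h3⟩
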